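/- Let $f_1\colon\widehat{\mathbb C}\to\widehat{\mathbb C}$ be the postcritically-finite rational map $$f_1(z)=\frac{2\,(z^2-\tfrac34)^3}{z^2\,(z^2-\tfrac98)^2}-1 ,$$ and let $\operatorname{post}(f_1)=\bigcup_{n\ge 1}f_1^n(\operatorname{crit}(f_1))$ be its postcritical set. Fix a basepoint $t$ in the open upper half-plane. Then $t\notin\operatorname{post}(f_1)$. Let $\mathbf T=\bigsqcup_{n\ge 0}f_1^{-n}(t)$ be the dynamical preimage tree, rooted at $t$, in which the parent of $p\in f_1^{-(n+1)}(t)$ is $f_1(p)\in f_1^{-n}(t)$. A loop $\gamma$ in $\widehat{\mathbb C}\setminus\operatorname{post}(f_1)$ based at $t$ acts on $\mathbf T$ (from the right) by sending $p\in f_1^{-n}(t)$ to the endpoint of the $f_1^n$-lift of $\gamma$ that starts at $p$; the iterated monodromy group $G=\operatorname{IMG}(f_1)<\operatorname{Aut}(\mathbf T)$ is the group of all automorphisms obtained in this way. Let $b,c\in G$ be given by loops that go from $t$ inside the upper half-plane to a circle of radius less than $2$ around $1$, respectively $-1$, traverse this circle once counterclockwise, and return to $t$ along the same path; each of these two loops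 induces a unique automorphism of $\mathbf T$. Put $X=\{1,\dots,6\}$, number the points of $f_1^{-1}(t)=\{t_1,\dots,t_6\}$ in any way, and join $t$ to $t_j$ by a path $\ell_j$ in $\widehat{\mathbb C}\setminus([-\infty,-1]\cup[1,\infty])$. There is a unique isomorphism of rooted trees $\Lambda\colon X^*\to\mathbf T$ such that, for every letter $x\in X$ and every word $v\in X^n$, the vertex $\Lambda(xv)$ is the endpoint of the $f_1^n$-lift of $\ell_x$ that starts at $\Lambda(v)$. Identify $\mathbf T$ with the tree of words $X^*$ through $\Lambda$, and let $$\psi\colon\operatorname{Aut}(X^*)\to\operatorname{Aut}(X^*)^X\rtimes\Sigma(X),\qquad \psi(g)=\big((g|_x)_{x\in X},\sigma_g\big),$$ be the wreath recursion, where $(xv)^g=x^{\sigma_g}\,v^{\,g|_x}$ for all $x\in X$, $v\in X^*$. Then $G$ is a regular branch group over the normal closure $$H=\langle [b^2,c]^g : g\in G\rangle ,\qquad [g,h]=g^{-1}h^{-1}gh,\quad k^g=g^{-1}kg .$$ That is: $G$ is self-similar (for all $g\in G$, $x\in X$ there are $h\in G$, $y\in X$ with $(xv)^g=y\,v^h$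 for all $v\in X^*$), $H$ is a subgroup of finite index in $G$, and $H^6=H^X<\psi(H)$, where $H^X$ is viewed as a subgroup of the base group $\operatorname{Aut}(X^*)^X$. -/

import Mathlib

open scoped unitInterval Topology

/-! ### Rooted trees, given by their parent maps, and their automorphism groups -/

/-- An isomorphism between two rooted trees. A rooted tree is given by its vertex set together with
the map that sends a vertex to its parent and fixes the root; a bijection is an isomorphism of
rooted trees iff it commutes with the parent maps. -/
@[ext]
structure RootedTreeIso {V W : Type*} (par : V → V) (par' : W → W) where
  toEquiv : V ≃ W
  map_parent : ∀ v, toEquiv (par v) = par' (toEquiv v)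

namespace RootedTreeIso

variable {V W U : Type*} {par : V → V} {par' : W → W} {par'' : U → U}

instance : CoeFun (RootedTreeIso par par') (fun _ => V → W) := ⟨fun g => g.toEquiv⟩

def refl (par : V → V) : RootedTreeIso par par := ⟨Equiv.refl V, fun _ => rfl⟩

/-- First `g`, then `h`. -/
def trans (g : RootedTreeIso par par') (h : RootedTreeIso par' par'') : RootedTreeIso par par'' :=
  ⟨g.toEquiv.trans h.toEquiv, fun v => by simp [g.map_parent, h.map_parent]⟩

def symm (g : RootedTreeIso par par') : RootedTreeIso par' par :=
  ⟨g.toEquiv.symm, fun v => by rw [Equiv.symm_apply_eq]; simp [g.map_parent]⟩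

end RootedTreeIso

/-- The automorphism group of a rooted tree. -/
abbrev TreeAut {V : Type*} (par : V → V) := RootedTreeIso par par

/-- Automorphisms act on the right: in a product `g * h` the factor `g` acts first. -/
instance TreeAut.instGroup {V : Type*} (par : V → V) : Group (TreeAut par) where
  mul g h := g.trans h
  one := RootedTreeIso.refl par
  inv g := g.symm
  mul_assoc _ _ _ := rfl
  one_mul _ := rfl
  mul_one _ := rfl
  inv_mul_cancel g := RootedTreeIso.ext (Equiv.symm_trans_self g.toEquiv)

theorem TreeAut.mul_apply {V : Type*} {par : V → V} (g h : TreeAut par) (v : V) :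
    (g * h) v = h (g v) := rfl

theorem TreeAut.one_apply {V : Type*} {par : V → V} (v : V) : (1 : TreeAut par) v = v := rfl

theorem TreeAut.inv_apply_self {V : Type*} {par : V → V} (g : TreeAut par) (v : V) :
    g⁻¹ (g v) = v := g.toEquiv.symm_apply_apply v

theorem TreeAut.apply_inv_self {V : Type*} {par : V → V} (g : TreeAut par) (v : V) :
    g (g⁻¹ v) = v := g.toEquiv.apply_symm_apply v

/-- The identification of automorphism groups that is induced by an identification of trees. -/
def TreeAut.pullback {V W : Type*} {par : V → V} {par' : W → W} (e : RootedTreeIso par par') :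
    TreeAut par' →* TreeAut par where
  toFun g := (e.trans g).trans e.symm
  map_one' := RootedTreeIso.ext (Equiv.self_trans_symm e.toEquiv)
  map_mul' g h := RootedTreeIso.ext (Equiv.ext fun v => by
    change e.toEquiv.symm (h (g (e v))) =
      e.toEquiv.symm (h (e.toEquiv (e.toEquiv.symm (g (e v)))))
    rw [Equiv.apply_symm_apply])

/-! ### The tree of words, wreath recursion, self-similar and regular branch groups -/

/-- The automorphism group of the tree of words `X^*`: the root is the empty word, and the parent
of `v x` (with `x` a letter) is `v`. -/
abbrev WordAut (X : Type*) := TreeAut (List.dropLast : List X → List X)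

namespace WordAut

variable {X : Type*}

theorem apply_nil (g : WordAut X) : g [] = [] := by
  have h : g [] = (g []).dropLast := g.map_parent []
  have h2 := congrArg List.length h
  rw [List.length_dropLast] at h2
  exact List.length_eq_zero_iff.mp (by omega)

theorem length_apply (g : WordAut X) (v : List X) : (g v).length = v.length := by
  induction v using List.reverseRecOn with
  | nil => rw [apply_nil]
  | append_singleton v x ih =>
    have h : g (v ++ [x]).dropLast = (g (v ++ [x])).dropLast := g.map_parent _
    rw [List.dropLast_concat] at h
    have h2 := congrArg List.length h
    rw [List.length_dropLast, ih] at h2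
    have h3 : g (v ++ [x]) ≠ [] := fun h0 => by
      have : v ++ [x] = [] := g.toEquiv.injective (h0.trans (apply_nil g).symm)
      simp at this
    have h4 := List.length_pos_iff.mpr h3
    simp only [List.length_append, List.length_singleton]
    omega

theorem exists_apply_singleton (g : WordAut X) (x : X) : ∃ y, g [x] = [y] :=
  List.length_eq_one_iff.mp (length_apply g [x])

/-- The image of a letter under the action of `g` on the first level. -/
noncomputable def letter (g : WordAut X) (x : X) : X := (exists_apply_singleton g x).choose

theorem apply_singleton (g : WordAut X) (x : X) : g [x] = [letter g x] :=
  (exists_apply_singleton g x).choose_spec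

theorem apply_cons (g : WordAut X) (x : X) (u : List X) :
    g (x :: u) = letter g x :: (g (x :: u)).tail := by
  induction u using List.reverseRecOn with
  | nil => rw [apply_singleton]; rfl
  | append_singleton u z ih =>
    have h : g (x :: (u ++ [z])).dropLast = (g (x :: (u ++ [z]))).dropLast := g.map_parent _
    rw [← List.cons_append, List.dropLast_concat, ih] at h
    cases hg : g (x :: u ++ [z]) with
    | nil => rw [hg] at h; simp at h
    | cons y w =>
      rw [hg] at h
      cases w with
      | nil => simp at h
      | cons y' w' =>
        rw [List.dropLast_cons_cons] at h
        rw [← List.cons_append, hg, (List.cons.inj h).1, List.tail_cons]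

theorem letter_mul (g h : WordAut X) (x : X) : letter (g * h) x = letter h (letter g x) := by
  have := apply_singleton (g * h) x
  rw [TreeAut.mul_apply, apply_singleton, apply_singleton] at this
  exact (List.cons.inj this).1.symm

theorem letter_one (x : X) : letter (1 : WordAut X) x = x := by
  have := apply_singleton (1 : WordAut X) x
  rw [TreeAut.one_apply] at this
  exact (List.cons.inj this).1.symm

/-- The permutation of the alphabet equal to the action of `g` on the first level. -/
noncomputable def perm (g : WordAut X) : Equiv.Perm X where
  toFun := letter g
  invFun := letter g⁻¹
  left_inv x := by rw [← letter_mul, mul_inv_cancel, letter_one]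
  right_inv x := by rw [← letter_mul, inv_mul_cancel, letter_one]

/-- The restriction `g|_x` of `g` to the subtree below the letter `x`, characterised by
`g (x :: u) = perm g x :: restrict g x u`. -/
noncomputable def restrict (g : WordAut X) (x : X) : WordAut X where
  toEquiv :=
    { toFun := fun u => (g (x :: u)).tail
      invFun := fun u => (g⁻¹ (letter g x :: u)).tail
      left_inv := fun u => by
        change (g⁻¹ (letter g x :: (g (x :: u)).tail)).tail = u
        rw [← apply_cons, TreeAut.inv_apply_self, List.tail_cons]
      right_inv := fun u => by
        change (g (x :: (g⁻¹ (letter g x :: u)).tail)).tail = u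
        have h : g⁻¹ (letter g x :: u) = x :: (g⁻¹ (letter g x :: u)).tail := by
          conv_lhs => rw [apply_cons, ← letter_mul, mul_inv_cancel, letter_one]
        rw [← h, TreeAut.apply_inv_self, List.tail_cons] }
  map_parent u := by
    change (g (x :: u.dropLast)).tail = (g (x :: u)).tail.dropLast
    induction u using List.reverseRecOn with
    | nil => simp [apply_singleton]
    | append_singleton u z _ =>
      have h : g (x :: (u ++ [z])).dropLast = (g (x :: (u ++ [z]))).dropLast := g.map_parent _
      rw [← List.cons_append, List.dropLast_concat] at h
      rw [List.dropLast_concat, h, ← List.cons_append, List.tail_dropLast]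

theorem apply_cons_eq (g : WordAut X) (x : X) (u : List X) :
    g (x :: u) = perm g x :: restrict g x u := apply_cons g x u

theorem restrict_mul (g h : WordAut X) (x : X) :
    restrict (g * h) x = restrict g x * restrict h (perm g x) := by
  refine RootedTreeIso.ext (Equiv.ext fun u => ?_)
  have h1 := apply_cons_eq (g * h) x u
  rw [TreeAut.mul_apply, apply_cons_eq, apply_cons_eq] at h1
  exact (List.cons.inj h1).2.symm

theorem restrict_one (x : X) : restrict (1 : WordAut X) x = 1 := rfl

/-- The action of permutations `s` of the alphabet on `X`-tuples,
`(h_x)_x ↦ (h_{s x})_x`. The group of permutations is the opposite of `Equiv.Perm X`, so that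
in a product the first factor acts first. -/
def permAction (X A : Type*) [Group A] : (Equiv.Perm X)ᵐᵒᵖ →* MulAut (X → A) where
  toFun s :=
    { toFun := fun h x => h (s.unop x)
      invFun := fun h x => h (s.unop.symm x)
      left_inv := fun h => by ext; simp
      right_inv := fun h => by ext; simp
      map_mul' := fun _ _ => rfl }
  map_one' := rfl
  map_mul' _ _ := rfl

/-- The wreath recursion `ψ : Aut(X^*) → Aut(X^*)^X ⋊ Σ(X)`, `g ↦ ⟨⟨g|_x⟩⟩_x σ_g`. -/
noncomputable def wreathRecursion (X : Type*) :
    WordAut X →* (X → WordAut X) ⋊[permAction X (WordAut X)] (Equiv.Perm X)ᵐᵒᵖ where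
  toFun g := ⟨restrict g, MulOpposite.op (perm g)⟩
  map_one' := by
    refine SemidirectProduct.ext (funext restrict_one) (MulOpposite.unop_injective ?_)
    exact Equiv.ext letter_one
  map_mul' g h := by
    refine SemidirectProduct.ext (funext (restrict_mul g h)) (MulOpposite.unop_injective ?_)
    exact Equiv.ext (letter_mul g h)

end WordAut

/-- A group `G < Aut(X^*)` is self-similar if for every `g ∈ G` and every letter `x` there are
`h ∈ G` and a letter `y` with `(x v)^g = y (v)^h` for all words `v`. -/
def IsSelfSimilar {X : Type*} (G : Subgroup (WordAut X)) : Prop :=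
  ∀ g ∈ G, ∀ x : X, ∃ h ∈ G, ∃ y : X, ∀ v : List X, g (x :: v) = y :: h v

/-- `G` is a regular branch group over `H`: `G` is self-similar, `H` is a subgroup of `G` of finite
index, and `H^X < ψ(H)`, where `ψ` is the wreath recursion. -/
def IsRegularBranchOver {X : Type*} (G H : Subgroup (WordAut X)) : Prop :=
  IsSelfSimilar G ∧ H ≤ G ∧ (H.subgroupOf G).FiniteIndex ∧
    (Subgroup.pi Set.univ fun _ : X => H).map SemidirectProduct.inl ≤
      H.map (WordAut.wreathRecursion X)

/-- The commutator in the convention `[g, h] = g⁻¹ h⁻¹ g h`. -/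
def rightCommutator {A : Type*} [Group A] (g h : A) : A := g⁻¹ * h⁻¹ * g * h

/-- The normal closure `⟨k^g : g ∈ G⟩` in `G`, where `k^g = g⁻¹ k g`. -/
def normalClosureIn {A : Type*} [Group A] (G : Subgroup A) (k : A) : Subgroup A :=
  Subgroup.closure {x | ∃ g ∈ G, x = g⁻¹ * k * g}

/-! ### Iterated monodromy groups -/

section IteratedMonodromy

variable {S : Type*} [TopologicalSpace S]

/-- The critical points of a branched covering: the points of local degree at least two, that is,
the points near which the map is not injective. -/
def criticalPoints (f : S → S) : Set S := {p | ∀ U ∈ 𝓝 p, ¬ Set.InjOn f U}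

/-- The union of `f^n (crit f)` over all `n ≥ 1`. -/
def postcriticalSet (f : S → S) : Set S := ⋃ n ≥ 1, f^[n] '' criticalPoints f

/-- The vertices of the dynamical preimage tree of `f` at `t`: the formal disjoint union of the
sets `f^{-n}(t)`. -/
abbrev PreimageTree {S : Type*} (f : S → S) (t : S) : Type _ := Σ n : ℕ, {p : S // f^[n] p = t}

/-- The parent of a vertex `p ∈ f^{-(n+1)}(t)` is `f p ∈ f^{-n}(t)`. -/
def PreimageTree.parent {S : Type*} (f : S → S) (t : S) : PreimageTree f t → PreimageTree f t
  | ⟨0, p⟩ => ⟨0, p⟩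
  | ⟨n + 1, p⟩ => ⟨n, ⟨f p.1, p.2⟩⟩

/-- `γ` has an `f^n`-lift that starts at `p` and ends at `q`. -/
def LiftConnects (f : S → S) (n : ℕ) {x y : S} (γ : Path x y) (p q : S) : Prop :=
  ∃ γ' : Path p q, ∀ s : I, f^[n] (γ' s) = γ s

/-- `g` is the automorphism of the dynamical preimage tree that is induced by the loop `γ`: a vertex
`p ∈ f^{-n}(t)` is mapped to the endpoint in `f^{-n}(t)` of the `f^n`-lift of `γ` that starts
at `p`. -/
def IsMonodromy {f : S → S} {t : S} (γ : Path t t) (g : TreeAut (PreimageTree.parent f t)) : Prop :=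
  ∀ (n : ℕ) (p : {p : S // f^[n] p = t}), ∃ q : {q : S // f^[n] q = t},
    g ⟨n, p⟩ = ⟨n, q⟩ ∧ LiftConnects f n γ p.1 q.1

/-- The iterated monodromy group of `f`, as the group of those automorphisms of the dynamical
preimage tree that are induced by loops in the complement of the postcritical set. -/
def IMG (f : S → S) (t : S) (ht : t ∉ postcriticalSet f) :
    Subgroup (TreeAut (PreimageTree.parent f t)) where
  carrier := {g | ∃ γ : Path t t, (∀ s, γ s ∉ postcriticalSet f) ∧ IsMonodromy γ g}
  one_mem' := ⟨Path.refl t, fun _ => ht, fun _ p => ⟨p, rfl, Path.refl p.1, fun _ => p.2⟩⟩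
  mul_mem' := by
    rintro g h ⟨γ, hγ, hg⟩ ⟨δ, hδ, hh⟩
    refine ⟨γ.trans δ, fun s => ?_, fun n p => ?_⟩
    · have hs : γ.trans δ s ∈ Set.range (γ.trans δ) := ⟨s, rfl⟩
      rw [Path.trans_range] at hs
      rcases hs with ⟨u, hu⟩ | ⟨u, hu⟩
      · exact hu ▸ hγ u
      · exact hu ▸ hδ u
    · obtain ⟨q, hq, γ', h1⟩ := hg n p
      obtain ⟨r, hr, δ', h2⟩ := hh n q
      refine ⟨r, by rw [TreeAut.mul_apply, hq, hr], γ'.trans δ', fun s => ?_⟩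
      rw [Path.trans_apply, Path.trans_apply]
      split_ifs
      · exact h1 _
      · exact h2 _
  inv_mem' := by
    rintro g ⟨γ, hγ, hg⟩
    refine ⟨γ.symm, fun s => hγ _, fun n p => ?_⟩
    obtain ⟨m, p', hm⟩ : ∃ m p', g⁻¹ ⟨n, p⟩ = (⟨m, p'⟩ : PreimageTree f t) := ⟨_, _, rfl⟩
    obtain ⟨q, hq, γ', h1⟩ := hg m p'
    have h2 : (⟨m, q⟩ : PreimageTree f t) = ⟨n, p⟩ := by
      rw [← hq, ← hm, TreeAut.apply_inv_self]
    obtain rfl : m = n := congrArg Sigma.fst h2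
    obtain rfl : q = p := eq_of_heq (Sigma.mk.inj h2).2
    exact ⟨p', hm, γ'.symm, fun s => h1 _⟩

/-- `Λ` is the labeling of the dynamical preimage tree by words that is defined by the
connecting paths `ℓ x` from `t` to the points `τ x` of `f^{-1}(t)`: for a word `v` of length `n`,
the vertex with label `x v` is the endpoint of the `f^n`-lift of `ℓ x` that starts at the vertex
with label `v`. -/
def IsLabeling {f : S → S} {t : S} {X : Type*} {τ : X → S} (ℓ : ∀ x, Path t (τ x))
    (Λ : RootedTreeIso (List.dropLast : List X → List X) (PreimageTree.parent f t)) : Prop :=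
  ∀ (x : X) (v : List X), ∃ (p : {p : S // f^[v.length] p = t})
    (q : {q : S // f^[v.length + 1] q = t}),
    Λ v = ⟨v.length, p⟩ ∧ Λ (x :: v) = ⟨v.length + 1, q⟩ ∧
      LiftConnects f v.length (ℓ x) p.1 q.1

end IteratedMonodromy

/-! ### The map, its connecting paths and the loops -/

/-- The rational map `f₁(z) = 2 (z² - 3/4)³ / (z² (z² - 9/8)²) - 1` on the Riemann sphere. -/
noncomputable def f₁ : OnePoint ℂ → OnePoint ℂ := fun p =>
  p.elim ((1 : ℂ) : OnePoint ℂ) fun z =>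
    if z ^ 2 * (z ^ 2 - 9 / 8) ^ 2 = 0 then OnePoint.infty
    else ((2 * (z ^ 2 - 3 / 4) ^ 3 / (z ^ 2 * (z ^ 2 - 9 / 8) ^ 2) - 1 : ℂ) : OnePoint ℂ)

/-- The subset `[-∞, -1] ∪ [1, ∞]` of the Riemann sphere. -/
def realSlits : Set (OnePoint ℂ) :=
  {OnePoint.infty} ∪ (fun z : ℂ => (z : OnePoint ℂ)) '' {z | z.im = 0 ∧ 1 ≤ |z.re|}

/-- The circle around `w` through `z`, traversed once counterclockwise. -/
noncomputable def circlePath (w z : ℂ) : Path z z where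
  toFun s := w + (z - w) * Complex.exp (2 * Real.pi * (s : ℝ) * Complex.I)
  continuous_toFun := by fun_prop
  source' := by simp
  target' := by simp

/-- The loop in the Riemann sphere that follows `δ` from `t` to `z`, traverses the circle around `w`
through `z` once counterclockwise, and returns along `δ`. -/
noncomputable def loopAround (w : ℂ) {t z : ℂ} (δ : Path t z) :
    Path (t : OnePoint ℂ) (t : OnePoint ℂ) :=
  ((δ.trans (circlePath w z)).trans δ.symm).map OnePoint.continuous_coe

/-!
The critical values of `f₁` are `1`, `-1` and `∞`, and `f₁` maps these three points to `1`, `1` and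
`1`; so the postcritical set is `{1, -1, ∞}` (`postcriticalSet_f₁`). Over its complement `f₁` is a
covering, because it is a local homeomorphism there and the sphere is compact
(`isCoveringMapOn_f₁`).

The plane slit along two of the three intervals `(-∞, -1]`, `[-1, 1]`, `[1, ∞)` is simply connected.
Hence every vertex `v` of the preimage tree, of level `n` say, extends to a branch of the inverse of
`f₁^n` on each of the three slit planes (`branch`). On the upper half-plane the three branches of
`v` agree. On the lower half-plane the branch of `v` on one slit plane is the branch of another
vertex on another slit plane, namely of the image of `v` under the monodromy of a loop that
passes through the two intervals (`IsMonodromy.eqOn_branch`). Since every path in the complement of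
the postcritical set is made of pieces in slit planes, the two loops `b` and `c` around `1` and `-1`
generate the iterated monodromy group (`IsMonodromy.mem_closure`).

In the coordinate `w = z² = u + iv` the imaginary part of `f₁(z)` has the sign of `v` times an
explicit polynomial, which cuts the preimage of the upper half-plane into six pieces `A, …, F`
(`tileSet`), one for each preimage of the basepoint; the preimage of the lower half-plane consists
of their complex conjugates. A branch of level one on a slit plane starts in one of the pieces and
passes to the conjugate of another one, which is found by looking at one explicit point on each of
the three intervals (`IsBranch.mem_tileSet_cross`). A branch of level `n + 1` is a branch of level
`n` after one of level one (`branch_graft`), and comparing these compositions gives the wreath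
recursion of `b` and `c` (`isGeneratingPair_pullback`):
`b` fixes `A` and `D`, with sections `b` and `c`, and permutes `B → F → E → C → B`, with sections
`b⁻¹, 1, c⁻¹, 1`; and `c` permutes `A → B → F → A` and `C → D → E → C`, with trivial sections.

The rest is algebra. The recursion gives `c³ = (cb)² = b²⁴ = 1`. Modulo the normal closure `H` of
`[b², c]` the element `b²` is central, so that the quotient consists of the classes of the `bⁱcʲ`
and is finite (`finite_of_commute_sq`). Let `K` be the normal subgroup of all `k` such that
`H` contains an element that acts as `k` below `A` and trivially elsewhere. A conjugate `y` of `b¹⁶`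
has the sections `c` at `A`, `b¹⁶` at `D`, and trivial ones elsewhere; as `b³` has the section
`c³ = 1` at `D`, the element `[y, b³]` of `H` shows that `[c, b³]` is in `K`. Together with the
relation that `b⁸` commutes with its conjugate by `c`, this makes `b` and `c` commute modulo `K`
(`commute_of_commute_cube`). So `K` contains `[b², c]` and therefore `H`, and as the group acts
transitively on the letters, `H^X` lies in `ψ(H)` (`IsGeneratingPair.isRegularBranchOver`).
-/

/-! ### Two facts on groups with two generators -/

section TwoGenerators

variable {Q : Type*} [Group Q] {b c : Q}

theorem commute_of_closure_pair_eq_top {z : Q} (hgen : Subgroup.closure {b, c} = ⊤)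
    (hb : Commute z b) (hc : Commute z c) (q : Q) : Commute z q := by
  have h : Subgroup.closure {b, c} ≤ Subgroup.centralizer {z} := by
    rw [Subgroup.closure_le]
    rintro x (rfl | rfl) <;> rw [SetLike.mem_coe, Subgroup.mem_centralizer_singleton_iff]
    · exact hb.symm.eq
    · exact hc.symm.eq
  have hq := h (hgen ▸ Subgroup.mem_top q)
  exact ((Subgroup.mem_centralizer_singleton_iff).1 hq).symm

/-- Under these relations every element has the form `b ^ i * c ^ j`: the set of these elements is
stable under left multiplication by `c` because `c * b = b⁻¹ * c ^ 2`, where even powers of `b` are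
central. -/
theorem finite_of_commute_sq (hgen : Subgroup.closure {b, c} = ⊤) (hb : b ^ 24 = 1)
    (hc : c ^ 3 = 1) (hcb : c * b * c * b = 1) (hcomm : Commute (b ^ 2) c) : Finite Q := by
  have hcb' : c * b = b⁻¹ * c ^ 2 := by
    have h1 : c * b * c = b⁻¹ := eq_inv_of_mul_eq_one_left hcb
    have h2 : c ^ 2 = c⁻¹ := by
      rw [eq_inv_iff_mul_eq_one, ← pow_succ]; exact hc
    rw [h2, ← h1]; group
  let f : Fin 24 × Fin 3 → Q := fun p => b ^ (p.1 : ℕ) * c ^ (p.2 : ℕ)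
  have hf : ∀ i j : ℕ, b ^ i * c ^ j ∈ Set.range f := fun i j =>
    ⟨(⟨i % 24, Nat.mod_lt _ (by norm_num)⟩, ⟨j % 3, Nat.mod_lt _ (by norm_num)⟩), by
      simp only [f]; rw [← pow_eq_pow_mod i hb, ← pow_eq_pow_mod j hc]⟩
  have hmul_b : ∀ q ∈ Set.range f, b * q ∈ Set.range f := by
    rintro _ ⟨p, rfl⟩
    have := hf (p.1 + 1) p.2
    rwa [pow_succ', mul_assoc] at this
  have hmul_c : ∀ q ∈ Set.range f, c * q ∈ Set.range f := by
    rintro _ ⟨⟨i, j⟩, rfl⟩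
    obtain ⟨k, hk | hk⟩ := Nat.even_or_odd' (i : ℕ)
    · have := hf i (j + 1)
      have hck : c * b ^ (2 * k) = b ^ (2 * k) * c := by
        rw [pow_mul]; exact ((hcomm.pow_left k).eq).symm
      simp only [f]
      rw [hk] at this ⊢
      rwa [← mul_assoc, hck, mul_assoc, ← pow_succ']
    · have hck : c * b ^ (2 * k) = b ^ (2 * k) * c := by
        rw [pow_mul]; exact ((hcomm.pow_left k).eq).symm
      have hbinv : b⁻¹ = b ^ 23 := by
        rw [inv_eq_iff_mul_eq_one, ← pow_succ']; exact hb
      have := hf (2 * k + 23) (2 + j)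
      simp only [f]
      rw [hk, pow_succ, ← mul_assoc, ← mul_assoc, hck, mul_assoc (b ^ (2 * k)), hcb', hbinv]
      rwa [pow_add, pow_add, ← mul_assoc, mul_assoc (b ^ (2 * k))] at this
  have hone : (1 : Q) ∈ Set.range f := by simpa using hf 0 0
  have hinv : ∀ (x : Q) (n : ℕ), x ^ (n + 1) = 1 → (∀ q ∈ Set.range f, x * q ∈ Set.range f) →
      ∀ q ∈ Set.range f, x⁻¹ * q ∈ Set.range f := by
    intro x n hn hx q hq
    have hxi : x⁻¹ = x ^ n := by rw [inv_eq_iff_mul_eq_one, ← pow_succ']; exact hn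
    rw [hxi]
    clear hn hxi
    induction n with
    | zero => simpa using hq
    | succ n ih => rw [pow_succ', mul_assoc]; exact hx _ ih
  have hall : ∀ q : Q, q ∈ Set.range f := by
    intro q
    have hq : q ∈ Subgroup.closure {b, c} := hgen ▸ Subgroup.mem_top q
    have key : ∀ r ∈ Set.range f, q * r ∈ Set.range f := by
      induction hq using Subgroup.closure_induction'' with
      | one => intro r hr; simpa using hr
      | mem x hx =>
        rcases hx with rfl | rfl
        · exact hmul_b
        · exact hmul_c
      | inv_mem x hx =>
        rcases hx with rfl | rfl
        · exact hinv _ 23 hb hmul_b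
        · exact hinv _ 2 hc hmul_c
      | mul x y _ _ hx hy => intro r hr; rw [mul_assoc]; exact hx _ (hy _ hr)
    simpa using key 1 hone
  exact Set.finite_univ_iff.1 ((Set.finite_range f).subset fun q _ => hall q)

/-- Modulo central elements `b ^ 8` is `b⁻¹`, and the relations give `c⁻¹ * b * c = c * b⁻¹`, so
that the last hypothesis says that `b` commutes with `c * b⁻¹`. -/
theorem commute_of_commute_cube (hc : c ^ 3 = 1) (hcb : c * b * c * b = 1)
    (h3 : Commute (b ^ 3) c) (h8 : Commute (b ^ 8) (c⁻¹ * b ^ 8 * c)) : Commute b c := by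
  have h9 : Commute (b ^ 9) c := by
    have := h3.pow_left 3
    rwa [← pow_mul] at this
  have hb8 : b ^ 8 = b⁻¹ * b ^ 9 := by group
  have hconj : c⁻¹ * b ^ 8 * c = (c⁻¹ * b * c)⁻¹ * b ^ 9 := by
    rw [hb8, ← mul_assoc, mul_assoc (c⁻¹ * b⁻¹), h9.eq]; group
  have hcbc : c⁻¹ * b * c = c * b⁻¹ := by
    have h1 : c * b * c = b⁻¹ := eq_inv_of_mul_eq_one_left hcb
    have h2 : c⁻¹ = c * c := by
      rw [inv_eq_iff_mul_eq_one, ← pow_two, ← pow_succ']; exact hc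
    rw [← h1, h2]; group
  rw [hcbc] at hconj
  -- the factors `b ^ 9` are central, so that `b⁻¹` commutes with the inverse of `c * b⁻¹`
  have h8' : b ^ 8 * ((c * b⁻¹)⁻¹ * b ^ 9) = (c * b⁻¹)⁻¹ * b ^ 9 * b ^ 8 := by
    rw [← hconj]; exact h8.eq
  have h9b : Commute (b ^ 9) (b⁻¹) := ((Commute.refl b).pow_left 9).inv_right
  have h9c : b ^ 9 * (c * b⁻¹)⁻¹ = (c * b⁻¹)⁻¹ * b ^ 9 :=
    ((h9.mul_right h9b).inv_right).eq
  have e1 : b⁻¹ * (c * b⁻¹)⁻¹ * (b ^ 9 * b ^ 9) = (c * b⁻¹)⁻¹ * b⁻¹ * (b ^ 9 * b ^ 9) := by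
    calc b⁻¹ * (c * b⁻¹)⁻¹ * (b ^ 9 * b ^ 9)
        = b⁻¹ * ((c * b⁻¹)⁻¹ * b ^ 9) * b ^ 9 := by group
      _ = b⁻¹ * b ^ 9 * (c * b⁻¹)⁻¹ * b ^ 9 := by rw [← h9c]; group
      _ = b ^ 8 * ((c * b⁻¹)⁻¹ * b ^ 9) := by group
      _ = (c * b⁻¹)⁻¹ * b ^ 9 * b ^ 8 := h8'
      _ = _ := by group
  have e2 := congrArg Inv.inv (mul_right_cancel e1)
  have e3 : c * b⁻¹ * b = b * (c * b⁻¹) := by simpa using e2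
  rw [inv_mul_cancel_right, ← mul_assoc, eq_mul_inv_iff_mul_eq] at e3
  exact e3.symm

end TwoGenerators

/-! ### Sections of tree automorphisms -/

namespace WordAut

variable {X : Type*}

/-- `g` maps the subtree below the letter `x` to the subtree below the letter `y`, and acts there
as `k`. Equivalently `y` is the image of `x` under the permutation `σ_g`, and `k = g|_x`. -/
def Sends (g : WordAut X) (x : X) (k : WordAut X) (y : X) : Prop :=
  ∀ u, g (x :: u) = y :: k u

theorem sends_perm_restrict (g : WordAut X) (x : X) : Sends g x (restrict g x) (perm g x) :=
  apply_cons_eq g x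

theorem Sends.perm_eq {g k : WordAut X} {x y : X} (h : Sends g x k y) : perm g x = y :=
  (List.cons.inj ((apply_cons_eq g x []).symm.trans (h []))).1

theorem Sends.restrict_eq {g k : WordAut X} {x y : X} (h : Sends g x k y) : restrict g x = k :=
  RootedTreeIso.ext (Equiv.ext fun u =>
    (List.cons.inj ((apply_cons_eq g x u).symm.trans (h u))).2)

theorem Sends.mul {g h k l : WordAut X} {x y z : X} (hg : Sends g x k y) (hh : Sends h y l z) :
    Sends (g * h) x (k * l) z := fun u => by
  rw [TreeAut.mul_apply, hg, hh, TreeAut.mul_apply]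

theorem Sends.inv {g k : WordAut X} {x y : X} (hg : Sends g x k y) : Sends g⁻¹ y k⁻¹ x :=
  fun u => by
    have := hg (k⁻¹ u)
    rw [TreeAut.apply_inv_self] at this
    rw [← this, TreeAut.inv_apply_self]

theorem Sends.one (x : X) : Sends 1 x 1 x := fun _ => rfl

theorem Sends.pow {g k : WordAut X} {x : X} (hg : Sends g x k x) (n : ℕ) :
    Sends (g ^ n) x (k ^ n) x := by
  induction n with
  | zero => rw [pow_zero, pow_zero]; exact Sends.one x
  | succ n ih => rw [pow_succ, pow_succ]; exact ih.mul hg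

theorem ext_of_sends {g h : WordAut X}
    (H : ∀ x, ∃ y k, Sends g x k y ∧ Sends h x k y) : g = h := by
  refine RootedTreeIso.ext (Equiv.ext fun u => ?_)
  cases u with
  | nil => exact (apply_nil g).trans (apply_nil h).symm
  | cons x u =>
    obtain ⟨y, k, hg, hh⟩ := H x
    exact (hg u).trans (hh u).symm

/-- An automorphism whose sections are trivial but for one, which is the automorphism itself, is
trivial. -/
theorem eq_one_of_sends_self {g : WordAut X} (H : ∀ x, Sends g x g x ∨ Sends g x 1 x) :
    g = 1 := by
  have key : ∀ u : List X, g u = u := by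
    intro u
    induction u with
    | nil => exact apply_nil g
    | cons x u ih =>
      rcases H x with h | h
      · rw [h, ih]
      · rw [h]; rfl
  exact RootedTreeIso.ext (Equiv.ext key)

/-- `u` acts as `k` below the letter `a` and trivially everywhere else. -/
def IsSupportedBelow (u : WordAut X) (a : X) (k : WordAut X) : Prop :=
  Sends u a k a ∧ ∀ x, x ≠ a → Sends u x 1 x

theorem IsSupportedBelow.mul {u v k l : WordAut X} {a : X} (hu : IsSupportedBelow u a k)
    (hv : IsSupportedBelow v a l) : IsSupportedBelow (u * v) a (k * l) :=
  ⟨hu.1.mul hv.1, fun x hx => by simpa using (hu.2 x hx).mul (hv.2 x hx)⟩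

theorem IsSupportedBelow.one (a : X) : IsSupportedBelow 1 a 1 :=
  ⟨Sends.one a, fun x _ => Sends.one x⟩

theorem IsSupportedBelow.inv {u k : WordAut X} {a : X} (hu : IsSupportedBelow u a k) :
    IsSupportedBelow u⁻¹ a k⁻¹ :=
  ⟨hu.1.inv, fun x hx => by simpa using (hu.2 x hx).inv⟩

theorem IsSupportedBelow.conj {u k g l : WordAut X} {a y : X} (hu : IsSupportedBelow u a k)
    (hg : Sends g a l y) : IsSupportedBelow (g⁻¹ * u * g) y (l⁻¹ * k * l) := by
  refine ⟨(hg.inv.mul hu.1).mul hg, fun x hx => ?_⟩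
  have hs := sends_perm_restrict g⁻¹ x
  have hs' : Sends g (perm g⁻¹ x) (restrict g⁻¹ x)⁻¹ x := by simpa using hs.inv
  have hne : perm g⁻¹ x ≠ a := fun h => hx (by
    rw [h] at hs'
    exact hs'.perm_eq.symm.trans hg.perm_eq)
  simpa using (hs.mul (hu.2 _ hne)).mul hs'

theorem IsSupportedBelow.wreathRecursion_eq [DecidableEq X] {u k : WordAut X} {a : X}
    (hu : IsSupportedBelow u a k) :
    wreathRecursion X u = SemidirectProduct.inl (Pi.mulSingle a k) := by
  refine SemidirectProduct.ext (funext fun x => ?_) (MulOpposite.unop_injective ?_)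
  · by_cases hx : x = a
    · subst hx
      simpa [wreathRecursion] using hu.1.restrict_eq
    · simpa [wreathRecursion, hx] using (hu.2 x hx).restrict_eq
  · refine Equiv.ext fun x => ?_
    by_cases hx : x = a
    · subst hx; simpa [wreathRecursion] using hu.1.perm_eq
    · simpa [wreathRecursion] using (hu.2 x hx).perm_eq

end WordAut

/-! ### The group generated by the wreath recursion of the map -/

/-- The six components of the preimage of the upper half-plane under `f₁`. -/
inductive Tile
  | A | B | C | D | E | F
  deriving DecidableEq

instance : Fintype Tile := ⟨{.A, .B, .C, .D, .E, .F}, fun x => by cases x <;> decide⟩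

/-- `b` and `c` satisfy the wreath recursion of the loops around `1` and `-1`, when the letters are
identified with the components of the preimage of the upper half-plane by `e`. -/
structure IsGeneratingPair {X : Type*} (e : Tile ≃ X) (b c : WordAut X) : Prop where
  bA : WordAut.Sends b (e .A) b (e .A)
  bB : WordAut.Sends b (e .B) b⁻¹ (e .F)
  bC : WordAut.Sends b (e .C) 1 (e .B)
  bD : WordAut.Sends b (e .D) c (e .D)
  bE : WordAut.Sends b (e .E) c⁻¹ (e .C)
  bF : WordAut.Sends b (e .F) 1 (e .E)
  cA : WordAut.Sends c (e .A) 1 (e .B)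
  cB : WordAut.Sends c (e .B) 1 (e .F)
  cC : WordAut.Sends c (e .C) 1 (e .D)
  cD : WordAut.Sends c (e .D) 1 (e .E)
  cE : WordAut.Sends c (e .E) 1 (e .C)
  cF : WordAut.Sends c (e .F) 1 (e .A)

namespace IsGeneratingPair

open WordAut

variable {X : Type*} {e : Tile ≃ X} {b c : WordAut X} (h : IsGeneratingPair e b c)
include h

theorem c_pow : c ^ 3 = 1 := by
  rw [pow_succ, pow_two]
  refine ext_of_sends fun x => ?_
  obtain ⟨y, rfl⟩ := e.surjective x
  refine ⟨e y, 1, ?_, Sends.one _⟩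
  cases y
  · simpa using (h.cA.mul h.cB).mul h.cF
  · simpa using (h.cB.mul h.cF).mul h.cA
  · simpa using (h.cC.mul h.cD).mul h.cE
  · simpa using (h.cD.mul h.cE).mul h.cC
  · simpa using (h.cE.mul h.cC).mul h.cD
  · simpa using (h.cF.mul h.cA).mul h.cB

theorem cb_sq : c * b * c * b = 1 := by
  refine ext_of_sends fun x => ?_
  obtain ⟨y, rfl⟩ := e.surjective x
  refine ⟨e y, 1, ?_, Sends.one _⟩
  cases y
  · simpa using ((h.cA.mul h.bB).mul h.cF).mul h.bA
  · simpa using ((h.cB.mul h.bF).mul h.cE).mul h.bC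
  · simpa using ((h.cC.mul h.bD).mul h.cD).mul h.bE
  · simpa using ((h.cD.mul h.bE).mul h.cC).mul h.bD
  · simpa using ((h.cE.mul h.bC).mul h.cB).mul h.bF
  · simpa using ((h.cF.mul h.bA).mul h.cA).mul h.bB

theorem b8A : Sends (b ^ 8) (e .A) (b ^ 8) (e .A) := h.bA.pow 8

theorem b8D : Sends (b ^ 8) (e .D) (c ^ 8) (e .D) := h.bD.pow 8

/-- `b` permutes the other four letters in a cycle, and its fourth power acts below each of them as
an involution `(b⁻¹c⁻¹)` or `(c⁻¹b⁻¹)`. -/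
theorem b8_of_ne (x : Tile) (hA : x ≠ .A) (hD : x ≠ .D) : Sends (b ^ 8) (e x) 1 (e x) := by
  have h1 : (b⁻¹ * c⁻¹) ^ 2 = 1 := by
    have := congrArg Inv.inv h.cb_sq
    simpa [pow_two, mul_assoc] using this
  have h2 : (c⁻¹ * b⁻¹) ^ 2 = 1 := by
    have h4 : c⁻¹ * b⁻¹ = b * (b⁻¹ * c⁻¹) * b⁻¹ := by group
    rw [h4, conj_pow, h1]; group
  have h48 : b ^ 8 = (b ^ 4) ^ 2 := by rw [← pow_mul]
  have h4 : b ^ 4 = b * b * b * b := by simp only [pow_succ, pow_zero, one_mul]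
  rw [h48, h4]
  cases x
  · exact absurd rfl hA
  · have := (((h.bB.mul h.bF).mul h.bE).mul h.bC).pow 2
    simpa [h1] using this
  · have := (((h.bC.mul h.bB).mul h.bF).mul h.bE).pow 2
    simpa [h1] using this
  · exact absurd rfl hD
  · have := (((h.bE.mul h.bC).mul h.bB).mul h.bF).pow 2
    simpa [h2] using this
  · have := (((h.bF.mul h.bE).mul h.bC).mul h.bB).pow 2
    simpa [h2] using this

theorem b_pow : b ^ 24 = 1 := by
  have h24 : b ^ 24 = (b ^ 8) ^ 3 := by rw [← pow_mul]
  refine eq_one_of_sends_self fun x => ?_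
  obtain ⟨y, rfl⟩ := e.surjective x
  by_cases hA : y = .A
  · subst hA; exact Or.inl (h.bA.pow 24)
  · right
    by_cases hD : y = .D
    · subst hD
      have := h.bD.pow 24
      rwa [show c ^ 24 = 1 from by
        rw [show 24 = 3 * 8 from rfl, pow_mul, h.c_pow, one_pow]] at this
    · rw [h24]; simpa using (h.b8_of_ne y hA hD).pow 3

end IsGeneratingPair

/-! ### Normal closures and quotients -/

section NormalClosureIn

variable {A : Type*} [Group A] {G : Subgroup A} {k : A}

theorem conj_mem_normalClosureIn {g x : A} (hg : g ∈ G) (hx : x ∈ normalClosureIn G k) :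
    g⁻¹ * x * g ∈ normalClosureIn G k := by
  induction hx using Subgroup.closure_induction with
  | mem x hx =>
    obtain ⟨a, ha, rfl⟩ := hx
    exact Subgroup.subset_closure ⟨a * g, G.mul_mem ha hg, by group⟩
  | one => simp
  | mul x y _ _ hx hy =>
    have := Subgroup.mul_mem _ hx hy
    rwa [show g⁻¹ * x * g * (g⁻¹ * y * g) = g⁻¹ * (x * y) * g by group] at this
  | inv x _ hx =>
    have := Subgroup.inv_mem _ hx
    rwa [show (g⁻¹ * x * g)⁻¹ = g⁻¹ * x⁻¹ * g by group] at this

theorem normalClosureIn_le {K : Subgroup A} (hk : k ∈ K)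
    (hK : ∀ g ∈ G, ∀ x ∈ K, g⁻¹ * x * g ∈ K) : normalClosureIn G k ≤ K := by
  rw [normalClosureIn, Subgroup.closure_le]
  rintro _ ⟨g, hg, rfl⟩
  exact hK g hg k hk

theorem mem_normalClosureIn : k ∈ normalClosureIn G k :=
  Subgroup.subset_closure ⟨1, G.one_mem, by simp⟩

theorem subgroupOf_normal {K : Subgroup A} (hK : ∀ g ∈ G, ∀ x ∈ K, g⁻¹ * x * g ∈ K) :
    (K.subgroupOf G).Normal where
  conj_mem x hx g := by
    rw [Subgroup.mem_subgroupOf] at hx ⊢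
    simpa using hK _ (G.inv_mem g.2) _ hx

end NormalClosureIn

theorem commute_mk_iff {G : Type*} [Group G] (N : Subgroup G) [N.Normal] (x y : G) :
    Commute (QuotientGroup.mk x : G ⧸ N) (QuotientGroup.mk y) ↔ rightCommutator x y ∈ N := by
  rw [← QuotientGroup.eq_one_iff, rightCommutator, Commute, SemiconjBy]
  simp only [QuotientGroup.mk_mul, QuotientGroup.mk_inv]
  rw [mul_assoc, ← mul_inv_rev, inv_mul_eq_one, eq_comm]

theorem closure_pair_quotient_eq_top {A : Type*} [Group A] {b c : A} {G : Subgroup A}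
    (hG : G = Subgroup.closure {b, c}) (hb : b ∈ G) (hc : c ∈ G) (N : Subgroup G) [N.Normal] :
    Subgroup.closure {(QuotientGroup.mk (⟨b, hb⟩ : G) : G ⧸ N), QuotientGroup.mk ⟨c, hc⟩} = ⊤ := by
  have h1 : Subgroup.closure ({⟨b, hb⟩, ⟨c, hc⟩} : Set G) = ⊤ := by
    subst hG
    rw [← Subgroup.closure_closure_coe_preimage]
    congr 1
    ext x
    simp [Subtype.ext_iff]
  have h2 := congrArg (Subgroup.map (QuotientGroup.mk' N)) h1
  rw [MonoidHom.map_closure, Subgroup.map_top_of_surjective _ (QuotientGroup.mk'_surjective N),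
    Set.image_pair] at h2
  exact h2

/-! ### The branching subgroup -/

namespace IsGeneratingPair

open WordAut

variable {X : Type*} {e : Tile ≃ X} {b c : WordAut X} (h : IsGeneratingPair e b c)
include h

/-- The word `c² b c²` interchanges the letters `A` and `D`, with trivial sections at both. -/
theorem swap_A : Sends (c * c * b * c * c) (e .A) 1 (e .D) := by
  simpa using (((h.cA.mul h.cB).mul h.bF).mul h.cE).mul h.cC

theorem swap_D : Sends (c * c * b * c * c) (e .D) 1 (e .A) := by
  simpa using (((h.cD.mul h.cE).mul h.bC).mul h.cB).mul h.cF

theorem c_pow_sixteen : c ^ 16 = c := by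
  rw [show 16 = 3 * 5 + 1 from rfl, pow_succ, pow_mul, h.c_pow, one_pow, one_mul]

/-- The conjugate of `b ^ 16` by the swap of `A` and `D` is supported below these two letters,
where it acts as `c` and as `b ^ 16`. -/
theorem sends_conj_b16 :
    let y := (c * c * b * c * c)⁻¹ * b ^ 16 * (c * c * b * c * c)
    Sends y (e .A) c (e .A) ∧ Sends y (e .D) (b ^ 16) (e .D) ∧
      ∀ x, x ≠ .A → x ≠ .D → Sends y (e x) 1 (e x) := by
  intro y
  have h16 : b ^ 16 = (b ^ 8) ^ 2 := by rw [← pow_mul]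
  have conj {x x' : X} {l : WordAut X} (hw : Sends (c * c * b * c * c) x' l x)
      (hb : Sends (b ^ 8) x' 1 x') : Sends y x 1 x := by
    have := (hw.inv.mul (hb.pow 2)).mul hw
    rw [← h16] at this
    simpa only [one_pow, mul_one, inv_mul_cancel] using this
  refine ⟨?_, ?_, fun x hA hD => ?_⟩
  · simpa only [inv_one, one_mul, mul_one, h.c_pow_sixteen] using
      (h.swap_D.inv.mul (h.bD.pow 16)).mul h.swap_D
  · simpa only [inv_one, one_mul, mul_one] using
      (h.swap_A.inv.mul (h.bA.pow 16)).mul h.swap_A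
  · cases x
    · exact absurd rfl hA
    · exact conj ((((h.cF.mul h.cA).mul h.bB).mul h.cF).mul h.cA)
        (h.b8_of_ne .F (by decide) (by decide))
    · exact conj ((((h.cE.mul h.cC).mul h.bD).mul h.cD).mul h.cE)
        (h.b8_of_ne .E (by decide) (by decide))
    · exact absurd rfl hD
    · exact conj ((((h.cC.mul h.cD).mul h.bE).mul h.cC).mul h.cD)
        (h.b8_of_ne .C (by decide) (by decide))
    · exact conj ((((h.cB.mul h.cF).mul h.bA).mul h.cA).mul h.cB)
        (h.b8_of_ne .B (by decide) (by decide))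

/-- The commutator with `b³` kills the section at `D`, because the section of `b³` there is
`c³ = 1`. -/
theorem isSupportedBelow_commutator :
    IsSupportedBelow
      (rightCommutator ((c * c * b * c * c)⁻¹ * b ^ 16 * (c * c * b * c * c)) (b ^ 3))
      (e .A) (rightCommutator c (b ^ 3)) := by
  obtain ⟨yA, yD, yx⟩ := h.sends_conj_b16
  have b3 : b ^ 3 = b * b * b := by rw [pow_succ, pow_two]
  have other {x x' : Tile} {l : WordAut X} (hx : x ≠ .A ∧ x ≠ .D) (hx' : x' ≠ .A ∧ x' ≠ .D)
      (hb : Sends (b * b * b) (e x') l (e x)) :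
      Sends (rightCommutator ((c * c * b * c * c)⁻¹ * b ^ 16 * (c * c * b * c * c)) (b ^ 3))
        (e x) 1 (e x) := by
    rw [← b3] at hb
    have := (((yx x hx.1 hx.2).inv.mul hb.inv).mul (yx x' hx'.1 hx'.2)).mul hb
    simpa [rightCommutator] using this
  refine ⟨((yA.inv.mul (h.bA.pow 3).inv).mul yA).mul (h.bA.pow 3), fun x hx => ?_⟩
  obtain ⟨x, rfl⟩ := e.surjective x
  cases x
  · exact absurd rfl hx
  · exact other (by decide) (by decide) ((h.bF.mul h.bE).mul h.bC)
  · exact other (by decide) (by decide) ((h.bB.mul h.bF).mul h.bE)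
  · have := ((yD.inv.mul (h.bD.pow 3).inv).mul yD).mul (h.bD.pow 3)
    rw [h.c_pow] at this
    simpa [rightCommutator] using this
  · exact other (by decide) (by decide) ((h.bC.mul h.bB).mul h.bF)
  · exact other (by decide) (by decide) ((h.bE.mul h.bC).mul h.bB)

/-- The nontrivial sections of `b ^ 8` are those at `A` and `D`, and the nontrivial sections of its
conjugate by `c` are those at the images `B` and `E` of these letters under `c`. -/
theorem commute_b8_conj : Commute (b ^ 8) (c⁻¹ * b ^ 8 * c) := by
  have conj {x x' : X} {k : WordAut X} (hw : Sends c x' 1 x)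
      (hb : Sends (b ^ 8) x' k x') : Sends (c⁻¹ * b ^ 8 * c) x k x := by
    simpa using (hw.inv.mul hb).mul hw
  have right {x : X} {k : WordAut X} (hl : Sends (b ^ 8) x k x)
      (hr : Sends (c⁻¹ * b ^ 8 * c) x 1 x) : ∃ y k, Sends (b ^ 8 * (c⁻¹ * b ^ 8 * c)) x k y ∧
        Sends (c⁻¹ * b ^ 8 * c * b ^ 8) x k y :=
    ⟨x, k, by simpa using hl.mul hr, by simpa using hr.mul hl⟩
  have left {x : X} {k : WordAut X} (hl : Sends (b ^ 8) x 1 x)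
      (hr : Sends (c⁻¹ * b ^ 8 * c) x k x) : ∃ y k, Sends (b ^ 8 * (c⁻¹ * b ^ 8 * c)) x k y ∧
        Sends (c⁻¹ * b ^ 8 * c * b ^ 8) x k y :=
    ⟨x, k, by simpa using hl.mul hr, by simpa using hr.mul hl⟩
  refine ext_of_sends fun x => ?_
  obtain ⟨x, rfl⟩ := e.surjective x
  have hB := h.b8_of_ne .B (by decide) (by decide)
  have hC := h.b8_of_ne .C (by decide) (by decide)
  have hE := h.b8_of_ne .E (by decide) (by decide)
  have hF := h.b8_of_ne .F (by decide) (by decide)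
  cases x
  · exact right h.b8A (conj h.cF hF)
  · exact left hB (conj h.cA h.b8A)
  · exact left hC (conj h.cE hE)
  · exact right h.b8D (conj h.cC hC)
  · exact left hE (conj h.cD h.b8D)
  · exact left hF (conj h.cB hB)

theorem isSelfSimilar : IsSelfSimilar (Subgroup.closure {b, c}) := by
  have hb : b ∈ Subgroup.closure {b, c} := Subgroup.subset_closure (by simp)
  have hc : c ∈ Subgroup.closure {b, c} := Subgroup.subset_closure (by simp)
  suffices H : ∀ g ∈ Subgroup.closure {b, c}, ∀ x, ∃ k ∈ Subgroup.closure {b, c}, ∃ y,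
      Sends g x k y from H
  intro g hg
  induction hg using Subgroup.closure_induction with
  | mem g hg =>
    intro x
    obtain ⟨x, rfl⟩ := e.surjective x
    rcases hg with rfl | rfl
    · cases x
      · exact ⟨_, hb, _, h.bA⟩
      · exact ⟨_, Subgroup.inv_mem _ hb, _, h.bB⟩
      · exact ⟨_, Subgroup.one_mem _, _, h.bC⟩
      · exact ⟨_, hc, _, h.bD⟩
      · exact ⟨_, Subgroup.inv_mem _ hc, _, h.bE⟩
      · exact ⟨_, Subgroup.one_mem _, _, h.bF⟩
    · cases x
      · exact ⟨_, Subgroup.one_mem _, _, h.cA⟩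
      · exact ⟨_, Subgroup.one_mem _, _, h.cB⟩
      · exact ⟨_, Subgroup.one_mem _, _, h.cC⟩
      · exact ⟨_, Subgroup.one_mem _, _, h.cD⟩
      · exact ⟨_, Subgroup.one_mem _, _, h.cE⟩
      · exact ⟨_, Subgroup.one_mem _, _, h.cF⟩
  | one => exact fun x => ⟨1, Subgroup.one_mem _, x, Sends.one x⟩
  | mul g g' _ _ hg hg' =>
    intro x
    obtain ⟨k, hk, y, hy⟩ := hg x
    obtain ⟨l, hl, z, hz⟩ := hg' y
    exact ⟨k * l, Subgroup.mul_mem _ hk hl, z, hy.mul hz⟩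
  | inv g _ hg =>
    intro x
    obtain ⟨k, hk, y, hy⟩ := hg ((perm g).symm x)
    have hyx : y = x := by rw [← hy.perm_eq, Equiv.apply_symm_apply]
    subst hyx
    exact ⟨k⁻¹, Subgroup.inv_mem _ hk, _, hy.inv⟩

/-- The group is self-replicating: the sections at the letter `A` of the elements that fix it
exhaust the group. -/
theorem exists_sends_A (g : WordAut X) (hg : g ∈ Subgroup.closure {b, c}) :
    ∃ g' ∈ Subgroup.closure {b, c}, Sends g' (e .A) g (e .A) := by
  have hb : b ∈ Subgroup.closure {b, c} := Subgroup.subset_closure (by simp)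
  have hc : c ∈ Subgroup.closure {b, c} := Subgroup.subset_closure (by simp)
  have hw : c * c * b * c * c ∈ Subgroup.closure {b, c} := by
    exact mul_mem (mul_mem (mul_mem (mul_mem hc hc) hb) hc) hc
  induction hg using Subgroup.closure_induction with
  | mem g hg =>
    rcases hg with rfl | rfl
    · exact ⟨_, hb, h.bA⟩
    · refine ⟨_, mul_mem (mul_mem (inv_mem hw) hb) hw, ?_⟩
      simpa using (h.swap_D.inv.mul h.bD).mul h.swap_D
  | one => exact ⟨1, one_mem _, Sends.one _⟩
  | mul g g' _ _ hg hg' =>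
    obtain ⟨k, hk, hk'⟩ := hg
    obtain ⟨l, hl, hl'⟩ := hg'
    exact ⟨_, mul_mem hk hl, hk'.mul hl'⟩
  | inv g _ hg =>
    obtain ⟨k, hk, hk'⟩ := hg
    exact ⟨_, inv_mem hk, hk'.inv⟩

/-- The group moves the letter `A` to any other one with trivial section; conjugation by such an
element moves the support of an automorphism without changing its section. -/
theorem exists_sends_one (x : Tile) :
    ∃ g ∈ Subgroup.closure {b, c}, Sends g (e .A) 1 (e x) := by
  have hb : b ∈ Subgroup.closure {b, c} := Subgroup.subset_closure (by simp)
  have hc : c ∈ Subgroup.closure {b, c} := Subgroup.subset_closure (by simp)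
  have sA := Sends.one (e .A)
  have sB := sA.mul h.cA
  have sF := sB.mul h.cB
  have sE := sF.mul h.bF
  have sC := sE.mul h.cE
  have sD := sC.mul h.cC
  have mB := mul_mem (one_mem _) hc
  have mF := mul_mem mB hc
  have mE := mul_mem mF hb
  have mC := mul_mem mE hc
  simp only [mul_one] at sB sF sE sC sD
  cases x
  · exact ⟨_, one_mem _, sA⟩
  · exact ⟨_, mB, sB⟩
  · exact ⟨_, mC, sC⟩
  · exact ⟨_, mul_mem mC hc, sD⟩
  · exact ⟨_, mE, sE⟩
  · exact ⟨_, mF, sF⟩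

/-- The subgroup `K` of all `k` for which `(k, 1, …, 1)` lies in `ψ(H)` is normal in the group, and
modulo `K` the generators commute. Hence `K` contains `[b², c]`, and with it `H`. -/
theorem exists_isSupportedBelow (k : WordAut X)
    (hk : k ∈ normalClosureIn (Subgroup.closure {b, c}) (rightCommutator (b ^ 2) c)) :
    ∃ u ∈ normalClosureIn (Subgroup.closure {b, c}) (rightCommutator (b ^ 2) c),
      IsSupportedBelow u (e .A) k := by
  obtain ⟨G, hG⟩ : ∃ G, G = Subgroup.closure {b, c} := ⟨_, rfl⟩
  have hb : b ∈ G := hG ▸ Subgroup.subset_closure (by simp)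
  have hc : c ∈ G := hG ▸ Subgroup.subset_closure (by simp)
  have hrep := h.exists_sends_A
  rw [← hG] at hk hrep ⊢
  obtain ⟨H, hH⟩ : ∃ H, H = normalClosureIn G (rightCommutator (b ^ 2) c) := ⟨_, rfl⟩
  have hHconj : ∀ g ∈ G, ∀ x ∈ H, g⁻¹ * x * g ∈ H := fun g hg x hx => by
    rw [hH] at hx ⊢; exact conj_mem_normalClosureIn hg hx
  have hHmem : rightCommutator (b ^ 2) c ∈ H := hH ▸ mem_normalClosureIn
  rw [← hH]
  let K : Subgroup (WordAut X) :=
    { carrier := {k | ∃ u ∈ H, IsSupportedBelow u (e .A) k}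
      one_mem' := ⟨1, H.one_mem, .one _⟩
      mul_mem' := by
        rintro k l ⟨u, hu, hk⟩ ⟨v, hv, hl⟩
        exact ⟨u * v, H.mul_mem hu hv, hk.mul hl⟩
      inv_mem' := by
        rintro k ⟨u, hu, hk⟩
        exact ⟨u⁻¹, H.inv_mem hu, hk.inv⟩ }
  have hKconj : ∀ g ∈ G, ∀ x ∈ K, g⁻¹ * x * g ∈ K := by
    rintro g hg x ⟨u, hu, hx⟩
    obtain ⟨g', hg', hs⟩ := hrep g hg
    exact ⟨_, hHconj g' hg' u hu, hx.conj hs⟩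
  suffices hle : normalClosureIn G (rightCommutator (b ^ 2) c) ≤ K from hle hk
  refine normalClosureIn_le ?_ hKconj
  let β : G := ⟨b, hb⟩
  let γ : G := ⟨c, hc⟩
  -- modulo `H` the element `b²` is central, so `[y, b³]` lies in `H` for the conjugate `y` of `b¹⁶`
  have h1 : rightCommutator c (b ^ 3) ∈ K := by
    refine ⟨_, ?_, h.isSupportedBelow_commutator⟩
    have := subgroupOf_normal hHconj
    have hcomm : Commute (QuotientGroup.mk (β ^ 2) : G ⧸ H.subgroupOf G) (QuotientGroup.mk γ) :=
      (commute_mk_iff _ _ _).2 hHmem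
    have hcentral : ∀ q : G ⧸ H.subgroupOf G, Commute (QuotientGroup.mk (β ^ 2)) q :=
      commute_of_closure_pair_eq_top (closure_pair_quotient_eq_top hG hb hc _)
        ((Commute.refl (QuotientGroup.mk β : G ⧸ H.subgroupOf G)).pow_left 2) hcomm
    let w : G := γ * γ * β * γ * γ
    have hy : (QuotientGroup.mk (w⁻¹ * β ^ 16 * w) : G ⧸ H.subgroupOf G) =
        (QuotientGroup.mk (β ^ 2)) ^ 8 := by
      have h16 : β ^ 16 = (β ^ 2) ^ 8 := by rw [← pow_mul]
      rw [h16, QuotientGroup.mk_mul, QuotientGroup.mk_mul, QuotientGroup.mk_pow, mul_assoc,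
        ((hcentral _).pow_left 8).eq, QuotientGroup.mk_inv, inv_mul_cancel_left]
    have := (commute_mk_iff (H.subgroupOf G) (w⁻¹ * β ^ 16 * w) (β ^ 3)).1
      (hy ▸ (hcentral _).pow_left 8)
    exact this
  have := subgroupOf_normal hKconj
  have h2 : Commute (QuotientGroup.mk β : G ⧸ K.subgroupOf G) (QuotientGroup.mk γ) := by
    refine commute_of_commute_cube ?_ ?_ (Commute.symm ?_) ?_
    · rw [← QuotientGroup.mk_pow, show γ ^ 3 = 1 from Subtype.ext h.c_pow, QuotientGroup.mk_one]
    · rw [← QuotientGroup.mk_mul, ← QuotientGroup.mk_mul, ← QuotientGroup.mk_mul,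
        show γ * β * γ * β = 1 from Subtype.ext h.cb_sq, QuotientGroup.mk_one]
    · exact (commute_mk_iff _ γ (β ^ 3)).2 h1
    · have h8 : Commute (β ^ 8) (γ⁻¹ * β ^ 8 * γ) := Subtype.ext h.commute_b8_conj.eq
      exact h8.map (QuotientGroup.mk' (K.subgroupOf G))
  exact (commute_mk_iff _ (β ^ 2) γ).1 (h2.pow_left 2)

theorem isRegularBranchOver :
    IsRegularBranchOver (Subgroup.closure {b, c})
      (normalClosureIn (Subgroup.closure {b, c}) (rightCommutator (b ^ 2) c)) := by
  classical
  have hb : b ∈ Subgroup.closure {b, c} := Subgroup.subset_closure (by simp)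
  have hc : c ∈ Subgroup.closure {b, c} := Subgroup.subset_closure (by simp)
  refine ⟨h.isSelfSimilar, ?_, ?_, ?_⟩
  · refine normalClosureIn_le ?_ fun g hg x hx => mul_mem (mul_mem (inv_mem hg) hx) hg
    exact mul_mem (mul_mem (mul_mem (inv_mem (pow_mem hb 2)) (inv_mem hc)) (pow_mem hb 2)) hc
  · have := subgroupOf_normal (G := Subgroup.closure {b, c}) fun g hg x hx =>
      conj_mem_normalClosureIn (k := rightCommutator (b ^ 2) c) hg hx
    let β : Subgroup.closure {b, c} := ⟨b, hb⟩
    let γ : Subgroup.closure {b, c} := ⟨c, hc⟩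
    rw [Subgroup.finiteIndex_iff_finite_quotient]
    refine finite_of_commute_sq (closure_pair_quotient_eq_top rfl hb hc _) ?_ ?_ ?_ ?_
    · rw [← QuotientGroup.mk_pow, show β ^ 24 = 1 from Subtype.ext h.b_pow, QuotientGroup.mk_one]
    · rw [← QuotientGroup.mk_pow, show γ ^ 3 = 1 from Subtype.ext h.c_pow, QuotientGroup.mk_one]
    · rw [← QuotientGroup.mk_mul, ← QuotientGroup.mk_mul, ← QuotientGroup.mk_mul,
        show γ * β * γ * β = 1 from Subtype.ext h.cb_sq, QuotientGroup.mk_one]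
    · exact (commute_mk_iff _ (β ^ 2) γ).2 mem_normalClosureIn
  · have : Finite X := Finite.of_equiv _ e
    rw [Subgroup.map_le_iff_le_comap, Subgroup.pi_le_iff]
    intro x
    obtain ⟨x, rfl⟩ := e.surjective x
    rintro _ ⟨k, hk, rfl⟩
    obtain ⟨u, hu, hs⟩ := h.exists_isSupportedBelow k hk
    obtain ⟨g, hg, hgs⟩ := h.exists_sends_one x
    have := hs.conj hgs
    refine ⟨g⁻¹ * u * g, conj_mem_normalClosureIn hg hu, ?_⟩
    simpa using this.wreathRecursion_eq

end IsGeneratingPair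

open Filter

/-! ### The map as a branched covering of the sphere -/

/-- The rational function in the definition of `f₁`; its values at the poles are junk. -/
noncomputable def ratFun (z : ℂ) : ℂ := 2 * (z ^ 2 - 3 / 4) ^ 3 / (z ^ 2 * (z ^ 2 - 9 / 8) ^ 2) - 1

/-- The denominator of the rational function. -/
noncomputable def ratDen (z : ℂ) : ℂ := z ^ 2 * (z ^ 2 - 9 / 8) ^ 2

theorem f₁_infty : f₁ OnePoint.infty = ((1 : ℂ) : OnePoint ℂ) := rfl

theorem f₁_coe (z : ℂ) :
    f₁ z = if ratDen z = 0 then OnePoint.infty else (ratFun z : OnePoint ℂ) := rfl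

theorem f₁_neg (z : ℂ) : f₁ ((-z : ℂ) : OnePoint ℂ) = f₁ z := by
  simp [f₁_coe, ratDen, ratFun]

theorem f₁_coe_of_ne {z : ℂ} (hz : ratDen z ≠ 0) : f₁ z = (ratFun z : OnePoint ℂ) := if_neg hz

theorem f₁_coe_of_eq {z : ℂ} (hz : ratDen z = 0) : f₁ z = OnePoint.infty := if_pos hz

theorem ratFun_sub_one {z : ℂ} (hz : ratDen z ≠ 0) :
    ratFun z - 1 = 27 / 32 * (z ^ 2 - 1) / ratDen z := by
  unfold ratFun ratDen
  unfold ratDen at hz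
  rw [eq_div_iff hz, sub_mul, sub_mul, div_mul_cancel₀ _ hz]
  ring

theorem ratFun_add_one (z : ℂ) : ratFun z + 1 = 2 * (z ^ 2 - 3 / 4) ^ 3 / ratDen z := by
  unfold ratFun ratDen
  rw [sub_add_cancel]

/-- The sphere with the three points `∞, 1, -1` removed. -/
def puncturedSphere : Set (OnePoint ℂ) :=
  {p | p ≠ OnePoint.infty ∧ p ≠ ((1 : ℂ) : OnePoint ℂ) ∧ p ≠ ((-1 : ℂ) : OnePoint ℂ)}

theorem coe_mem_puncturedSphere {z : ℂ} :
    (z : OnePoint ℂ) ∈ puncturedSphere ↔ z ≠ 1 ∧ z ≠ -1 := by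
  simp [puncturedSphere, OnePoint.coe_ne_infty]

theorem exists_coe_of_f₁_mem {p : OnePoint ℂ} (hp : f₁ p ∈ puncturedSphere) :
    ∃ z : ℂ, p = z ∧ ratDen z ≠ 0 ∧ f₁ p = (ratFun z : OnePoint ℂ) := by
  induction p using OnePoint.rec with
  | infty => exact absurd f₁_infty hp.2.1
  | coe z =>
    have hz : ratDen z ≠ 0 := fun h => hp.1 (f₁_coe_of_eq h)
    exact ⟨z, rfl, hz, f₁_coe_of_ne hz⟩

theorem f₁_one : f₁ ((1 : ℂ) : OnePoint ℂ) = ((1 : ℂ) : OnePoint ℂ) := by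
  have h : ratDen 1 ≠ 0 := by norm_num [ratDen]
  rw [f₁_coe_of_ne h]
  norm_num [ratFun]

theorem f₁_neg_one : f₁ ((-1 : ℂ) : OnePoint ℂ) = ((1 : ℂ) : OnePoint ℂ) := by
  have h : ratDen (-1) ≠ 0 := by norm_num [ratDen]
  rw [f₁_coe_of_ne h]
  norm_num [ratFun]

theorem mem_puncturedSphere_of_f₁_mem {p : OnePoint ℂ} (hp : f₁ p ∈ puncturedSphere) :
    p ∈ puncturedSphere := by
  refine ⟨?_, ?_, ?_⟩ <;> rintro rfl
  · exact hp.2.1 f₁_infty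
  · exact hp.2.1 f₁_one
  · exact hp.2.1 f₁_neg_one

theorem continuousAt_ratFun {z : ℂ} (hz : ratDen z ≠ 0) : ContinuousAt ratFun z := by
  unfold ratFun
  refine ContinuousAt.sub (ContinuousAt.div (by fun_prop) (by fun_prop) hz) continuousAt_const

theorem continuous_ratDen : Continuous ratDen := by
  unfold ratDen; fun_prop

theorem continuous_f₁ : Continuous f₁ := by
  rw [continuous_iff_continuousAt]
  intro p
  induction p using OnePoint.rec with
  | infty =>
    rw [OnePoint.continuousAt_infty', coclosedCompact_eq_cocompact, f₁_infty]
    -- in the coordinate `1 / z` the map is continuous at infinity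
    let g : ℂ → ℂ := fun y => 2 * (1 - 3 / 4 * y ^ 2) ^ 3 / (1 - 9 / 8 * y ^ 2) ^ 2 - 1
    have hg : ContinuousAt g 0 := by
      refine ContinuousAt.sub (ContinuousAt.div (by fun_prop) (by fun_prop) ?_) continuousAt_const
      norm_num
    have hg0 : g 0 = 1 := by norm_num [g]
    have hinv : Tendsto (fun z : ℂ => z⁻¹) (cocompact ℂ) (𝓝 0) := by
      rw [← Metric.cobounded_eq_cocompact]
      exact tendsto_inv₀_cobounded
    have h1 : Tendsto (fun z : ℂ => g z⁻¹) (cocompact ℂ) (𝓝 1) := by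
      have := hg.tendsto
      rw [hg0] at this
      exact this.comp hinv
    have h2 : Tendsto (fun z : ℂ => 1 - 9 / 8 * (z⁻¹) ^ 2) (cocompact ℂ) (𝓝 1) := by
      have : ContinuousAt (fun y : ℂ => 1 - 9 / 8 * y ^ 2) 0 := by fun_prop
      have h := this.tendsto.comp hinv
      simpa [Function.comp_def] using h
    have h3 : ∀ᶠ z : ℂ in cocompact ℂ, z ≠ 0 := by
      have := (isCompact_singleton (x := (0 : ℂ))).compl_mem_cocompact
      filter_upwards [this] with z hz using hz
    refine ((OnePoint.continuous_coe.tendsto (1 : ℂ)).comp h1).congr' ?_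
    filter_upwards [h3, h2.eventually_ne one_ne_zero] with z hz hz'
    have hz2 : z ^ 2 - 9 / 8 ≠ 0 := by
      intro h
      apply hz'
      field_simp
      linear_combination 8 * h
    have hden : ratDen z ≠ 0 := mul_ne_zero (pow_ne_zero _ hz) (pow_ne_zero _ hz2)
    simp only [Function.comp_apply]
    rw [f₁_coe_of_ne hden]
    congr 1
    simp only [g, ratFun]
    have e1 : 1 - 9 / 8 * z⁻¹ ^ 2 = (z ^ 2 - 9 / 8) / z ^ 2 := by field_simp
    have e2 : 1 - 3 / 4 * z⁻¹ ^ 2 = (z ^ 2 - 3 / 4) / z ^ 2 := by field_simp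
    rw [e1, e2]
    field_simp
  | coe z =>
    rw [OnePoint.continuousAt_coe]
    by_cases hz : ratDen z = 0
    · have hval : (f₁ ∘ ((↑) : ℂ → OnePoint ℂ)) z = OnePoint.infty := f₁_coe_of_eq hz
      have hnum : 2 * (z ^ 2 - 3 / 4) ^ 3 ≠ 0 := by
        intro h
        have h1 : z ^ 2 - 3 / 4 = 0 := by simpa using h
        have h2 : z ^ 2 = 3 / 4 := by linear_combination h1
        rw [ratDen, h2] at hz
        norm_num at hz
      rw [ContinuousAt, hval, ← nhdsNE_sup_pure, tendsto_sup]
      refine ⟨?_, by rw [← hval]; exact tendsto_pure_nhds _ _⟩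
      have hne : ∀ᶠ y in 𝓝[≠] z, ratDen y ≠ 0 := by
        have hfin : {y : ℂ | ratDen y = 0} ⊆ {0} ∪ {y | y ^ 2 = 9 / 8} := by
          intro y hy
          rcases mul_eq_zero.1 hy with h | h
          · left; simpa using h
          · right
            have : y ^ 2 - 9 / 8 = 0 := by simpa using h
            exact sub_eq_zero.1 this
        have hfin' : {y : ℂ | ratDen y = 0}.Finite := by
          refine Set.Finite.subset ((Set.finite_singleton 0).union ?_) hfin
          have : {y : ℂ | y ^ 2 = 9 / 8} ⊆ ((Polynomial.nthRoots 2 (9 / 8 : ℂ)).toFinset : Set ℂ) :=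
            fun y hy => by simpa [Polynomial.mem_nthRoots] using hy
          exact (Finset.finite_toSet _).subset this
        have := (hfin'.subset (Set.sdiff_subset (t := {z}))).isClosed.isOpen_compl.mem_nhds
          (show z ∈ ({y : ℂ | ratDen y = 0} \ {z})ᶜ by simp)
        filter_upwards [nhdsWithin_le_nhds this, self_mem_nhdsWithin] with y hy hyz h
        exact hy ⟨h, hyz⟩
      have hlim : Tendsto ratFun (𝓝[≠] z) (cocompact ℂ) := by
        rw [← Metric.cobounded_eq_cocompact]
        have h0 : Tendsto ratDen (𝓝[≠] z) (𝓝[≠] 0) := by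
          refine tendsto_nhdsWithin_iff.2 ⟨?_, hne⟩
          have := continuous_ratDen.tendsto z
          rw [hz] at this
          exact this.mono_left nhdsWithin_le_nhds
        have hinv : Tendsto (fun y => ‖(ratDen y)⁻¹‖) (𝓝[≠] z) atTop :=
          tendsto_norm_cobounded_atTop.comp (tendsto_inv₀_nhdsNE_zero.comp h0)
        have hn : Tendsto (fun y : ℂ => ‖2 * (y ^ 2 - 3 / 4) ^ 3‖) (𝓝[≠] z)
            (𝓝 ‖2 * (z ^ 2 - 3 / 4) ^ 3‖) := by
          have : Continuous fun y : ℂ => ‖2 * (y ^ 2 - 3 / 4) ^ 3‖ := by fun_prop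
          exact (this.tendsto z).mono_left nhdsWithin_le_nhds
        have hprod := hn.pos_mul_atTop (norm_pos_iff.2 hnum) hinv
        rw [← tendsto_norm_atTop_iff_cobounded]
        refine tendsto_atTop_mono (fun y => ?_) (tendsto_atTop_add_const_right _ (-1) hprod)
        have h1 : 2 * (y ^ 2 - 3 / 4) ^ 3 * (ratDen y)⁻¹ = ratFun y + 1 := by
          rw [ratFun_add_one]
          exact (div_eq_mul_inv _ _).symm
        rw [← norm_mul, h1]
        have := norm_add_le (ratFun y) 1
        rw [norm_one] at this
        linarith
      rw [← coclosedCompact_eq_cocompact] at hlim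
      refine (OnePoint.tendsto_coe_infty.comp hlim).congr' ?_
      filter_upwards [hne] with y hy
      exact (f₁_coe_of_ne hy).symm
    · have : (fun y : ℂ => (ratFun y : OnePoint ℂ)) =ᶠ[𝓝 z] f₁ ∘ ((↑) : ℂ → OnePoint ℂ) := by
        filter_upwards [continuous_ratDen.continuousAt.eventually_ne hz] with y hy
        exact (f₁_coe_of_ne hy).symm
      exact (OnePoint.continuous_coe.continuousAt.comp (continuousAt_ratFun hz)).congr this

theorem hasStrictDerivAt_ratFun {z : ℂ} (hz : ratDen z ≠ 0) :
    HasStrictDerivAt ratFun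
      (-(27 / 8) * (z * (z ^ 2 - 3 / 4) ^ 2 * (z ^ 2 - 9 / 8)) / ratDen z ^ 2) z := by
  have h2 (a : ℂ) : HasStrictDerivAt (fun y : ℂ => y ^ 2 - a) (2 * z) z := by
    have h : HasStrictDerivAt (fun y : ℂ => y ^ 2 - a) ((2 : ℕ) * z ^ (2 - 1)) z :=
      (hasStrictDerivAt_pow 2 z).sub_const a
    simpa only [Nat.cast_ofNat, Nat.add_one_sub_one, pow_one] using h
  have h0 : HasStrictDerivAt (fun y : ℂ => y ^ 2) (2 * z) z := by
    simpa only [sub_zero] using h2 0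
  have hnum := ((h2 (3 / 4)).fun_pow 3).const_mul 2
  have hden := h0.fun_mul ((h2 (9 / 8)).fun_pow 2)
  refine HasStrictDerivAt.congr_deriv (f := ratFun)
    (HasDerivAtFilter.sub_const 1 (hnum.fun_div hden hz)) ?_
  unfold ratDen
  congr 1
  push_cast
  ring

/-- The critical points are `∞` and the zeros of `z (z² - 3/4) (z² - 9/8)`; none of them is mapped
into the punctured sphere. -/
theorem exists_openPartialHomeomorph_ratFun {z : ℂ} (hz : ratDen z ≠ 0)
    (hf : (ratFun z : OnePoint ℂ) ∈ puncturedSphere) :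
    ∃ e : OpenPartialHomeomorph ℂ ℂ, z ∈ e.source ∧ (∀ y ∈ e.source, ratDen y ≠ 0) ∧
      ∀ y ∈ e.source, e y = ratFun y := by
  have hz0 : z ≠ 0 := by rintro rfl; exact hz (by simp [ratDen])
  have hz2 : z ^ 2 - 9 / 8 ≠ 0 := fun h => hz (by simp [ratDen, h])
  have hz3 : z ^ 2 - 3 / 4 ≠ 0 := by
    intro h
    refine (coe_mem_puncturedSphere.1 hf).2 ?_
    have := ratFun_add_one z
    rw [h] at this
    simp only [ne_eq, OfNat.ofNat_ne_zero, not_false_eq_true, zero_pow, mul_zero, zero_div] at this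
    linear_combination this
  have hd : -(27 / 8) * (z * (z ^ 2 - 3 / 4) ^ 2 * (z ^ 2 - 9 / 8)) / ratDen z ^ 2 ≠ 0 := by
    refine div_ne_zero (mul_ne_zero (by norm_num) ?_) (pow_ne_zero _ hz)
    exact mul_ne_zero (mul_ne_zero hz0 (pow_ne_zero _ hz3)) hz2
  let e := ((hasStrictDerivAt_ratFun hz).hasStrictFDerivAt_equiv hd).toOpenPartialHomeomorph ratFun
  have hopen : IsOpen {y : ℂ | ratDen y ≠ 0} := isOpen_ne.preimage continuous_ratDen
  refine ⟨e.restrOpen _ hopen, ⟨?_, hz⟩, fun y hy => hy.2, fun y _ => rfl⟩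
  exact HasStrictFDerivAt.mem_toOpenPartialHomeomorph_source _

theorem isLocalHomeomorphOn_f₁ : IsLocalHomeomorphOn f₁ (f₁ ⁻¹' puncturedSphere) := by
  have himage : f₁ ⁻¹' puncturedSphere =
      ((↑) : ℂ → OnePoint ℂ) '' {z | f₁ z ∈ puncturedSphere} := by
    ext p
    refine ⟨fun hp => ?_, fun ⟨z, hz, h⟩ => h ▸ hz⟩
    obtain ⟨z, rfl, -⟩ := exists_coe_of_f₁_mem hp
    exact ⟨z, hp, rfl⟩
  rw [himage]
  refine IsLocalHomeomorphOn.of_comp_right (IsLocalHomeomorphOn.mk _ _ fun z hz => ?_)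
    (OnePoint.isOpenEmbedding_coe.isLocalHomeomorph.isLocalHomeomorphOn)
  obtain ⟨z', h1, h2, h3⟩ := exists_coe_of_f₁_mem hz
  obtain rfl := OnePoint.coe_injective h1
  obtain ⟨e, he, hne, heq⟩ := exists_openPartialHomeomorph_ratFun h2 (h3 ▸ hz)
  refine ⟨e.trans (OnePoint.isOpenEmbedding_coe.toOpenPartialHomeomorph _), by simpa using he,
    fun y hy => ?_⟩
  have hy' : y ∈ e.source := by simpa using hy
  simp [f₁_coe_of_ne (hne y hy'), heq y hy']

/-- A local homeomorphism over an open set that is proper is a covering over it; here properness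
comes from the compactness of the sphere. -/
theorem isCoveringMapOn_f₁ : IsCoveringMapOn f₁ puncturedSphere :=
  .of_isLocalHomeomorphOn continuous_f₁ isLocalHomeomorphOn_f₁

/-! ### The postcritical set -/

theorem f₁_mem_compl_of_mem_criticalPoints {p : OnePoint ℂ} (hp : p ∈ criticalPoints f₁) :
    f₁ p ∉ puncturedSphere := by
  intro hf
  obtain ⟨e, he, heq⟩ := isLocalHomeomorphOn_f₁ p hf
  refine hp e.source (e.open_source.mem_nhds he) ?_
  rw [heq]
  exact e.injOn

/-- The map is even, so that it is not injective near the fixed points `0` and `∞` of `z ↦ -z`. -/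
theorem infty_mem_criticalPoints : OnePoint.infty ∈ criticalPoints f₁ := by
  intro U hU hinj
  rw [OnePoint.nhds_infty_eq, coclosedCompact_eq_cocompact, mem_sup] at hU
  have h1 : ∀ᶠ z : ℂ in cocompact ℂ, (z : OnePoint ℂ) ∈ U := hU.1
  have hneg : Tendsto (fun z : ℂ => -z) (cocompact ℂ) (cocompact ℂ) :=
    (Homeomorph.neg ℂ).isClosedEmbedding.tendsto_cocompact
  have h3 : ∀ᶠ z : ℂ in cocompact ℂ, z ≠ 0 := by
    have := (isCompact_singleton (x := (0 : ℂ))).compl_mem_cocompact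
    filter_upwards [this] with z hz using hz
  obtain ⟨z, hz, hz', hz0⟩ := (h1.and ((hneg.eventually h1).and h3)).exists
  have := hinj hz hz' (f₁_neg z).symm
  exact hz0 (self_eq_neg.1 (OnePoint.coe_injective this))

theorem zero_mem_criticalPoints : ((0 : ℂ) : OnePoint ℂ) ∈ criticalPoints f₁ := by
  intro U hU hinj
  have h1 : ∀ᶠ z : ℂ in 𝓝 0, (z : OnePoint ℂ) ∈ U :=
    OnePoint.continuous_coe.continuousAt.eventually_mem hU
  have hneg : Tendsto (fun z : ℂ => -z) (𝓝 0) (𝓝 0) := by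
    simpa using (continuous_neg (G := ℂ)).tendsto 0
  have h2 := (h1.and (hneg.eventually h1)).filter_mono (nhdsWithin_le_nhds (s := {0}ᶜ))
  obtain ⟨z, ⟨hz, hz'⟩, hz0⟩ := (h2.and self_mem_nhdsWithin).exists
  have := hinj hz hz' (f₁_neg z).symm
  exact hz0 (self_eq_neg.1 (OnePoint.coe_injective this))

/-- The sign of the imaginary part is that of an explicit polynomial in the coordinates of `z²`. -/
theorem ratFun_im {z : ℂ} {u v : ℝ} (hz : z ^ 2 = ⟨u, v⟩) (hd : ratDen z ≠ 0) :
    (ratFun z).im = 27 / 16 / Complex.normSq (ratDen z) *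
      (v * ((9 / 8 - u) * (u - 3 / 4) ^ 2 - v ^ 2 * (u - 5 / 8))) := by
  have h1 : (ratFun z).im = (ratFun z - 1).im := by simp
  rw [h1, ratFun_sub_one hd, Complex.div_im]
  have hn : Complex.normSq (ratDen z) ≠ 0 := (Complex.normSq_pos.2 hd).ne'
  have hden : ratDen z = (⟨u, v⟩ : ℂ) * ((⟨u, v⟩ : ℂ) - 9 / 8) ^ 2 := by rw [ratDen, hz]
  have e1 : (27 / 32 * (z ^ 2 - 1) : ℂ).im = 27 / 32 * v := by
    rw [hz]; simp [Complex.mul_im]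
  have e2 : (27 / 32 * (z ^ 2 - 1) : ℂ).re = 27 / 32 * (u - 1) := by
    rw [hz]; simp [Complex.mul_re]
  have hr : (9 / 8 : ℂ).re = 9 / 8 := by norm_num
  have hi : (9 / 8 : ℂ).im = 0 := by norm_num
  have e3 : (ratDen z).re = u * ((u - 9 / 8) ^ 2 - v ^ 2) - v * (2 * (u - 9 / 8) * v) := by
    rw [hden]
    simp only [pow_two, Complex.mul_re, Complex.mul_im, Complex.sub_re, Complex.sub_im, hr, hi]
    ring
  have e4 : (ratDen z).im = u * (2 * (u - 9 / 8) * v) + v * ((u - 9 / 8) ^ 2 - v ^ 2) := by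
    rw [hden]
    simp only [pow_two, Complex.mul_re, Complex.mul_im, Complex.sub_re, Complex.sub_im, hr, hi]
    ring
  rw [e1, e2, e3, e4, ← sub_div, div_mul_eq_mul_div]
  ring

/-- The map is a function of `z²` with real coefficients. -/
theorem ratFun_conj_of_sq {z z' : ℂ} (h : z' ^ 2 = starRingEnd ℂ (z ^ 2)) :
    ratFun z' = starRingEnd ℂ (ratFun z) := by
  unfold ratFun
  rw [h]
  simp [map_ofNat]

theorem ratDen_conj_of_sq {z z' : ℂ} (h : z' ^ 2 = starRingEnd ℂ (z ^ 2)) :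
    ratDen z' = starRingEnd ℂ (ratDen z) := by
  unfold ratDen
  rw [h]
  simp [map_ofNat]

theorem f₁_of_sq_eq {z : ℂ} (hz : z ^ 2 = 3 / 4) : f₁ z = ((-1 : ℂ) : OnePoint ℂ) := by
  have hd : ratDen z ≠ 0 := by rw [ratDen, hz]; norm_num
  rw [f₁_coe_of_ne hd]
  congr 1
  rw [ratFun, hz]
  norm_num

/-- A square root of `3 / 4` is critical: there are non-real points `w` arbitrarily close to `3 / 4`
at which the value of the map, as a function of `w = z²`, is real, and the map takes the same value
at `w` and at its conjugate. These points form a curve through `3 / 4`. -/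
theorem sqrt_mem_criticalPoints :
    (((3 / 4 : ℂ) ^ (2⁻¹ : ℂ) : ℂ) : OnePoint ℂ) ∈ criticalPoints f₁ := by
  intro U hU hinj
  let v : ℝ → ℝ := fun u => |u - 3 / 4| * √((9 / 8 - u) / (u - 5 / 8))
  let w : ℝ → ℂ := fun u => ⟨u, v u⟩
  have hv : ContinuousAt v (3 / 4) := by
    refine ContinuousAt.mul (by fun_prop) (Real.continuous_sqrt.continuousAt.comp ?_)
    exact ContinuousAt.div (by fun_prop) (by fun_prop) (by norm_num)
  have hw : ContinuousAt w (3 / 4) := by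
    have h1 : w = fun u : ℝ => (u : ℂ) + v u * Complex.I := by
      funext u; apply Complex.ext <;> simp [w]
    rw [h1]
    exact (Complex.continuous_ofReal.continuousAt).add
      ((Complex.continuous_ofReal.continuousAt.comp hv).mul continuousAt_const)
  have hw0 : w (3 / 4) = 3 / 4 := by
    apply Complex.ext
    · norm_num [w]
    · norm_num [w, v]
  have hsqrt : ContinuousAt (fun y : ℂ => y ^ (2⁻¹ : ℂ)) (3 / 4) := by
    refine continuousAt_cpow_const ?_
    left; norm_num
  have h1 : Tendsto (fun u => (((w u) ^ (2⁻¹ : ℂ) : ℂ) : OnePoint ℂ)) (𝓝 (3 / 4))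
      (𝓝 (((3 / 4 : ℂ) ^ (2⁻¹ : ℂ) : ℂ) : OnePoint ℂ)) := by
    have := hw.tendsto
    rw [hw0] at this
    exact (OnePoint.continuous_coe.continuousAt.tendsto).comp (hsqrt.tendsto.comp this)
  have h2 : Tendsto (fun u => (((starRingEnd ℂ (w u)) ^ (2⁻¹ : ℂ) : ℂ) : OnePoint ℂ)) (𝓝 (3 / 4))
      (𝓝 (((3 / 4 : ℂ) ^ (2⁻¹ : ℂ) : ℂ) : OnePoint ℂ)) := by
    have h3 := (Complex.continuous_conj.continuousAt.comp hw).tendsto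
    have h4 : (starRingEnd ℂ ∘ w) (3 / 4) = 3 / 4 := by
      rw [Function.comp_apply, hw0]; simp [map_ofNat]
    rw [h4] at h3
    exact (OnePoint.continuous_coe.continuousAt.tendsto).comp (hsqrt.tendsto.comp h3)
  have h3 : ∀ᶠ u : ℝ in 𝓝 (3 / 4), 5 / 8 < u ∧ u < 9 / 8 :=
    (lt_mem_nhds (by norm_num)).and (gt_mem_nhds (by norm_num))
  have h4 := ((h1.eventually_mem hU).and ((h2.eventually_mem hU).and h3)).filter_mono
    (nhdsWithin_le_nhds (s := {3 / 4}ᶜ))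
  obtain ⟨u, ⟨hu1, hu2, hu5, hu9⟩, hu3⟩ := (h4.and self_mem_nhdsWithin).exists
  have hpos : 0 < (9 / 8 - u) / (u - 5 / 8) := div_pos (by linarith) (by linarith)
  have hvpos : 0 < v u :=
    mul_pos (abs_pos.2 (sub_ne_zero.2 hu3)) (Real.sqrt_pos.2 hpos)
  have hv2 : v u ^ 2 = (u - 3 / 4) ^ 2 * ((9 / 8 - u) / (u - 5 / 8)) := by
    simp only [v]
    rw [mul_pow, Real.sq_sqrt hpos.le, sq_abs]
  have sq (y : ℂ) : (y ^ (2⁻¹ : ℂ)) ^ 2 = y := by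
    simp
  have hsq := sq (w u)
  have hsq' : ((starRingEnd ℂ (w u)) ^ (2⁻¹ : ℂ)) ^ 2 =
      starRingEnd ℂ (((w u) ^ (2⁻¹ : ℂ)) ^ 2) := by rw [sq, sq]
  have hd : ratDen ((w u) ^ (2⁻¹ : ℂ)) ≠ 0 := by
    rw [ratDen, hsq]
    have him : (w u).im = v u := rfl
    refine mul_ne_zero ?_ (pow_ne_zero _ ?_)
    · intro h
      rw [h] at him
      exact hvpos.ne (by simpa using him)
    · intro h
      have h' := congrArg Complex.im (sub_eq_zero.1 h)
      rw [him] at h'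
      norm_num at h'
      exact hvpos.ne' h'
  have hd' : ratDen ((starRingEnd ℂ (w u)) ^ (2⁻¹ : ℂ)) ≠ 0 := by
    rw [ratDen_conj_of_sq hsq']
    exact (map_ne_zero _).2 hd
  have hreal : (ratFun ((w u) ^ (2⁻¹ : ℂ))).im = 0 := by
    have h5 : u - 5 / 8 ≠ 0 := by linarith
    have h6 : v u ^ 2 * (u - 5 / 8) = (9 / 8 - u) * (u - 3 / 4) ^ 2 := by
      rw [hv2, mul_assoc, div_mul_cancel₀ _ h5, mul_comm]
    rw [ratFun_im (u := u) (v := v u) hsq hd, h6]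
    ring
  have heq := hinj hu1 hu2 (by
    rw [f₁_coe_of_ne hd, f₁_coe_of_ne hd', ratFun_conj_of_sq hsq']
    congr 1
    apply Complex.ext <;> simp [hreal])
  have heq' : w u = starRingEnd ℂ (w u) := by
    have := congrArg (· ^ 2) (OnePoint.coe_injective heq)
    simp only [sq] at this
    exact this
  have := congrArg Complex.im heq'
  simp only [w, Complex.conj_im] at this
  linarith

theorem postcriticalSet_f₁ : postcriticalSet f₁ = puncturedSphereᶜ := by
  ext p
  simp only [postcriticalSet, Set.mem_iUnion, Set.mem_image, Set.mem_compl_iff, exists_prop]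
  constructor
  · rintro ⟨n, hn, q, hq, rfl⟩
    obtain ⟨n, rfl⟩ := Nat.exists_eq_add_of_le' hn
    induction n with
    | zero => exact f₁_mem_compl_of_mem_criticalPoints hq
    | succ n ih =>
      rw [Function.iterate_succ_apply']
      exact fun h => ih (by omega) (mem_puncturedSphere_of_f₁_mem h)
  · intro hp
    by_cases h1 : p = OnePoint.infty
    · refine ⟨1, le_rfl, _, zero_mem_criticalPoints, ?_⟩
      rw [h1, Function.iterate_one]
      exact f₁_coe_of_eq (by simp [ratDen])
    by_cases h2 : p = ((1 : ℂ) : OnePoint ℂ)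
    · exact ⟨1, le_rfl, _, infty_mem_criticalPoints, by rw [h2]; rfl⟩
    by_cases h3 : p = ((-1 : ℂ) : OnePoint ℂ)
    · refine ⟨1, le_rfl, _, sqrt_mem_criticalPoints, ?_⟩
      rw [h3, Function.iterate_one]
      exact f₁_of_sq_eq (Complex.cpow_nat_inv_pow (3 / 4) two_ne_zero)
    · exact absurd ⟨h1, h2, h3⟩ hp

/-! ### Lifting through the iterates -/

theorem mem_puncturedSphere_of_iterate_mem {n : ℕ} {p : OnePoint ℂ}
    (hp : f₁^[n] p ∈ puncturedSphere) : p ∈ puncturedSphere := by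
  induction n generalizing p with
  | zero => exact hp
  | succ n ih => exact mem_puncturedSphere_of_f₁_mem (ih hp)

theorem exists_lift_iterate {A : Type*} [TopologicalSpace A] [SimplyConnectedSpace A]
    [LocallyPathConnectedSpace A] (n : ℕ) (h : C(A, OnePoint ℂ)) (hh : ∀ a, h a ∈ puncturedSphere)
    (a₀ : A) (p : OnePoint ℂ) (hp : f₁^[n] p = h a₀) :
    ∃ F : C(A, OnePoint ℂ), F a₀ = p ∧ ∀ a, f₁^[n] (F a) = h a := by
  induction n generalizing p with
  | zero => exact ⟨h, hp.symm, fun _ => rfl⟩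
  | succ n ih =>
    obtain ⟨F, hF, hFn⟩ := ih (f₁ p) hp
    obtain ⟨F', ⟨hF', hcomp⟩, -⟩ := isCoveringMapOn_f₁.existsUnique_continuousMap_lifts F hF.symm
      fun a => mem_puncturedSphere_of_iterate_mem (n := n) (by rw [hFn]; exact hh a)
    refine ⟨F', hF', fun a => ?_⟩
    rw [Function.iterate_succ_apply, ← hFn, ← hcomp]
    rfl

theorem eqOn_of_f₁_eqOn {A : Type*} [TopologicalSpace A] {s : Set A} (hs : IsPreconnected s)
    {F F' : A → OnePoint ℂ} (hF : ContinuousOn F s) (hF' : ContinuousOn F' s)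
    (hmem : ∀ a ∈ s, f₁ (F a) ∈ puncturedSphere) (heq : ∀ a ∈ s, f₁ (F a) = f₁ (F' a))
    {a₀ : A} (ha₀ : a₀ ∈ s) (h : F a₀ = F' a₀) : Set.EqOn F F' s := by
  have : PreconnectedSpace s := isPreconnected_iff_preconnectedSpace.1 hs
  let E : s → f₁ ⁻¹' puncturedSphere := fun a => ⟨F a, hmem a a.2⟩
  let E' : s → f₁ ⁻¹' puncturedSphere := fun a => ⟨F' a, by
    rw [Set.mem_preimage, ← heq a a.2]; exact hmem a a.2⟩
  have hE : Continuous E := (continuousOn_iff_continuous_domRestrict.1 hF).subtype_mk _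
  have hE' : Continuous E' := (continuousOn_iff_continuous_domRestrict.1 hF').subtype_mk _
  have key : E = E' := isCoveringMapOn_f₁.isCoveringMap_restrictPreimage.eq_of_comp_eq hE hE'
    (funext fun a => Subtype.ext (heq a a.2)) ⟨a₀, ha₀⟩ (Subtype.ext h)
  exact fun a ha => congrArg Subtype.val (congrFun key ⟨a, ha⟩)

theorem eqOn_of_iterate_eqOn {A : Type*} [TopologicalSpace A] {s : Set A} (hs : IsPreconnected s)
    (n : ℕ) {F F' : A → OnePoint ℂ} (hF : ContinuousOn F s) (hF' : ContinuousOn F' s)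
    (hmem : ∀ a ∈ s, f₁^[n] (F a) ∈ puncturedSphere)
    (heq : ∀ a ∈ s, f₁^[n] (F a) = f₁^[n] (F' a))
    {a₀ : A} (ha₀ : a₀ ∈ s) (h : F a₀ = F' a₀) : Set.EqOn F F' s := by
  induction n generalizing F F' with
  | zero => exact heq
  | succ n ih =>
    have := ih (continuous_f₁.comp_continuousOn hF) (continuous_f₁.comp_continuousOn hF') hmem heq
      (congrArg f₁ h)
    exact eqOn_of_f₁_eqOn hs hF hF'
      (fun a ha => mem_puncturedSphere_of_iterate_mem (n := n) (hmem a ha)) this ha₀ h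

section PathLifting

variable {x y : OnePoint ℂ} {γ : Path x y}

theorem exists_liftConnects (hγ : ∀ s, γ s ∈ puncturedSphere) {n : ℕ} {p : OnePoint ℂ}
    (hp : f₁^[n] p = x) : ∃ q, f₁^[n] q = y ∧ LiftConnects f₁ n γ p q := by
  -- the path is extended to the real line, which is locally path connected
  obtain ⟨F, hF0, hF⟩ := exists_lift_iterate n ⟨γ.extend, γ.continuous_extend⟩
    (fun a => hγ _) 0 p (by simpa using hp)
  refine ⟨F 1, ?_, ⟨⟨fun s => F s, F.continuous.comp continuous_subtype_val⟩, ?_, ?_⟩, fun s => ?_⟩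
  · rw [hF]; exact γ.extend_one
  · simpa using hF0
  · simp
  · exact (hF s).trans (γ.extend_apply s.2)

theorem LiftConnects.unique (hγ : ∀ s, γ s ∈ puncturedSphere) {n : ℕ} {p q q' : OnePoint ℂ}
    (h : LiftConnects f₁ n γ p q) (h' : LiftConnects f₁ n γ p q') : q = q' := by
  obtain ⟨Γ, hΓ⟩ := h
  obtain ⟨Γ', hΓ'⟩ := h'
  have := eqOn_of_iterate_eqOn (s := Set.univ) isPreconnected_univ n Γ.continuous.continuousOn
    Γ'.continuous.continuousOn (fun a _ => by rw [hΓ]; exact hγ a)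
    (fun a _ => by rw [hΓ, hΓ']) (Set.mem_univ 0) (by rw [Γ.source, Γ'.source])
  simpa using this (Set.mem_univ 1)

theorem LiftConnects.symm {n : ℕ} {p q : OnePoint ℂ} (h : LiftConnects f₁ n γ p q) :
    LiftConnects f₁ n γ.symm q p := by
  obtain ⟨Γ, hΓ⟩ := h
  exact ⟨Γ.symm, fun s => hΓ _⟩

end PathLifting

/-! ### Branches of the inverse iterates on slit planes -/

/-- The three intervals into which `1` and `-1` divide the real line. -/
inductive Side
  | mid | right | left

/-- The plane slit along the two intervals other than the given one. -/
def slitPlane : Side → Set ℂ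
  | .mid => {z | z.im ≠ 0 ∨ (-1 < z.re ∧ z.re < 1)}
  | .right => {z | z.im ≠ 0 ∨ 1 < z.re}
  | .left => {z | z.im ≠ 0 ∨ z.re < -1}

theorem isOpen_slitPlane (j : Side) : IsOpen (slitPlane j) := by
  have him : IsOpen {z : ℂ | z.im ≠ 0} := isOpen_ne.preimage Complex.continuous_im
  cases j
  · exact him.union ((isOpen_lt continuous_const Complex.continuous_re).inter
      (isOpen_lt Complex.continuous_re continuous_const))
  · exact him.union (isOpen_lt continuous_const Complex.continuous_re)
  · exact him.union (isOpen_lt Complex.continuous_re continuous_const)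

/-- A union of the non-real points and of a convex piece of the real line is star convex about each
point of this piece. -/
theorem starConvex_im_ne_zero_or {s : Set ℝ} (hs : Convex ℝ s) {x : ℝ} (hx : x ∈ s) :
    StarConvex ℝ (x : ℂ) {z : ℂ | z.im ≠ 0 ∨ z.re ∈ s} := by
  intro y hy a b ha hb hab
  have him : (a • (x : ℂ) + b • y).im = b * y.im := by simp
  have hre : (a • (x : ℂ) + b • y).re = a * x + b * y.re := by simp
  rw [Set.mem_ofPred_eq, him, hre]
  rcases hb.eq_or_lt with rfl | hb
  · right
    rw [add_zero] at hab
    simpa [hab] using hx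
  · rcases hy with hy | hy
    · exact Or.inl (mul_ne_zero hb.ne' hy)
    · exact Or.inr (hs hx hy ha hb.le hab)

theorem exists_starConvex_slitPlane (j : Side) :
    ∃ x : ℂ, x ∈ slitPlane j ∧ StarConvex ℝ x (slitPlane j) := by
  cases j
  · refine ⟨((0 : ℝ) : ℂ), Or.inr (by norm_num), ?_⟩
    exact starConvex_im_ne_zero_or (convex_Ioo (-1) 1) (by norm_num)
  · refine ⟨((2 : ℝ) : ℂ), Or.inr (by norm_num), ?_⟩
    exact starConvex_im_ne_zero_or (convex_Ioi 1) (by norm_num)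
  · refine ⟨((-2 : ℝ) : ℂ), Or.inr (by norm_num), ?_⟩
    exact starConvex_im_ne_zero_or (convex_Iio (-1)) (by norm_num)

theorem contractibleSpace_slitPlane (j : Side) : ContractibleSpace (slitPlane j) := by
  obtain ⟨x, hx, h⟩ := exists_starConvex_slitPlane j
  exact h.contractibleSpace ⟨x, hx⟩

theorem isPreconnected_slitPlane (j : Side) : IsPreconnected (slitPlane j) := by
  have := contractibleSpace_slitPlane j
  exact isPreconnected_iff_preconnectedSpace.2 inferInstance

/-- A slit plane as a subset of the sphere. -/
def slitSphere (j : Side) : Set (OnePoint ℂ) := (↑) '' slitPlane j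

/-- The upper half-plane as a subset of the sphere. -/
def upperHalf : Set (OnePoint ℂ) := (↑) '' {z : ℂ | 0 < z.im}

/-- The lower half-plane as a subset of the sphere. -/
def lowerHalf : Set (OnePoint ℂ) := (↑) '' {z : ℂ | z.im < 0}

theorem coe_mem_slitSphere {j : Side} {z : ℂ} : (z : OnePoint ℂ) ∈ slitSphere j ↔ z ∈ slitPlane j :=
  OnePoint.coe_injective.mem_set_image

theorem coe_mem_upperHalf {z : ℂ} : (z : OnePoint ℂ) ∈ upperHalf ↔ 0 < z.im :=
  OnePoint.coe_injective.mem_set_image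

theorem coe_mem_lowerHalf {z : ℂ} : (z : OnePoint ℂ) ∈ lowerHalf ↔ z.im < 0 :=
  OnePoint.coe_injective.mem_set_image

theorem isOpen_slitSphere (j : Side) : IsOpen (slitSphere j) :=
  OnePoint.isOpenEmbedding_coe.isOpenMap _ (isOpen_slitPlane j)

theorem mem_slitPlane_of_im_ne {j : Side} {z : ℂ} (hz : z.im ≠ 0) : z ∈ slitPlane j := by
  cases j <;> exact Or.inl hz

theorem upperHalf_subset (j : Side) : upperHalf ⊆ slitSphere j :=
  Set.image_mono fun _ hz => mem_slitPlane_of_im_ne hz.ne'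

theorem lowerHalf_subset (j : Side) : lowerHalf ⊆ slitSphere j :=
  Set.image_mono fun _ hz => mem_slitPlane_of_im_ne hz.ne

theorem slitSphere_subset (j : Side) : slitSphere j ⊆ puncturedSphere := by
  rintro _ ⟨z, hz, rfl⟩
  rw [coe_mem_puncturedSphere]
  constructor <;> rintro rfl <;> cases j <;> rcases hz with hz | hz <;> norm_num at hz

theorem isPreconnected_slitSphere (j : Side) : IsPreconnected (slitSphere j) :=
  (isPreconnected_slitPlane j).image _ OnePoint.continuous_coe.continuousOn

theorem isPreconnected_upperHalf : IsPreconnected upperHalf :=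
  (convex_halfSpace_im_gt 0).isPreconnected.image _ OnePoint.continuous_coe.continuousOn

theorem isPreconnected_lowerHalf : IsPreconnected lowerHalf :=
  (convex_halfSpace_im_lt 0).isPreconnected.image _ OnePoint.continuous_coe.continuousOn

/-- `s` is a branch of the inverse of `f₁^n` on a slit plane. -/
structure IsBranch (j : Side) (n : ℕ) (s : OnePoint ℂ → OnePoint ℂ) : Prop where
  continuousOn : ContinuousOn s (slitSphere j)
  iterate_apply : ∀ q ∈ slitSphere j, f₁^[n] (s q) = q

theorem exists_isBranch {j : Side} {n : ℕ} {q p : OnePoint ℂ} (hq : q ∈ slitSphere j)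
    (hp : f₁^[n] p = q) : ∃ s, IsBranch j n s ∧ s q = p := by
  obtain ⟨z, hz, rfl⟩ := hq
  have := contractibleSpace_slitPlane j
  have : LocallyPathConnectedSpace (slitPlane j) := (isOpen_slitPlane j).locallyPathConnectedSpace
  obtain ⟨F, hF0, hF⟩ := exists_lift_iterate (A := slitPlane j) n
    ⟨fun a => (a : OnePoint ℂ), OnePoint.continuous_coe.comp continuous_subtype_val⟩
    (fun a => slitSphere_subset j ⟨a, a.2, rfl⟩) ⟨z, hz⟩ p hp
  classical
  let s : OnePoint ℂ → OnePoint ℂ := fun p => p.elim OnePoint.infty fun y =>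
    if hy : y ∈ slitPlane j then F ⟨y, hy⟩ else OnePoint.infty
  have hs : ∀ y (hy : y ∈ slitPlane j), s y = F ⟨y, hy⟩ := fun y hy => dif_pos hy
  refine ⟨s, ⟨?_, ?_⟩, by rw [hs z hz, hF0]⟩
  · rintro _ ⟨y, hy, rfl⟩
    refine ContinuousAt.continuousWithinAt ?_
    rw [OnePoint.continuousAt_coe]
    refine ContinuousOn.continuousAt ?_ ((isOpen_slitPlane j).mem_nhds hy)
    rw [continuousOn_iff_continuous_domRestrict]
    convert F.continuous using 1
    funext a
    exact hs a a.2
  · rintro _ ⟨y, hy, rfl⟩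
    rw [hs y hy, hF]
    rfl

theorem IsBranch.eqOn {j : Side} {n : ℕ} {s s' : OnePoint ℂ → OnePoint ℂ} {V : Set (OnePoint ℂ)}
    (hV : IsPreconnected V) (hVj : V ⊆ slitSphere j) (hs : IsBranch j n s)
    (hs' : ContinuousOn s' V) (hn : ∀ q ∈ V, f₁^[n] (s' q) = q) {q₀ : OnePoint ℂ} (hq₀ : q₀ ∈ V)
    (h : s q₀ = s' q₀) : Set.EqOn s s' V :=
  eqOn_of_iterate_eqOn hV n (hs.continuousOn.mono hVj) hs'
    (fun a ha => by rw [hs.iterate_apply a (hVj ha)]; exact slitSphere_subset j (hVj ha))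
    (fun a ha => by rw [hs.iterate_apply a (hVj ha), hn a ha]) hq₀ h

/-- As long as a path stays in a slit plane, its lift follows a branch. -/
theorem IsBranch.eqOn_lift {j : Side} {n : ℕ} {s : OnePoint ℂ → OnePoint ℂ} (hs : IsBranch j n s)
    {γ Γ : I → OnePoint ℂ} (hγ : Continuous γ) (hΓ : Continuous Γ) (hlift : ∀ a, f₁^[n] (Γ a) = γ a)
    {J : Set I} (hJ : IsPreconnected J) (hγJ : ∀ a ∈ J, γ a ∈ slitSphere j) {a₀ : I} (ha₀ : a₀ ∈ J)
    (h : Γ a₀ = s (γ a₀)) : ∀ a ∈ J, Γ a = s (γ a) :=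
  eqOn_of_iterate_eqOn hJ n hΓ.continuousOn (hs.continuousOn.comp hγ.continuousOn hγJ)
    (fun a ha => by rw [hlift]; exact slitSphere_subset j (hγJ a ha))
    (fun a ha => by rw [hlift, hs.iterate_apply _ (hγJ a ha)]) ha₀ h

section Branch

variable {t : ℂ}

/-- The branch of the inverse of `f₁^n` on a slit plane that takes the value `p` at the basepoint,
where `p` is a vertex of level `n` of the preimage tree. -/
noncomputable def branch (j : Side) (v : PreimageTree f₁ (t : OnePoint ℂ)) :
    OnePoint ℂ → OnePoint ℂ :=
  open Classical in if h : ∃ s, IsBranch j v.1 s ∧ s t = v.2.1 then h.choose else id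

theorem branch_spec (ht : 0 < t.im) (j : Side) (v : PreimageTree f₁ (t : OnePoint ℂ)) :
    IsBranch j v.1 (branch j v) ∧ branch j v t = v.2.1 := by
  have h := exists_isBranch (j := j) (upperHalf_subset j (coe_mem_upperHalf.2 ht)) v.2.2
  rw [branch, dif_pos h]
  exact h.choose_spec

theorem isBranch_branch (ht : 0 < t.im) (j : Side) (v : PreimageTree f₁ (t : OnePoint ℂ)) :
    IsBranch j v.1 (branch j v) := (branch_spec ht j v).1

theorem branch_base (ht : 0 < t.im) (j : Side) (v : PreimageTree f₁ (t : OnePoint ℂ)) :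
    branch j v t = v.2.1 := (branch_spec ht j v).2

theorem eqOn_branch_upperHalf (ht : 0 < t.im) (j k : Side)
    (v : PreimageTree f₁ (t : OnePoint ℂ)) : Set.EqOn (branch j v) (branch k v) upperHalf :=
  (isBranch_branch ht j v).eqOn isPreconnected_upperHalf (upperHalf_subset j)
    ((isBranch_branch ht k v).continuousOn.mono (upperHalf_subset k))
    (fun q hq => (isBranch_branch ht k v).iterate_apply q (upperHalf_subset k hq))
    (coe_mem_upperHalf.2 ht) (by rw [branch_base ht, branch_base ht])

theorem vertex_ext {v w : PreimageTree f₁ (t : OnePoint ℂ)} (h1 : v.1 = w.1)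
    (h2 : v.2.1 = w.2.1) : v = w := by
  obtain ⟨n, p, hp⟩ := v
  obtain ⟨m, q, hq⟩ := w
  obtain rfl : n = m := h1
  obtain rfl : p = q := h2
  rfl

theorem branch_injective (ht : 0 < t.im) {j : Side} {v w : PreimageTree f₁ (t : OnePoint ℂ)}
    (hlev : v.1 = w.1) {q : OnePoint ℂ} (hq : q ∈ slitSphere j)
    (h : branch j v q = branch j w q) : v = w := by
  have hb : IsBranch j v.1 (branch j w) := hlev ▸ isBranch_branch ht j w
  have := (isBranch_branch ht j v).eqOn (isPreconnected_slitSphere j) le_rfl hb.continuousOn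
    hb.iterate_apply hq h
  refine vertex_ext hlev ?_
  rw [← branch_base ht j v, ← branch_base ht j w]
  exact this (upperHalf_subset j (coe_mem_upperHalf.2 ht))

theorem exists_branch_eq (ht : 0 < t.im) {j : Side} {n : ℕ} {q p : OnePoint ℂ}
    (hq : q ∈ slitSphere j) (hp : f₁^[n] p = q) :
    ∃ v : PreimageTree f₁ (t : OnePoint ℂ), v.1 = n ∧ branch j v q = p := by
  obtain ⟨s, hs, hsq⟩ := exists_isBranch hq hp
  have htj := upperHalf_subset j (coe_mem_upperHalf.2 ht)
  refine ⟨⟨n, s t, hs.iterate_apply _ htj⟩, rfl, ?_⟩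
  rw [← hsq]
  exact (isBranch_branch ht j _).eqOn (isPreconnected_slitSphere j) le_rfl hs.continuousOn
    hs.iterate_apply htj (branch_base ht j _) hq

/-- Two branches that agree at one point of the lower half-plane agree on all of it. -/
theorem eqOn_branch_lowerHalf (ht : 0 < t.im) {j k : Side}
    {v w : PreimageTree f₁ (t : OnePoint ℂ)} (hlev : v.1 = w.1) {q : OnePoint ℂ}
    (hq : q ∈ lowerHalf) (h : branch j v q = branch k w q) :
    Set.EqOn (branch j v) (branch k w) lowerHalf := by
  have hb : IsBranch k v.1 (branch k w) := hlev ▸ isBranch_branch ht k w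
  exact (isBranch_branch ht j v).eqOn isPreconnected_lowerHalf (lowerHalf_subset j)
    (hb.continuousOn.mono (lowerHalf_subset k))
    (fun q hq => hb.iterate_apply q (lowerHalf_subset k hq)) hq h

theorem f₁_branch (ht : 0 < t.im) (j : Side) {n : ℕ} {p : OnePoint ℂ}
    (hp : f₁^[n + 1] p = (t : OnePoint ℂ)) :
    Set.EqOn (branch j (⟨n, f₁ p, hp⟩ : PreimageTree f₁ (t : OnePoint ℂ)))
      (fun q => f₁ (branch j (⟨n + 1, p, hp⟩ : PreimageTree f₁ (t : OnePoint ℂ)) q))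
      (slitSphere j) := by
  have hb := isBranch_branch ht j (⟨n + 1, p, hp⟩ : PreimageTree f₁ (t : OnePoint ℂ))
  refine (isBranch_branch ht j _).eqOn (isPreconnected_slitSphere j) le_rfl
    (continuous_f₁.comp_continuousOn hb.continuousOn) (fun q hq => hb.iterate_apply q hq)
    (upperHalf_subset j (coe_mem_upperHalf.2 ht)) ?_
  rw [branch_base ht, branch_base ht]

end Branch

/-! ### The components of the preimages of the half-planes -/

/-- In the coordinate `w = z² = u + iv`, the imaginary part of `f₁(z)` is a positive multiple of `v`
times this polynomial. -/
noncomputable def kappa (z : ℂ) : ℝ :=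
  (9 / 8 - (z ^ 2).re) * ((z ^ 2).re - 3 / 4) ^ 2 - (z ^ 2).im ^ 2 * ((z ^ 2).re - 5 / 8)

/-- For `ε = 1` the six components of the preimage of the upper half-plane. For `ε = -1` their
complex conjugates, which are the components of the preimage of the lower half-plane. -/
def tileSet (ε : ℝ) : Tile → Set ℂ
  | .A => {z | 0 < kappa z ∧ 3 / 4 < (z ^ 2).re ∧ 0 < ε * (z ^ 2).im ∧ 0 < z.re}
  | .B => {z | 0 < kappa z ∧ (z ^ 2).re < 3 / 4 ∧ 0 < ε * (z ^ 2).im ∧ 0 < z.re}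
  | .C => {z | kappa z < 0 ∧ ε * (z ^ 2).im < 0 ∧ z.re < 0}
  | .D => {z | 0 < kappa z ∧ 3 / 4 < (z ^ 2).re ∧ 0 < ε * (z ^ 2).im ∧ z.re < 0}
  | .E => {z | 0 < kappa z ∧ (z ^ 2).re < 3 / 4 ∧ 0 < ε * (z ^ 2).im ∧ z.re < 0}
  | .F => {z | kappa z < 0 ∧ ε * (z ^ 2).im < 0 ∧ 0 < z.re}

theorem sq_re (z : ℂ) : (z ^ 2).re = z.re ^ 2 - z.im ^ 2 := by
  rw [pow_two, Complex.mul_re]; ring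

theorem sq_im (z : ℂ) : (z ^ 2).im = 2 * z.re * z.im := by
  rw [pow_two, Complex.mul_im]; ring

theorem continuous_sq_re : Continuous fun z : ℂ => (z ^ 2).re := by fun_prop

theorem continuous_sq_im : Continuous fun z : ℂ => (z ^ 2).im := by fun_prop

theorem continuous_kappa : Continuous kappa := by
  unfold kappa
  fun_prop

theorem isOpen_tileSet (ε : ℝ) (x : Tile) : IsOpen (tileSet ε x) := by
  have k1 : IsOpen {z | 0 < kappa z} := isOpen_lt continuous_const continuous_kappa
  have k2 : IsOpen {z | kappa z < 0} := isOpen_lt continuous_kappa continuous_const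
  have u1 : IsOpen {z : ℂ | 3 / 4 < (z ^ 2).re} := isOpen_lt continuous_const continuous_sq_re
  have u2 : IsOpen {z : ℂ | (z ^ 2).re < 3 / 4} := isOpen_lt continuous_sq_re continuous_const
  have v1 : IsOpen {z : ℂ | 0 < ε * (z ^ 2).im} :=
    isOpen_lt continuous_const (continuous_const.mul continuous_sq_im)
  have v2 : IsOpen {z : ℂ | ε * (z ^ 2).im < 0} :=
    isOpen_lt (continuous_const.mul continuous_sq_im) continuous_const
  have r1 : IsOpen {z : ℂ | 0 < z.re} := isOpen_lt continuous_const Complex.continuous_re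
  have r2 : IsOpen {z : ℂ | z.re < 0} := isOpen_lt Complex.continuous_re continuous_const
  cases x
  · exact k1.inter (u1.inter (v1.inter r1))
  · exact k1.inter (u2.inter (v1.inter r1))
  · exact k2.inter (v2.inter r2)
  · exact k1.inter (u1.inter (v1.inter r2))
  · exact k1.inter (u2.inter (v1.inter r2))
  · exact k2.inter (v2.inter r1)

open Classical in
theorem tileSet_disjoint {ε : ℝ} {x y : Tile} {z : ℂ} (hx : z ∈ tileSet ε x)
    (hy : z ∈ tileSet ε y) : x = y := by
  let f : Tile := if kappa z < 0 then (if z.re < 0 then .C else .F) else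
    if 3 / 4 < (z ^ 2).re then (if z.re < 0 then .D else .A) else (if z.re < 0 then .E else .B)
  have key : ∀ x, z ∈ tileSet ε x → x = f := by
    intro x hx
    cases x
    · obtain ⟨h1, h2, h3, h4⟩ := hx
      simp only [f, if_neg h1.not_gt, if_pos h2, if_neg h4.not_gt]
    · obtain ⟨h1, h2, h3, h4⟩ := hx
      simp only [f, if_neg h1.not_gt, if_neg h2.not_gt, if_neg h4.not_gt]
    · obtain ⟨h1, h3, h4⟩ := hx
      simp only [f, if_pos h1, if_pos h4]
    · obtain ⟨h1, h2, h3, h4⟩ := hx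
      simp only [f, if_neg h1.not_gt, if_pos h2, if_pos h4]
    · obtain ⟨h1, h2, h3, h4⟩ := hx
      simp only [f, if_neg h1.not_gt, if_neg h2.not_gt, if_pos h4]
    · obtain ⟨h1, h3, h4⟩ := hx
      simp only [f, if_pos h1, if_neg h4.not_gt]
  rw [key x hx, key y hy]

theorem mul_ratFun_im_pos_iff {z : ℂ} (hd : ratDen z ≠ 0) (ε : ℝ) :
    0 < ε * (ratFun z).im ↔ 0 < ε * (z ^ 2).im * kappa z := by
  have hpos : 0 < 27 / 16 / Complex.normSq (ratDen z) :=
    div_pos (by norm_num) (Complex.normSq_pos.2 hd)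
  have h := ratFun_im (z := z) (u := (z ^ 2).re) (v := (z ^ 2).im) (Complex.eta _).symm hd
  rw [h, show ∀ a b c : ℝ, ε * (a * (b * c)) = a * (ε * b * c) by intros; ring]
  exact mul_pos_iff_of_pos_left hpos

theorem exists_mem_tileSet {ε : ℝ} {z : ℂ} (hd : ratDen z ≠ 0) (hz : 0 < ε * (ratFun z).im) :
    ∃ x, z ∈ tileSet ε x := by
  rw [mul_ratFun_im_pos_iff hd] at hz
  have hv : (z ^ 2).im ≠ 0 := by
    intro h; rw [h] at hz; simp at hz
  have hre : z.re ≠ 0 := by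
    intro h; rw [sq_im, h] at hv; simp at hv
  rcases mul_pos_iff.1 hz with ⟨h1, h2⟩ | ⟨h1, h2⟩
  · have hu : (z ^ 2).re ≠ 3 / 4 := by
      intro h
      rw [kappa, h] at h2
      nlinarith [sq_nonneg (z ^ 2).im]
    rcases hu.lt_or_gt with hu | hu <;> rcases hre.lt_or_gt with hre | hre
    · exact ⟨.E, h2, hu, h1, hre⟩
    · exact ⟨.B, h2, hu, h1, hre⟩
    · exact ⟨.D, h2, hu, h1, hre⟩
    · exact ⟨.A, h2, hu, h1, hre⟩
  · rcases hre.lt_or_gt with hre | hre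
    · exact ⟨.C, h2, h1, hre⟩
    · exact ⟨.F, h2, h1, hre⟩

/-- A map from a connected set whose values are mapped into one half-plane takes all its values in
one component. -/
theorem mem_tileSet_of_isPreconnected {V : Set (OnePoint ℂ)} (hV : IsPreconnected V) {ε : ℝ}
    {s : OnePoint ℂ → OnePoint ℂ} (hs : ContinuousOn s V)
    (him : ∀ q ∈ V, ∃ z : ℂ, s q = z ∧ ratDen z ≠ 0 ∧ 0 < ε * (ratFun z).im) {x : Tile}
    {q₀ : OnePoint ℂ} (hq₀ : q₀ ∈ V) (hx : s q₀ ∈ ((↑) : ℂ → OnePoint ℂ) '' tileSet ε x) :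
    ∀ q ∈ V, s q ∈ ((↑) : ℂ → OnePoint ℂ) '' tileSet ε x := by
  have hopen : ∀ y, IsOpen (((↑) : ℂ → OnePoint ℂ) '' tileSet ε y) := fun y =>
    OnePoint.isOpenEmbedding_coe.isOpenMap _ (isOpen_tileSet ε y)
  have hsub : s '' V ⊆ ((↑) : ℂ → OnePoint ℂ) '' tileSet ε x := by
    refine (hV.image s hs).subset_left_of_subset_union (hopen x)
      (isOpen_iUnion fun y => isOpen_iUnion fun _ : y ≠ x => hopen y) ?_ ?_ ⟨_, ⟨q₀, hq₀, rfl⟩, hx⟩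
    · rw [Set.disjoint_left]
      rintro _ ⟨z, hz, rfl⟩ hz'
      simp only [Set.mem_iUnion, exists_prop] at hz'
      obtain ⟨y, hy, z', hz', h⟩ := hz'
      obtain rfl := OnePoint.coe_injective h
      exact hy (tileSet_disjoint hz' hz)
    · rintro _ ⟨q, hq, rfl⟩
      obtain ⟨z, hz, hd, hi⟩ := him q hq
      obtain ⟨y, hy⟩ := exists_mem_tileSet hd hi
      rw [hz]
      by_cases hyx : y = x
      · exact Or.inl ⟨z, hyx ▸ hy, rfl⟩
      · right
        simp only [Set.mem_iUnion, exists_prop]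
        exact ⟨y, hyx, z, hy, rfl⟩
  exact fun q hq => hsub ⟨q, hq, rfl⟩

/-! ### Crossing the real line -/

/-- The component `cross j x` is the one whose conjugate lies across the edge of `x` that is mapped
to the interval `j`. -/
def cross : Side → Tile → Tile
  | .mid, .A => .A
  | .mid, .B => .F
  | .mid, .C => .E
  | .mid, .D => .D
  | .mid, .E => .C
  | .mid, .F => .B
  | .right, .A => .A
  | .right, .B => .E
  | .right, .C => .C
  | .right, .D => .D
  | .right, .E => .B
  | .right, .F => .F
  | .left, .A => .F
  | .left, .B => .B
  | .left, .C => .D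
  | .left, .D => .C
  | .left, .E => .E
  | .left, .F => .A

/-- A point of each interval for which the cubic equation for `w = z²` splits over the Gaussian
rationals, so that its six preimages are explicit. -/
noncomputable def sample : Side → ℝ
  | .mid => -337 / 338
  | .right => 3169 / 1225
  | .left => -29 / 25

/-- Near the point `z` the preimages of the two half-planes are the component `x` and the conjugate
of the component `y`. -/
def IsEdgePoint (z : ℂ) (x y : Tile) : Prop :=
  (∀ᶠ w in 𝓝 z, ratDen w ≠ 0 → 0 < 1 * (ratFun w).im → w ∈ tileSet 1 x) ∧
    ∀ᶠ w in 𝓝 z, ratDen w ≠ 0 → 0 < -1 * (ratFun w).im → w ∈ tileSet (-1) y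

/-- Near the point `z` the sign of `kappa` decides between the component `x` and the component `y`,
and their conjugates. -/
def IsNear (z : ℂ) (x y : Tile) : Prop :=
  (∀ ε : ℝ, ∀ᶠ w in 𝓝 z, 0 < kappa w → 0 < ε * (w ^ 2).im → w ∈ tileSet ε x) ∧
    ∀ ε : ℝ, ∀ᶠ w in 𝓝 z, kappa w < 0 → ε * (w ^ 2).im < 0 → w ∈ tileSet ε y

section EdgePoints

variable {z : ℂ} {x y : Tile}

theorem eventually_sq_re_gt {a : ℝ} (h : a < (z ^ 2).re) : ∀ᶠ w : ℂ in 𝓝 z, a < (w ^ 2).re :=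
  continuous_sq_re.continuousAt.eventually (lt_mem_nhds h)

theorem eventually_sq_re_lt {a : ℝ} (h : (z ^ 2).re < a) : ∀ᶠ w : ℂ in 𝓝 z, (w ^ 2).re < a :=
  continuous_sq_re.continuousAt.eventually (gt_mem_nhds h)

theorem eventually_re_pos (h : 0 < z.re) : ∀ᶠ w : ℂ in 𝓝 z, 0 < w.re :=
  Complex.continuous_re.continuousAt.eventually (lt_mem_nhds h)

theorem eventually_re_neg (h : z.re < 0) : ∀ᶠ w : ℂ in 𝓝 z, w.re < 0 :=
  Complex.continuous_re.continuousAt.eventually (gt_mem_nhds h)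

theorem isNear_A (hu : 3 / 4 < (z ^ 2).re) (hr : 0 < z.re) : IsNear z .A .F := by
  constructor <;> intro ε <;>
    filter_upwards [eventually_sq_re_gt hu, eventually_re_pos hr] with w h1 h2 h3 h4
  exacts [⟨h3, h1, h4, h2⟩, ⟨h3, h4, h2⟩]

theorem isNear_B (hu : (z ^ 2).re < 3 / 4) (hr : 0 < z.re) : IsNear z .B .F := by
  constructor <;> intro ε <;>
    filter_upwards [eventually_sq_re_lt hu, eventually_re_pos hr] with w h1 h2 h3 h4
  exacts [⟨h3, h1, h4, h2⟩, ⟨h3, h4, h2⟩]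

theorem isNear_D (hu : 3 / 4 < (z ^ 2).re) (hr : z.re < 0) : IsNear z .D .C := by
  constructor <;> intro ε <;>
    filter_upwards [eventually_sq_re_gt hu, eventually_re_neg hr] with w h1 h2 h3 h4
  exacts [⟨h3, h1, h4, h2⟩, ⟨h3, h4, h2⟩]

theorem isNear_E (hu : (z ^ 2).re < 3 / 4) (hr : z.re < 0) : IsNear z .E .C := by
  constructor <;> intro ε <;>
    filter_upwards [eventually_sq_re_lt hu, eventually_re_neg hr] with w h1 h2 h3 h4
  exacts [⟨h3, h1, h4, h2⟩, ⟨h3, h4, h2⟩]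

/-- A point of a real edge: `kappa` keeps its sign while `v` changes sign. -/
theorem IsNear.isEdgePoint_of_kappa_pos (h : IsNear z x y) (hk : 0 < kappa z) :
    IsEdgePoint z x x := by
  have hk' := continuous_kappa.continuousAt.eventually (lt_mem_nhds hk)
  constructor
  · filter_upwards [h.1 1, hk'] with w h1 h2 hd hw
    rw [mul_ratFun_im_pos_iff hd] at hw
    exact h1 h2 (by nlinarith)
  · filter_upwards [h.1 (-1), hk'] with w h1 h2 hd hw
    rw [mul_ratFun_im_pos_iff hd] at hw
    exact h1 h2 (by nlinarith)

theorem IsNear.isEdgePoint_of_kappa_neg (h : IsNear z x y) (hk : kappa z < 0) :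
    IsEdgePoint z y y := by
  have hk' := continuous_kappa.continuousAt.eventually (gt_mem_nhds hk)
  constructor
  · filter_upwards [h.2 1, hk'] with w h1 h2 hd hw
    rw [mul_ratFun_im_pos_iff hd] at hw
    exact h1 h2 (by nlinarith)
  · filter_upwards [h.2 (-1), hk'] with w h1 h2 hd hw
    rw [mul_ratFun_im_pos_iff hd] at hw
    exact h1 h2 (by nlinarith)

/-- A point of an edge that is not on the axes: `v` keeps its sign while `kappa` changes sign. -/
theorem IsNear.isEdgePoint_of_im_pos (h : IsNear z x y) (hv : 0 < (z ^ 2).im) :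
    IsEdgePoint z x y := by
  have hv' := continuous_sq_im.continuousAt.eventually (lt_mem_nhds hv)
  constructor
  · filter_upwards [h.1 1, hv'] with w h1 h2 hd hw
    rw [mul_ratFun_im_pos_iff hd] at hw
    exact h1 (by nlinarith) (by linarith)
  · filter_upwards [h.2 (-1), hv'] with w h1 h2 hd hw
    rw [mul_ratFun_im_pos_iff hd] at hw
    exact h1 (by nlinarith) (by linarith)

theorem IsNear.isEdgePoint_of_im_neg (h : IsNear z x y) (hv : (z ^ 2).im < 0) :
    IsEdgePoint z y x := by
  have hv' := continuous_sq_im.continuousAt.eventually (gt_mem_nhds hv)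
  constructor
  · filter_upwards [h.2 1, hv'] with w h1 h2 hd hw
    rw [mul_ratFun_im_pos_iff hd] at hw
    exact h1 (by nlinarith) (by linarith)
  · filter_upwards [h.1 (-1), hv'] with w h1 h2 hd hw
    rw [mul_ratFun_im_pos_iff hd] at hw
    exact h1 (by nlinarith) (by linarith)

/-- Near a point of the imaginary axis the signs of `v` and of the imaginary part of `z` determine
the sign of the real part of `z`. -/
theorem isEdgePoint_of_im_pos (hk : 0 < kappa z) (hu : (z ^ 2).re < 3 / 4) (hi : 0 < z.im) :
    IsEdgePoint z .B .E := by
  have hk' := continuous_kappa.continuousAt.eventually (lt_mem_nhds hk)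
  have hi' := Complex.continuous_im.continuousAt.eventually (lt_mem_nhds hi)
  constructor <;>
    filter_upwards [eventually_sq_re_lt hu, hk', hi'] with w h1 h2 h3 hd hw <;>
    rw [mul_ratFun_im_pos_iff hd, mul_pos_iff_of_pos_right h2] at hw <;>
    refine ⟨h2, h1, hw, ?_⟩ <;> rw [sq_im] at hw <;> nlinarith

theorem isEdgePoint_of_im_neg (hk : 0 < kappa z) (hu : (z ^ 2).re < 3 / 4) (hi : z.im < 0) :
    IsEdgePoint z .E .B := by
  have hk' := continuous_kappa.continuousAt.eventually (lt_mem_nhds hk)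
  have hi' := Complex.continuous_im.continuousAt.eventually (gt_mem_nhds hi)
  constructor <;>
    filter_upwards [eventually_sq_re_lt hu, hk', hi'] with w h1 h2 h3 hd hw <;>
    rw [mul_ratFun_im_pos_iff hd, mul_pos_iff_of_pos_right h2] at hw <;>
    refine ⟨h2, h1, hw, ?_⟩ <;> rw [sq_im] at hw <;> nlinarith

theorem ratFun_eq_iff {r : ℂ} (hd : ratDen z ≠ 0) :
    ratFun z = r ↔ 27 / 32 * (z ^ 2 - 1) = (r - 1) * (z ^ 2 * (z ^ 2 - 9 / 8) ^ 2) := by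
  rw [← sub_left_inj (a := 1), ratFun_sub_one hd, div_eq_iff hd, ratDen]

theorem exists_isEdgePoint_mid (hd : ratDen z ≠ 0) (hz : ratFun z = (sample .mid : ℂ)) :
    ∃ x, IsEdgePoint z x (cross .mid x) := by
  rw [ratFun_eq_iff hd] at hz
  have hroots : (z ^ 2 - 4 / 5) * ((z ^ 2 - (29 / 40 + Complex.I / 20)) *
      (z ^ 2 - (29 / 40 - Complex.I / 20))) = 0 := by
    simp only [sample] at hz
    push_cast at hz
    linear_combination (338 / 675) * hz - (z ^ 2 - 4 / 5) / 400 * Complex.I_sq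
  rcases mul_eq_zero.1 hroots with h | h
  · have h1 := congrArg Complex.re (sub_eq_zero.1 h)
    have h2 := congrArg Complex.im (sub_eq_zero.1 h)
    norm_num at h1 h2
    have hk : 0 < kappa z := by rw [kappa, h1, h2]; norm_num
    have hu : 3 / 4 < (z ^ 2).re := by rw [h1]; norm_num
    rw [sq_re] at h1
    rcases lt_trichotomy z.re 0 with hr | hr | hr
    · exact ⟨.D, (isNear_D hu hr).isEdgePoint_of_kappa_pos hk⟩
    · rw [hr] at h1; nlinarith
    · exact ⟨.A, (isNear_A hu hr).isEdgePoint_of_kappa_pos hk⟩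
  · have key : (z ^ 2).re = 29 / 40 ∧ ((z ^ 2).im = 1 / 20 ∨ (z ^ 2).im = -1 / 20) := by
      rcases mul_eq_zero.1 h with h | h
      · rw [sub_eq_zero.1 h]; norm_num
      · rw [sub_eq_zero.1 h]; norm_num
    obtain ⟨h1, h2⟩ := key
    have hu : (z ^ 2).re < 3 / 4 := by rw [h1]; norm_num
    have hr0 : z.re ≠ 0 := by
      intro hr; rw [sq_im, hr] at h2; norm_num at h2
    rcases h2 with h2 | h2 <;> rcases hr0.lt_or_gt with hr | hr
    · exact ⟨.E, (isNear_E hu hr).isEdgePoint_of_im_pos (by rw [h2]; norm_num)⟩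
    · exact ⟨.B, (isNear_B hu hr).isEdgePoint_of_im_pos (by rw [h2]; norm_num)⟩
    · exact ⟨.C, (isNear_E hu hr).isEdgePoint_of_im_neg (by rw [h2]; norm_num)⟩
    · exact ⟨.F, (isNear_B hu hr).isEdgePoint_of_im_neg (by rw [h2]; norm_num)⟩

theorem exists_isEdgePoint_left (hd : ratDen z ≠ 0) (hz : ratFun z = (sample .left : ℂ)) :
    ∃ x, IsEdgePoint z x (cross .left x) := by
  rw [ratFun_eq_iff hd] at hz
  have hroots : (z ^ 2 - 1 / 2) * ((z ^ 2 - (7 / 8 + Complex.I / 8)) *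
      (z ^ 2 - (7 / 8 - Complex.I / 8))) = 0 := by
    simp only [sample] at hz
    push_cast at hz
    linear_combination (25 / 54) * hz - (z ^ 2 - 1 / 2) / 64 * Complex.I_sq
  rcases mul_eq_zero.1 hroots with h | h
  · have h1 := congrArg Complex.re (sub_eq_zero.1 h)
    have h2 := congrArg Complex.im (sub_eq_zero.1 h)
    norm_num at h1 h2
    have hk : 0 < kappa z := by rw [kappa, h1, h2]; norm_num
    have hu : (z ^ 2).re < 3 / 4 := by rw [h1]; norm_num
    rw [sq_re] at h1
    rcases lt_trichotomy z.re 0 with hr | hr | hr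
    · exact ⟨.E, (isNear_E hu hr).isEdgePoint_of_kappa_pos hk⟩
    · rw [hr] at h1; nlinarith
    · exact ⟨.B, (isNear_B hu hr).isEdgePoint_of_kappa_pos hk⟩
  · have key : (z ^ 2).re = 7 / 8 ∧ ((z ^ 2).im = 1 / 8 ∨ (z ^ 2).im = -1 / 8) := by
      rcases mul_eq_zero.1 h with h | h
      · rw [sub_eq_zero.1 h]; norm_num
      · rw [sub_eq_zero.1 h]; norm_num
    obtain ⟨h1, h2⟩ := key
    have hu : 3 / 4 < (z ^ 2).re := by rw [h1]; norm_num
    have hr0 : z.re ≠ 0 := by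
      intro hr; rw [sq_im, hr] at h2; norm_num at h2
    rcases h2 with h2 | h2 <;> rcases hr0.lt_or_gt with hr | hr
    · exact ⟨.D, (isNear_D hu hr).isEdgePoint_of_im_pos (by rw [h2]; norm_num)⟩
    · exact ⟨.A, (isNear_A hu hr).isEdgePoint_of_im_pos (by rw [h2]; norm_num)⟩
    · exact ⟨.C, (isNear_D hu hr).isEdgePoint_of_im_neg (by rw [h2]; norm_num)⟩
    · exact ⟨.F, (isNear_A hu hr).isEdgePoint_of_im_neg (by rw [h2]; norm_num)⟩

/-- The six preimages of `sample .right`, one on the boundary of each component. -/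
noncomputable def rightPoint : Tile → ℂ
  | .A => (√(49 / 48) : ℝ)
  | .B => (√(1 / 3) : ℝ) * Complex.I
  | .C => -(√(25 / 16) : ℝ)
  | .D => -(√(49 / 48) : ℝ)
  | .E => -((√(1 / 3) : ℝ) * Complex.I)
  | .F => (√(25 / 16) : ℝ)

theorem exists_isEdgePoint_right (hd : ratDen z ≠ 0) (hz : ratFun z = (sample .right : ℂ)) :
    ∃ x, IsEdgePoint z x (cross .right x) ∧ z = rightPoint x := by
  rw [ratFun_eq_iff hd] at hz
  have hsq (a : ℝ) (ha : 0 ≤ a) : ((√a : ℝ) : ℂ) ^ 2 = (a : ℂ) := by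
    rw [← Complex.ofReal_pow, Real.sq_sqrt ha]
  have hroots : (z ^ 2 - 49 / 48) * ((z ^ 2 - -1 / 3) * (z ^ 2 - 25 / 16)) = 0 := by
    simp only [sample] at hz
    push_cast at hz
    linear_combination -(1225 / 1944) * hz
  rcases mul_eq_zero.1 hroots with h | h
  · have h1 := congrArg Complex.re (sub_eq_zero.1 h)
    have h2 := congrArg Complex.im (sub_eq_zero.1 h)
    norm_num at h1 h2
    have hk : 0 < kappa z := by rw [kappa, h1, h2]; norm_num
    have hu : 3 / 4 < (z ^ 2).re := by rw [h1]; norm_num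
    have hz2 : z ^ 2 = ((√(49 / 48) : ℝ) : ℂ) ^ 2 := by
      rw [hsq _ (by norm_num), sub_eq_zero.1 h]; norm_num
    rcases sq_eq_sq_iff_eq_or_eq_neg.1 hz2 with h3 | h3
    · have hr : 0 < z.re := by rw [h3]; simp
      exact ⟨.A, (isNear_A hu hr).isEdgePoint_of_kappa_pos hk, h3⟩
    · have hr : z.re < 0 := by rw [h3]; simp
      exact ⟨.D, (isNear_D hu hr).isEdgePoint_of_kappa_pos hk, h3⟩
  rcases mul_eq_zero.1 h with h | h
  · have h1 := congrArg Complex.re (sub_eq_zero.1 h)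
    have h2 := congrArg Complex.im (sub_eq_zero.1 h)
    norm_num at h1 h2
    have hk : 0 < kappa z := by rw [kappa, h1, h2]; norm_num
    have hu : (z ^ 2).re < 3 / 4 := by rw [h1]; norm_num
    have hz2 : z ^ 2 = (((√(1 / 3) : ℝ) : ℂ) * Complex.I) ^ 2 := by
      rw [mul_pow, hsq _ (by norm_num), sub_eq_zero.1 h, Complex.I_sq]; norm_num
    rcases sq_eq_sq_iff_eq_or_eq_neg.1 hz2 with h3 | h3
    · have hi : 0 < z.im := by rw [h3]; simp
      exact ⟨.B, isEdgePoint_of_im_pos hk hu hi, h3⟩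
    · have hi : z.im < 0 := by rw [h3]; simp
      exact ⟨.E, isEdgePoint_of_im_neg hk hu hi, h3⟩
  · have h1 := congrArg Complex.re (sub_eq_zero.1 h)
    have h2 := congrArg Complex.im (sub_eq_zero.1 h)
    norm_num at h1 h2
    have hk : kappa z < 0 := by rw [kappa, h1, h2]; norm_num
    have hu : 3 / 4 < (z ^ 2).re := by rw [h1]; norm_num
    have hz2 : z ^ 2 = ((√(25 / 16) : ℝ) : ℂ) ^ 2 := by
      rw [hsq _ (by norm_num), sub_eq_zero.1 h]; norm_num
    rcases sq_eq_sq_iff_eq_or_eq_neg.1 hz2 with h3 | h3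
    · have hr : 0 < z.re := by rw [h3]; simp
      exact ⟨.F, (isNear_A hu hr).isEdgePoint_of_kappa_neg hk, h3⟩
    · have hr : z.re < 0 := by rw [h3]; simp
      exact ⟨.C, (isNear_D hu hr).isEdgePoint_of_kappa_neg hk, h3⟩

theorem exists_isEdgePoint (j : Side) (hd : ratDen z ≠ 0) (hz : ratFun z = (sample j : ℂ)) :
    ∃ x, IsEdgePoint z x (cross j x) := by
  cases j
  · exact exists_isEdgePoint_mid hd hz
  · obtain ⟨x, hx, -⟩ := exists_isEdgePoint_right hd hz
    exact ⟨x, hx⟩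
  · exact exists_isEdgePoint_left hd hz

end EdgePoints

/-! ### The branches of the inverse of the map itself -/

theorem sample_mem_slitPlane (j : Side) : (sample j : ℂ) ∈ slitPlane j := by
  cases j
  · exact Or.inr (by norm_num [sample])
  · exact Or.inr (by norm_num [sample])
  · exact Or.inr (by norm_num [sample])

namespace IsBranch

variable {j : Side} {s : OnePoint ℂ → OnePoint ℂ} (hs : IsBranch j 1 s)
include hs

theorem exists_coe {y : ℂ} (hy : y ∈ slitPlane j) :
    ∃ z : ℂ, s y = z ∧ ratDen z ≠ 0 ∧ ratFun z = y := by
  have h1 : f₁ (s y) = y := hs.iterate_apply y (coe_mem_slitSphere.2 hy)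
  obtain ⟨z, hz, hd, hf⟩ := exists_coe_of_f₁_mem
    (h1 ▸ slitSphere_subset j (coe_mem_slitSphere.2 hy))
  exact ⟨z, hz, hd, OnePoint.coe_injective (hf.symm.trans h1)⟩

theorem mem_tileSet_of_upperHalf {x : Tile} {q₀ : OnePoint ℂ} (hq₀ : q₀ ∈ upperHalf)
    (hx : s q₀ ∈ ((↑) : ℂ → OnePoint ℂ) '' tileSet 1 x) :
    ∀ q ∈ upperHalf, s q ∈ ((↑) : ℂ → OnePoint ℂ) '' tileSet 1 x := by
  refine mem_tileSet_of_isPreconnected isPreconnected_upperHalf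
    (hs.continuousOn.mono (upperHalf_subset j)) ?_ hq₀ hx
  rintro _ ⟨y, hy, rfl⟩
  obtain ⟨z, hz, hd, hf⟩ := hs.exists_coe (mem_slitPlane_of_im_ne (j := j) (ne_of_gt hy))
  exact ⟨z, hz, hd, by rw [hf, one_mul]; exact hy⟩

theorem mem_tileSet_of_lowerHalf {x : Tile} {q₀ : OnePoint ℂ} (hq₀ : q₀ ∈ lowerHalf)
    (hx : s q₀ ∈ ((↑) : ℂ → OnePoint ℂ) '' tileSet (-1) x) :
    ∀ q ∈ lowerHalf, s q ∈ ((↑) : ℂ → OnePoint ℂ) '' tileSet (-1) x := by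
  refine mem_tileSet_of_isPreconnected isPreconnected_lowerHalf
    (hs.continuousOn.mono (lowerHalf_subset j)) ?_ hq₀ hx
  rintro _ ⟨y, hy, rfl⟩
  obtain ⟨z, hz, hd, hf⟩ := hs.exists_coe (mem_slitPlane_of_im_ne (j := j) (ne_of_lt hy))
  refine ⟨z, hz, hd, ?_⟩
  rw [hf]
  have : y.im < 0 := hy
  linarith

/-- A real point of the slit plane is approached from both half-planes. -/
theorem exists_near {r : ℝ} (hr : (r : ℂ) ∈ slitPlane j) {z : ℂ} (hz : s (r : ℂ) = z) {N : Set ℂ}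
    (hN : N ∈ 𝓝 z) {ε : ℝ} (hε : 0 < ε * ε) :
    ∃ y w : ℂ, 0 < ε * y.im ∧ s y = w ∧ w ∈ N := by
  have h1 : ContinuousAt s ((r : ℂ) : OnePoint ℂ) :=
    hs.continuousOn.continuousAt ((isOpen_slitSphere j).mem_nhds (coe_mem_slitSphere.2 hr))
  have h2 : Tendsto (fun a : ℝ => (((r : ℂ) + (ε * a : ℝ) * Complex.I : ℂ) : OnePoint ℂ))
      (𝓝[>] 0) (𝓝 ((r : ℂ) : OnePoint ℂ)) := by
    have : Continuous fun a : ℝ => (((r : ℂ) + (ε * a : ℝ) * Complex.I : ℂ) : OnePoint ℂ) :=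
      OnePoint.continuous_coe.comp (by fun_prop)
    have h := this.tendsto 0
    simp only [mul_zero, Complex.ofReal_zero, zero_mul, add_zero] at h
    exact h.mono_left nhdsWithin_le_nhds
  have h3 : ((↑) : ℂ → OnePoint ℂ) '' N ∈ 𝓝 (s (r : ℂ)) := by
    rw [hz, OnePoint.nhds_coe_eq]
    exact image_mem_map hN
  obtain ⟨a, ⟨w, hw, hw'⟩, ha⟩ :=
    (((h1.tendsto.comp h2).eventually_mem h3).and self_mem_nhdsWithin).exists
  refine ⟨_, w, ?_, hw'.symm, hw⟩
  have ha : 0 < a := ha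
  have : ((r : ℂ) + (ε * a : ℝ) * Complex.I).im = ε * a := by simp
  rw [this, ← mul_assoc]
  exact mul_pos hε ha

/-- The branch with values in the component `x` on the upper half-plane has an edge point of `x` as
its value at the sample point; this determines its values on the lower half-plane. -/
theorem eq_and_mem_tileSet_of_isEdgePoint {x x' y : Tile} {z : ℂ} (hz : s (sample j : ℂ) = z)
    (hxy : IsEdgePoint z x' y) {q₀ : OnePoint ℂ} (hq₀ : q₀ ∈ upperHalf)
    (hx : s q₀ ∈ ((↑) : ℂ → OnePoint ℂ) '' tileSet 1 x) :
    x = x' ∧ ∀ q ∈ lowerHalf, s q ∈ ((↑) : ℂ → OnePoint ℂ) '' tileSet (-1) y := by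
  have hsj := sample_mem_slitPlane j
  constructor
  · obtain ⟨a, w, ha, hw, hwN⟩ := hs.exists_near hsj hz hxy.1 (ε := 1) (by norm_num)
    rw [one_mul] at ha
    obtain ⟨w', hw', hd, hf⟩ := hs.exists_coe (mem_slitPlane_of_im_ne (j := j) ha.ne')
    obtain rfl := OnePoint.coe_injective (hw.symm.trans hw')
    have h1 := hwN hd (by rw [hf, one_mul]; exact ha)
    obtain ⟨w₂, hw₂, h⟩ := hs.mem_tileSet_of_upperHalf hq₀ hx a (coe_mem_upperHalf.2 ha)
    obtain rfl := OnePoint.coe_injective (h.trans hw')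
    exact tileSet_disjoint hw₂ h1
  · obtain ⟨a, w, ha, hw, hwN⟩ := hs.exists_near hsj hz hxy.2 (ε := -1) (by norm_num)
    have ha' : a.im < 0 := by linarith
    obtain ⟨w', hw', hd, hf⟩ := hs.exists_coe (mem_slitPlane_of_im_ne (j := j) ha'.ne)
    obtain rfl := OnePoint.coe_injective (hw.symm.trans hw')
    have h1 := hwN hd (by rw [hf]; exact ha)
    exact hs.mem_tileSet_of_lowerHalf (coe_mem_lowerHalf.2 ha') ⟨w, h1, hw.symm⟩

/-- The branch on the slit plane `j` that starts in the component `x` passes to the conjugate of the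
component `cross j x`. -/
theorem mem_tileSet_cross {x : Tile} {q₀ : OnePoint ℂ} (hq₀ : q₀ ∈ upperHalf)
    (hx : s q₀ ∈ ((↑) : ℂ → OnePoint ℂ) '' tileSet 1 x) :
    ∀ q ∈ lowerHalf, s q ∈ ((↑) : ℂ → OnePoint ℂ) '' tileSet (-1) (cross j x) := by
  obtain ⟨z, hz, hd, hf⟩ := hs.exists_coe (sample_mem_slitPlane j)
  obtain ⟨x', hx'⟩ := exists_isEdgePoint j hd hf
  obtain ⟨rfl, h⟩ := hs.eq_and_mem_tileSet_of_isEdgePoint hz hx' hq₀ hx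
  exact h

end IsBranch

theorem IsBranch.apply_sample_right {s : OnePoint ℂ → OnePoint ℂ} (hs : IsBranch .right 1 s)
    {x : Tile} {q₀ : OnePoint ℂ} (hq₀ : q₀ ∈ upperHalf)
    (hx : s q₀ ∈ ((↑) : ℂ → OnePoint ℂ) '' tileSet 1 x) :
    s (sample .right : ℂ) = rightPoint x := by
  obtain ⟨z, hz, hd, hf⟩ := hs.exists_coe (sample_mem_slitPlane .right)
  obtain ⟨x', hx', hzx⟩ := exists_isEdgePoint_right hd hf
  obtain ⟨rfl, -⟩ := hs.eq_and_mem_tileSet_of_isEdgePoint hz hx' hq₀ hx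
  rw [hz, hzx]

/-- Each component contains at most one preimage of a point of the upper half-plane: the branch
through it on the right-hand slit plane is determined by its value at the sample point. -/
theorem eq_of_mem_tileSet {q p p' : OnePoint ℂ} (hq : q ∈ upperHalf) (hp : f₁ p = q)
    (hp' : f₁ p' = q) {x : Tile} (hx : p ∈ ((↑) : ℂ → OnePoint ℂ) '' tileSet 1 x)
    (hx' : p' ∈ ((↑) : ℂ → OnePoint ℂ) '' tileSet 1 x) : p = p' := by
  have hqr := upperHalf_subset .right hq
  obtain ⟨s, hs, hsq⟩ := exists_isBranch (j := .right) (n := 1) hqr hp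
  obtain ⟨s', hs', hsq'⟩ := exists_isBranch (j := .right) (n := 1) hqr hp'
  have h := hs.apply_sample_right hq (hsq ▸ hx)
  have h' := hs'.apply_sample_right hq (hsq' ▸ hx')
  have key := hs.eqOn (isPreconnected_slitSphere .right) le_rfl hs'.continuousOn
    hs'.iterate_apply (coe_mem_slitSphere.2 (sample_mem_slitPlane .right)) (h.trans h'.symm) hqr
  rw [← hsq, ← hsq', key]

theorem conj_mem_tileSet {z : ℂ} {x : Tile} (hz : z ∈ tileSet (-1) x) :
    starRingEnd ℂ z ∈ tileSet 1 x := by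
  have h1 : ((starRingEnd ℂ z) ^ 2).re = (z ^ 2).re := by rw [← map_pow, Complex.conj_re]
  have h2 : 1 * ((starRingEnd ℂ z) ^ 2).im = -1 * (z ^ 2).im := by
    rw [← map_pow, Complex.conj_im]; ring
  have h3 : kappa (starRingEnd ℂ z) = kappa z := by
    simp only [kappa, ← map_pow, Complex.conj_re, Complex.conj_im, neg_sq]
  cases x <;> simpa only [tileSet, Set.mem_ofPred_eq, h1, h2, h3, Complex.conj_re] using hz

/-- The analogue for the lower half-plane, which follows by complex conjugation. -/
theorem eq_of_mem_tileSet_neg {q p p' : OnePoint ℂ} (hq : q ∈ lowerHalf) (hp : f₁ p = q)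
    (hp' : f₁ p' = q) {x : Tile} (hx : p ∈ ((↑) : ℂ → OnePoint ℂ) '' tileSet (-1) x)
    (hx' : p' ∈ ((↑) : ℂ → OnePoint ℂ) '' tileSet (-1) x) : p = p' := by
  obtain ⟨y, hy, rfl⟩ := hq
  obtain ⟨z, hz, rfl⟩ := hx
  obtain ⟨z', hz', rfl⟩ := hx'
  have hmem := slitSphere_subset .mid (lowerHalf_subset .mid (coe_mem_lowerHalf.2 hy))
  have conj {w : ℂ} (hw : f₁ w = y) : f₁ (starRingEnd ℂ w : ℂ) = (starRingEnd ℂ y : ℂ) := by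
    obtain ⟨w', hw', hd, hf⟩ := exists_coe_of_f₁_mem (hw ▸ hmem)
    obtain rfl := OnePoint.coe_injective hw'
    have hsq : (starRingEnd ℂ w) ^ 2 = starRingEnd ℂ (w ^ 2) := (map_pow _ _ _).symm
    have hd' : ratDen (starRingEnd ℂ w) ≠ 0 := by
      rw [ratDen_conj_of_sq hsq]
      exact (map_ne_zero _).2 hd
    rw [f₁_coe_of_ne hd', ratFun_conj_of_sq hsq, OnePoint.coe_injective (hf.symm.trans hw)]
  have hu : ((starRingEnd ℂ y : ℂ) : OnePoint ℂ) ∈ upperHalf := by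
    rw [coe_mem_upperHalf, Complex.conj_im]
    exact neg_pos.2 hy
  have := eq_of_mem_tileSet hu (conj hp) (conj hp') ⟨_, conj_mem_tileSet hz, rfl⟩
    ⟨_, conj_mem_tileSet hz', rfl⟩
  rw [(starRingEnd ℂ).injective (OnePoint.coe_injective this)]

theorem exists_mem_tileSet_of_f₁_mem {p : OnePoint ℂ} (hp : f₁ p ∈ upperHalf) :
    ∃ x, p ∈ ((↑) : ℂ → OnePoint ℂ) '' tileSet 1 x := by
  obtain ⟨z, rfl, hd, hf⟩ := exists_coe_of_f₁_mem
    (slitSphere_subset .mid (upperHalf_subset .mid hp))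
  rw [hf, coe_mem_upperHalf] at hp
  obtain ⟨x, hx⟩ := exists_mem_tileSet hd (by rwa [one_mul])
  exact ⟨x, z, hx, rfl⟩

/-- The slit plane into which the branch that belongs to the interval `j` and the component `x`
maps: on the real line the map takes values in `(-∞, 1)` only on `(-1, 1)` and values in `(1, ∞)`
only outside `[-1, 1]`, and each component lies on one side of the imaginary axis. -/
def target : Side → Tile → Side
  | .mid, _ => .mid
  | .left, _ => .mid
  | .right, .A => .right
  | .right, .B => .right
  | .right, .C => .left
  | .right, .D => .left
  | .right, .E => .left
  | .right, .F => .right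

/-- On the real line the value of the map is on the same side of `1` as `a²`. -/
theorem ratFun_ofReal_sub_one {a : ℝ} (hd : ratDen a ≠ 0) :
    ∃ d : ℝ, 0 < d ∧ (ratFun a).re - 1 = d * (a ^ 2 - 1) := by
  have h1 : ratDen (a : ℂ) = ((a ^ 2 * (a ^ 2 - 9 / 8) ^ 2 : ℝ) : ℂ) := by
    rw [ratDen]; push_cast; ring
  have h2 : 0 < a ^ 2 * (a ^ 2 - 9 / 8) ^ 2 := by
    refine lt_of_le_of_ne (by positivity) fun h => hd ?_
    rw [h1, ← h, Complex.ofReal_zero]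
  refine ⟨27 / 32 / (a ^ 2 * (a ^ 2 - 9 / 8) ^ 2), by positivity, ?_⟩
  have h3 := ratFun_sub_one hd
  rw [h1] at h3
  have h4 : ratFun (a : ℂ) - 1 =
      ((27 / 32 / (a ^ 2 * (a ^ 2 - 9 / 8) ^ 2) * (a ^ 2 - 1) : ℝ) : ℂ) := by
    rw [h3]; push_cast; ring
  have h5 := congrArg Complex.re h4
  rwa [Complex.ofReal_re, Complex.sub_re, Complex.one_re] at h5

theorem tileSet_re {x : Tile} {ε : ℝ} {z : ℂ} (hz : z ∈ tileSet ε x) :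
    (target .right x = .right ∧ 0 < z.re) ∨ (target .right x = .left ∧ z.re < 0) := by
  cases x
  · exact Or.inl ⟨rfl, hz.2.2.2⟩
  · exact Or.inl ⟨rfl, hz.2.2.2⟩
  · exact Or.inr ⟨rfl, hz.2.2⟩
  · exact Or.inr ⟨rfl, hz.2.2.2⟩
  · exact Or.inr ⟨rfl, hz.2.2.2⟩
  · exact Or.inl ⟨rfl, hz.2.2⟩

theorem IsBranch.mapsTo_target {j : Side} {s : OnePoint ℂ → OnePoint ℂ} (hs : IsBranch j 1 s)
    {x : Tile} {q₀ : OnePoint ℂ} (hq₀ : q₀ ∈ upperHalf)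
    (hx : s q₀ ∈ ((↑) : ℂ → OnePoint ℂ) '' tileSet 1 x) :
    Set.MapsTo s (slitSphere j) (slitSphere (target j x)) := by
  rintro _ ⟨y, hy, rfl⟩
  obtain ⟨z, hz, hd, hf⟩ := hs.exists_coe hy
  rw [hz, coe_mem_slitSphere]
  by_cases hzi : z.im = 0
  swap
  · exact mem_slitPlane_of_im_ne hzi
  obtain ⟨a, rfl⟩ : ∃ a : ℝ, z = a := ⟨z.re, Complex.ext rfl hzi⟩
  have hyi : y.im = 0 := by
    rw [← hf, ratFun_im (u := a ^ 2) (v := 0) _ hd]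
    · ring
    · apply Complex.ext <;> simp [sq_re, sq_im]
  obtain ⟨r, rfl⟩ : ∃ r : ℝ, y = r := ⟨y.re, Complex.ext rfl hyi⟩
  obtain ⟨d, hd0, hda⟩ := ratFun_ofReal_sub_one hd
  rw [hf, Complex.ofReal_re] at hda
  have hmid (hr : r < 1) : (a : ℂ) ∈ slitPlane .mid := by
    refine Or.inr ?_
    rw [Complex.ofReal_re]
    have : a ^ 2 < 1 := by nlinarith
    exact abs_lt.1 ((sq_lt_one_iff_abs_lt_one a).1 this)
  cases j
  · rcases hy with hy | hy
    · exact absurd hyi hy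
    · exact hmid hy.2
  · have hr : 1 < r := by
      rcases hy with hy | hy
      · exact absurd hyi hy
      · exact hy
    have ha : 1 < |a| := by
      rw [← sq_lt_sq₀ zero_le_one (abs_nonneg a), sq_abs, one_pow]
      nlinarith
    -- the value at a real point lies in the closure of the component
    have hclosed (N : Set ℂ) (hN : N ∈ 𝓝 (a : ℂ)) : ∃ w ∈ N, w ∈ tileSet 1 x := by
      obtain ⟨b, w, hb, hw, hwN⟩ := hs.exists_near hy hz hN (ε := 1) (by norm_num)
      rw [one_mul] at hb
      obtain ⟨w', hw', h⟩ := hs.mem_tileSet_of_upperHalf hq₀ hx b (coe_mem_upperHalf.2 hb)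
      obtain rfl := OnePoint.coe_injective (h.trans hw)
      exact ⟨w', hwN, hw'⟩
    rcases lt_abs.1 ha with ha | ha
    · obtain ⟨w, hw, hwx⟩ := hclosed _ (eventually_re_pos (z := a)
        (by rw [Complex.ofReal_re]; linarith))
      rcases tileSet_re hwx with ⟨h, -⟩ | ⟨-, h⟩
      · rw [h]; exact Or.inr ha
      · exact absurd hw h.not_gt
    · obtain ⟨w, hw, hwx⟩ := hclosed _ (eventually_re_neg (z := a)
        (by rw [Complex.ofReal_re]; linarith))
      rcases tileSet_re hwx with ⟨-, h⟩ | ⟨h, -⟩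
      · exact absurd hw h.not_gt
      · rw [h]; exact Or.inr (by rw [Complex.ofReal_re]; linarith)
  · rcases hy with hy | hy
    · exact absurd hyi hy
    · rw [Complex.ofReal_re] at hy
      exact hmid (by linarith)

/-! ### The monodromy action -/

section Monodromy

variable {t : ℂ}

theorem parent_of_fst_eq_zero {v : PreimageTree f₁ (t : OnePoint ℂ)} (h : v.1 = 0) :
    PreimageTree.parent f₁ t v = v := by
  obtain ⟨n, p⟩ := v
  obtain rfl : n = 0 := h
  rfl

theorem parent_of_fst_eq_succ {v : PreimageTree f₁ (t : OnePoint ℂ)} {n : ℕ} (h : v.1 = n + 1) :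
    (PreimageTree.parent f₁ t v).1 = n ∧ (PreimageTree.parent f₁ t v).2.1 = f₁ v.2.1 := by
  obtain ⟨m, p⟩ := v
  obtain rfl : m = n + 1 := h
  exact ⟨rfl, rfl⟩

/-- Monodromy in terms of the vertices of the disjoint union, whose levels are preserved. -/
theorem isMonodromy_iff {γ : Path (t : OnePoint ℂ) t}
    {g : TreeAut (PreimageTree.parent f₁ (t : OnePoint ℂ))} :
    IsMonodromy γ g ↔ ∀ v, (g v).1 = v.1 ∧ LiftConnects f₁ v.1 γ v.2.1 (g v).2.1 := by
  constructor
  · rintro h ⟨n, p⟩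
    obtain ⟨q, hq, hl⟩ := h n p
    rw [hq]
    exact ⟨rfl, hl⟩
  · intro h n p
    obtain ⟨h1, h2⟩ := h ⟨n, p⟩
    generalize g ⟨n, p⟩ = w at h1 h2 ⊢
    obtain ⟨m, q⟩ := w
    obtain rfl : m = n := h1
    exact ⟨q, rfl, h2⟩

theorem LiftConnects.apply_f₁ {x y : OnePoint ℂ} {γ : Path x y} {n : ℕ} {p q : OnePoint ℂ}
    (h : LiftConnects f₁ (n + 1) γ p q) : LiftConnects f₁ n γ (f₁ p) (f₁ q) := by
  obtain ⟨Γ, hΓ⟩ := h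
  exact ⟨Γ.map continuous_f₁, hΓ⟩

theorem LiftConnects.congr_level {x y : OnePoint ℂ} {γ : Path x y} {m n : ℕ} {p q : OnePoint ℂ}
    (h : LiftConnects f₁ m γ p q) (hmn : m = n) : LiftConnects f₁ n γ p q := hmn ▸ h

/-- The inverse automorphism is given by the lifts of the reversed loop. -/
theorem existsUnique_isMonodromy {γ : Path (t : OnePoint ℂ) t}
    (hγ : ∀ s, γ s ∈ puncturedSphere) :
    ∃! g : TreeAut (PreimageTree.parent f₁ (t : OnePoint ℂ)), IsMonodromy γ g := by
  have hlift (δ : Path (t : OnePoint ℂ) t) (hδ : ∀ s, δ s ∈ puncturedSphere)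
      (v : PreimageTree f₁ (t : OnePoint ℂ)) : ∃ w : PreimageTree f₁ (t : OnePoint ℂ),
      w.1 = v.1 ∧ LiftConnects f₁ v.1 δ v.2.1 w.2.1 := by
    obtain ⟨q, hq, hl⟩ := exists_liftConnects hδ v.2.2
    exact ⟨⟨v.1, q, hq⟩, rfl, hl⟩
  have hγ' : ∀ s, γ.symm s ∈ puncturedSphere := fun s => hγ _
  choose F hF1 hF2 using hlift γ hγ
  choose G hG1 hG2 using hlift γ.symm hγ'
  have hGF (v) : G (F v) = v := by
    have h1 : (G (F v)).1 = v.1 := (hG1 _).trans (hF1 v)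
    have h2 := (hG2 (F v)).congr_level (hF1 v)
    exact vertex_ext h1 (h2.unique hγ' (hF2 v).symm)
  have hFG (v) : F (G v) = v := by
    have h1 : (F (G v)).1 = v.1 := (hF1 _).trans (hG1 v)
    have h2 := (hF2 (G v)).congr_level (hG1 v)
    have h3 := (hG2 v).symm
    rw [Path.symm_symm] at h3
    exact vertex_ext h1 (h2.unique hγ h3)
  have hpar (v) : F (PreimageTree.parent f₁ t v) = PreimageTree.parent f₁ t (F v) := by
    obtain ⟨n, p⟩ := v
    cases n with
    | zero => rw [parent_of_fst_eq_zero rfl, parent_of_fst_eq_zero (hF1 _)]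
    | succ n =>
      obtain ⟨h1, h2⟩ := parent_of_fst_eq_succ (hF1 ⟨n + 1, p⟩)
      refine vertex_ext ((hF1 _).trans h1.symm) ?_
      rw [h2]
      exact (hF2 (PreimageTree.parent f₁ t ⟨n + 1, p⟩)).unique hγ (hF2 ⟨n + 1, p⟩).apply_f₁
  refine ⟨⟨⟨F, G, hGF, hFG⟩, hpar⟩, isMonodromy_iff.2 fun v => ⟨hF1 v, hF2 v⟩, fun g hg => ?_⟩
  replace hg := isMonodromy_iff.1 hg
  exact RootedTreeIso.ext (Equiv.ext fun v =>
    vertex_ext ((hg v).1.trans (hF1 v).symm) ((hg v).2.unique hγ (hF2 v)))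

/-- A loop that passes from one slit plane to another one through the lower half-plane identifies
the branches on the two slit planes there. -/
theorem IsMonodromy.eqOn_branch (ht : 0 < t.im) {γ : Path (t : OnePoint ℂ) t}
    {g : TreeAut (PreimageTree.parent f₁ (t : OnePoint ℂ))} (hg : IsMonodromy γ g) {j k : Side}
    {a₁ : I} (ha₁ : γ a₁ ∈ lowerHalf) (hj : ∀ a ≤ a₁, γ a ∈ slitSphere j)
    (hk : ∀ a, a₁ ≤ a → γ a ∈ slitSphere k) (v : PreimageTree f₁ (t : OnePoint ℂ)) :
    Set.EqOn (branch j v) (branch k (g v)) lowerHalf := by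
  obtain ⟨hlev, Γ, hΓ⟩ := isMonodromy_iff.1 hg v
  have h1 := (isBranch_branch ht j v).eqOn_lift γ.continuous Γ.continuous hΓ
    (isPreconnected_Iic (a := a₁)) hj (Set.mem_Iic.2 (unitInterval.nonneg a₁ : (0 : I) ≤ a₁))
    (by rw [Γ.source, γ.source, branch_base ht]) a₁ Set.self_mem_Iic
  have h2 := (isBranch_branch ht k (g v)).eqOn_lift γ.continuous Γ.continuous
    (fun a => (congrArg (fun n => f₁^[n] (Γ a)) hlev).trans (hΓ a))
    (isPreconnected_Ici (a := a₁)) hk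
    (Set.mem_Ici.2 (unitInterval.le_one a₁ : a₁ ≤ (1 : I)))
    (by rw [Γ.target, γ.target, branch_base ht]) a₁ Set.self_mem_Ici
  exact eqOn_branch_lowerHalf ht hlev.symm ha₁ (h1.symm.trans h2)

end Monodromy

/-! ### The loops around the punctures -/

section Loops

variable {t w z : ℂ} {δ : Path t z}

/-- The circle is traversed in the second quarter of the time. -/
theorem loopAround_apply (w : ℂ) (δ : Path t z) (a : I) :
    (((a : ℝ) ≤ 1 / 4 ∨ 1 / 2 < (a : ℝ)) ∧ ∃ u, loopAround w δ a = δ u) ∨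
      ∃ u : I, (u : ℝ) = 4 * a - 1 ∧ loopAround w δ a = circlePath w z u := by
  simp only [loopAround, Path.map_coe, Function.comp_apply, Path.trans_apply]
  split_ifs with h1 h2
  · left
    refine ⟨Or.inl ?_, _, rfl⟩
    linarith
  · right
    refine ⟨_, ?_, rfl⟩
    ring
  · left
    exact ⟨Or.inr (not_le.1 h1), _, rfl⟩

/-- The angle of the starting point of the circle, in terms of which the circle is given in polar
coordinates. -/
theorem exists_circlePath_eq (hw : w.im = 0) (hz : 0 < z.im) :
    ∃ α : ℝ, 0 < α ∧ α < Real.pi ∧ ∀ s : I,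
      (circlePath w z s).re = w.re + ‖z - w‖ * Real.cos (α + 2 * Real.pi * s) ∧
      (circlePath w z s).im = ‖z - w‖ * Real.sin (α + 2 * Real.pi * s) := by
  have him : 0 < (z - w).im := by rwa [Complex.sub_im, hw, sub_zero]
  have hsin : 0 < Real.sin (z - w).arg := by
    rw [Complex.sin_arg]
    exact div_pos him (norm_pos_iff.2 fun h => by simp [h] at him)
  refine ⟨(z - w).arg, ?_, ?_, fun s => ?_⟩
  · by_contra! h
    exact hsin.not_ge (Real.sin_nonpos_of_nonpos_of_neg_pi_le h (Complex.neg_pi_lt_arg _).le)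
  · refine (Complex.arg_le_pi _).lt_of_ne fun h => ?_
    rw [h, Real.sin_pi] at hsin
    exact hsin.false
  · have h : circlePath w z s = w + ‖z - w‖ *
        Complex.exp ((((z - w).arg + 2 * Real.pi * s : ℝ) : ℂ) * Complex.I) := by
      change w + (z - w) * Complex.exp (2 * Real.pi * (s : ℝ) * Complex.I) = _
      nth_rw 1 [← Complex.norm_mul_exp_arg_mul_I (z - w)]
      rw [mul_assoc, ← Complex.exp_add]
      push_cast
      ring_nf
    rw [h]
    constructor
    · rw [Complex.add_re, Complex.re_ofReal_mul, Complex.exp_ofReal_mul_I_re]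
    · rw [Complex.add_im, Complex.im_ofReal_mul, Complex.exp_ofReal_mul_I_im, hw, zero_add]

/-- A loop around a real point crosses the real line only at the leftmost and at the rightmost point
of its circle: it goes into the lower half-plane through the first one and returns through the
second one. -/
theorem exists_loopAround_split (hw : w.im = 0) (hδ : ∀ s, 0 < (δ s).im) {j k : Side}
    (hj : ((w.re - ‖z - w‖ : ℝ) : ℂ) ∈ slitPlane j)
    (hk : ((w.re + ‖z - w‖ : ℝ) : ℂ) ∈ slitPlane k) :
    ∃ a₁ : I, loopAround w δ a₁ ∈ lowerHalf ∧ (∀ a ≤ a₁, loopAround w δ a ∈ slitSphere j) ∧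
      ∀ a, a₁ ≤ a → loopAround w δ a ∈ slitSphere k := by
  have hz : 0 < z.im := by simpa using hδ 1
  obtain ⟨α, hα0, hαπ, hα⟩ := exists_circlePath_eq hw hz
  have hπ := Real.pi_pos
  have hr : 0 < ‖z - w‖ := norm_pos_iff.2 fun h => by
    rw [sub_eq_zero.1 h, hw] at hz
    exact hz.false
  -- the time at which the circle is at its lowest point
  obtain ⟨σ₁, hσ₁⟩ : ∃ x : ℝ, x = (3 * Real.pi / 2 - α) / (2 * Real.pi) := ⟨_, rfl⟩
  have hmul : 2 * Real.pi * σ₁ = 3 * Real.pi / 2 - α := by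
    rw [hσ₁]; field_simp
  have h0 : 0 < σ₁ := by nlinarith
  have h1 : σ₁ < 1 := by nlinarith
  have hup {q : Side} {u : I} : ((δ u : ℂ) : OnePoint ℂ) ∈ slitSphere q :=
    upperHalf_subset q (coe_mem_upperHalf.2 (hδ u))
  have hpos {q : Side} {x : ℂ} {r θ : ℝ} (hr : 0 < r) (hθ0 : 0 < θ) (hθ : θ < 2 * Real.pi)
      (him : x.im = r * Real.sin θ ∨ x.im = -(r * Real.sin θ))
      (hx : θ = Real.pi → x ∈ slitPlane q) : x ∈ slitPlane q := by
    rcases lt_trichotomy θ Real.pi with h | h | h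
    · have := mul_pos hr (Real.sin_pos_of_pos_of_lt_pi hθ0 h)
      exact mem_slitPlane_of_im_ne (by rcases him with h | h <;> rw [h] <;> linarith)
    · exact hx h
    · have h2 : Real.sin θ < 0 := by
        rw [← Real.sin_sub_two_pi]
        exact Real.sin_neg_of_neg_of_neg_pi_lt (by linarith) (by linarith)
      have := mul_neg_of_pos_of_neg hr h2
      exact mem_slitPlane_of_im_ne (by rcases him with h | h <;> rw [h] <;> linarith)
  refine ⟨⟨(1 + σ₁) / 4, by constructor <;> linarith⟩, ?_, fun a ha => ?_, fun a ha => ?_⟩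
  · rcases loopAround_apply w δ ⟨(1 + σ₁) / 4, by constructor <;> linarith⟩ with
      ⟨h | h, -⟩ | ⟨u, hu, h⟩
    · simp only at h; linarith
    · simp only at h; linarith
    · rw [h, coe_mem_lowerHalf, (hα u).2, hu,
        show α + 2 * Real.pi * (4 * ((1 + σ₁) / 4) - 1) = Real.pi / 2 + Real.pi by linarith,
        Real.sin_add_pi, Real.sin_pi_div_two]
      linarith
  · have ha : (a : ℝ) ≤ (1 + σ₁) / 4 := ha
    rcases loopAround_apply w δ a with ⟨-, u, h⟩ | ⟨u, hu, h⟩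
    · rw [h]; exact hup
    · have hu0 := u.2.1
      rw [h, coe_mem_slitSphere]
      refine hpos hr (θ := α + 2 * Real.pi * u) (by positivity) (by nlinarith) (Or.inl (hα u).2)
        fun h => ?_
      convert hj
      apply Complex.ext
      · rw [(hα u).1, h, Real.cos_pi, Complex.ofReal_re]; ring
      · rw [(hα u).2, h, Real.sin_pi, Complex.ofReal_im, mul_zero]
  · have ha : (1 + σ₁) / 4 ≤ (a : ℝ) := ha
    rcases loopAround_apply w δ a with ⟨-, u, h⟩ | ⟨u, hu, h⟩
    · rw [h]; exact hup
    · have hu1 := u.2.2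
      have hθ : α + 2 * Real.pi * u = α + 2 * Real.pi * u - Real.pi + Real.pi := by ring
      rw [h, coe_mem_slitSphere]
      refine hpos hr (θ := α + 2 * Real.pi * u - Real.pi) (by nlinarith) (by nlinarith)
        (Or.inr ?_) fun h => ?_
      · rw [(hα u).2, hθ, Real.sin_add_pi, ← hθ]; ring
      · have h2 : α + 2 * Real.pi * u = 2 * Real.pi := by linarith
        convert hk
        apply Complex.ext
        · rw [(hα u).1, h2, Real.cos_two_pi, Complex.ofReal_re, mul_one]
        · rw [(hα u).2, h2, Real.sin_two_pi, Complex.ofReal_im, mul_zero]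

end Loops

/-! ### The labelling of the preimage tree by words -/

/-- The half-plane that contains the component `x` of the preimage of the upper half-plane. -/
def tileHalf : Tile → Set (OnePoint ℂ)
  | .A | .B | .C => upperHalf
  | .D | .E | .F => lowerHalf

/-- The half-plane that contains the conjugate of the component `x`. -/
def conjTileHalf : Tile → Set (OnePoint ℂ)
  | .A | .B | .C => lowerHalf
  | .D | .E | .F => upperHalf

theorem image_tileSet_subset (x : Tile) :
    ((↑) : ℂ → OnePoint ℂ) '' tileSet 1 x ⊆ tileHalf x := by
  rintro _ ⟨z, hz, rfl⟩
  have h := sq_im z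
  cases x
  · obtain ⟨-, -, h1, h2⟩ := hz
    refine coe_mem_upperHalf.2 ?_
    by_contra! h3
    nlinarith
  · obtain ⟨-, -, h1, h2⟩ := hz
    refine coe_mem_upperHalf.2 ?_
    by_contra! h3
    nlinarith
  · obtain ⟨-, h1, h2⟩ := hz
    refine coe_mem_upperHalf.2 ?_
    by_contra! h3
    nlinarith
  · obtain ⟨-, -, h1, h2⟩ := hz
    refine coe_mem_lowerHalf.2 ?_
    by_contra! h3
    nlinarith
  · obtain ⟨-, -, h1, h2⟩ := hz
    refine coe_mem_lowerHalf.2 ?_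
    by_contra! h3
    nlinarith
  · obtain ⟨-, h1, h2⟩ := hz
    refine coe_mem_lowerHalf.2 ?_
    by_contra! h3
    nlinarith

theorem image_tileSet_neg_subset (x : Tile) :
    ((↑) : ℂ → OnePoint ℂ) '' tileSet (-1) x ⊆ conjTileHalf x := by
  rintro _ ⟨z, hz, rfl⟩
  have h := image_tileSet_subset x ⟨_, conj_mem_tileSet hz, rfl⟩
  cases x <;> simpa [tileHalf, conjTileHalf, coe_mem_upperHalf, coe_mem_lowerHalf] using h

theorem tileHalf_subset (x : Tile) (j : Side) : tileHalf x ⊆ slitSphere j := by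
  cases x <;> first | exact upperHalf_subset j | exact lowerHalf_subset j

section Labelling

variable {t : ℂ} {X : Type*}

theorem exists_preimage_mem_tileSet (ht : 0 < t.im)
    (p : {p : OnePoint ℂ // f₁ p = (t : OnePoint ℂ)}) :
    ∃ x, p.1 ∈ ((↑) : ℂ → OnePoint ℂ) '' tileSet 1 x :=
  exists_mem_tileSet_of_f₁_mem (by rw [p.2]; exact coe_mem_upperHalf.2 ht)

theorem preimage_mem_slitSphere (ht : 0 < t.im) (j : Side)
    (p : {p : OnePoint ℂ // f₁ p = (t : OnePoint ℂ)}) : p.1 ∈ slitSphere j := by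
  obtain ⟨x, hx⟩ := exists_preimage_mem_tileSet ht p
  exact tileHalf_subset x j (image_tileSet_subset x hx)

/-- The endpoint of the lift, starting at the vertex `v`, of a path that joins the basepoint to its
preimage `p` in the plane slit along `(-∞, -1]` and `[1, ∞)`. -/
noncomputable def graft (ht : 0 < t.im) (v : PreimageTree f₁ (t : OnePoint ℂ))
    (p : {p : OnePoint ℂ // f₁ p = (t : OnePoint ℂ)}) : PreimageTree f₁ (t : OnePoint ℂ) :=
  ⟨v.1 + 1, branch .mid v p, by
    rw [Function.iterate_succ_apply', (isBranch_branch ht .mid v).iterate_apply _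
      (preimage_mem_slitSphere ht .mid p), p.2]⟩

theorem parent_graft_of_zero (ht : 0 < t.im) {v : PreimageTree f₁ (t : OnePoint ℂ)} (h : v.1 = 0)
    (p : {p : OnePoint ℂ // f₁ p = (t : OnePoint ℂ)}) :
    PreimageTree.parent f₁ t (graft ht v p) = v := by
  obtain ⟨n, q, hq⟩ := v
  obtain rfl : n = 0 := h
  refine vertex_ext rfl ?_
  have h1 := (isBranch_branch ht .mid ⟨0, q, hq⟩).iterate_apply _
    (preimage_mem_slitSphere ht .mid p)
  change branch .mid ⟨0, q, hq⟩ p.1 = p.1 at h1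
  change f₁ (branch .mid ⟨0, q, hq⟩ p.1) = q
  rw [h1, p.2]
  exact hq.symm

theorem parent_graft_of_succ (ht : 0 < t.im) {v : PreimageTree f₁ (t : OnePoint ℂ)} {n : ℕ}
    (h : v.1 = n + 1) (p : {p : OnePoint ℂ // f₁ p = (t : OnePoint ℂ)}) :
    PreimageTree.parent f₁ t (graft ht v p) = graft ht (PreimageTree.parent f₁ t v) p := by
  obtain ⟨m, q, hq⟩ := v
  obtain rfl : m = n + 1 := h
  exact vertex_ext rfl (f₁_branch ht .mid hq (preimage_mem_slitSphere ht .mid p)).symm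

theorem graft_injective (ht : 0 < t.im) {v w : PreimageTree f₁ (t : OnePoint ℂ)}
    {p q : {p : OnePoint ℂ // f₁ p = (t : OnePoint ℂ)}} (h : graft ht v p = graft ht w q) :
    v = w ∧ p = q := by
  have hlev : v.1 = w.1 := Nat.succ_injective (congrArg Sigma.fst h)
  have hb : branch .mid v p.1 = branch .mid w q.1 := congrArg (fun u => u.2.1) h
  have hpq : p = q := by
    have h1 := (isBranch_branch ht .mid v).iterate_apply _ (preimage_mem_slitSphere ht .mid p)
    have h2 := (isBranch_branch ht .mid w).iterate_apply _ (preimage_mem_slitSphere ht .mid q)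
    rw [hb, hlev] at h1
    exact Subtype.ext (h1.symm.trans h2)
  subst hpq
  exact ⟨branch_injective ht hlev (preimage_mem_slitSphere ht .mid p) hb, rfl⟩

/-- The vertex that is labelled by a word when the preimages of the basepoint are numbered by the
letters. -/
noncomputable def labelVertex (ht : 0 < t.im)
    (τ : X ≃ {p : OnePoint ℂ // f₁ p = (t : OnePoint ℂ)}) :
    List X → PreimageTree f₁ (t : OnePoint ℂ)
  | [] => ⟨0, t, rfl⟩
  | x :: v => graft ht (labelVertex ht τ v) (τ x)

theorem labelVertex_fst (ht : 0 < t.im)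
    (τ : X ≃ {p : OnePoint ℂ // f₁ p = (t : OnePoint ℂ)}) (v : List X) :
    (labelVertex ht τ v).1 = v.length := by
  induction v with
  | nil => rfl
  | cons x v ih => exact congrArg Nat.succ ih

theorem labelVertex_dropLast (ht : 0 < t.im)
    (τ : X ≃ {p : OnePoint ℂ // f₁ p = (t : OnePoint ℂ)}) (v : List X) :
    labelVertex ht τ v.dropLast = PreimageTree.parent f₁ t (labelVertex ht τ v) := by
  induction v with
  | nil => rfl
  | cons x v ih =>
    cases v with
    | nil => exact (parent_graft_of_zero ht rfl (τ x)).symm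
    | cons y v =>
      rw [List.dropLast_cons_cons]
      refine Eq.trans ?_ (parent_graft_of_succ ht (labelVertex_fst ht τ (y :: v)) (τ x)).symm
      rw [← ih]
      rfl

theorem bijective_labelVertex (ht : 0 < t.im)
    (τ : X ≃ {p : OnePoint ℂ // f₁ p = (t : OnePoint ℂ)}) :
    Function.Bijective (labelVertex ht τ) := by
  constructor
  · intro v
    induction v with
    | nil =>
      intro w h
      have := congrArg Sigma.fst h
      rw [labelVertex_fst, labelVertex_fst] at this
      exact (List.length_eq_zero_iff.1 this.symm).symm
    | cons x v ih =>
      intro w h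
      cases w with
      | nil =>
        have := congrArg Sigma.fst h
        rw [labelVertex_fst, labelVertex_fst] at this
        simp at this
      | cons y w =>
        obtain ⟨h1, h2⟩ := graft_injective ht h
        rw [ih h1, τ.injective h2]
  · rintro ⟨n, q, hq⟩
    induction n generalizing q with
    | zero => exact ⟨[], vertex_ext rfl hq.symm⟩
    | succ n ih =>
      rw [Function.iterate_succ_apply'] at hq
      obtain ⟨⟨m, r, hr⟩, hm, hb⟩ := exists_branch_eq ht (j := .mid) (n := n) (p := q)
        (preimage_mem_slitSphere ht .mid ⟨_, hq⟩) rfl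
      obtain rfl : m = n := hm
      obtain ⟨v, hv⟩ := ih r hr
      refine ⟨τ.symm ⟨_, hq⟩ :: v, ?_⟩
      rw [labelVertex, hv, Equiv.apply_symm_apply]
      exact vertex_ext rfl hb

/-- A path in a slit plane that starts at the basepoint is lifted by the branches. -/
theorem liftConnects_branch (ht : 0 < t.im) {j : Side} {y : OnePoint ℂ}
    {γ : Path (t : OnePoint ℂ) y} (hγ : ∀ s, γ s ∈ slitSphere j)
    (v : PreimageTree f₁ (t : OnePoint ℂ)) :
    LiftConnects f₁ v.1 γ v.2.1 (branch j v y) := by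
  have hb := isBranch_branch ht j v
  refine ⟨⟨⟨fun s => branch j v (γ s), hb.continuousOn.comp_continuous γ.continuous hγ⟩, ?_, ?_⟩,
    fun s => hb.iterate_apply _ (hγ s)⟩
  · change branch j v (γ 0) = _
    rw [γ.source, branch_base ht]
  · change branch j v (γ 1) = _
    rw [γ.target]

theorem isLabeling_iff (ht : 0 < t.im) {τ : X ≃ {p : OnePoint ℂ // f₁ p = (t : OnePoint ℂ)}}
    {ℓ : ∀ x, Path (t : OnePoint ℂ) (τ x).1} (hℓ : ∀ x s, ℓ x s ∈ slitSphere .mid)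
    {Λ : RootedTreeIso (List.dropLast : List X → List X)
      (PreimageTree.parent f₁ (t : OnePoint ℂ))} :
    IsLabeling ℓ Λ ↔ ∀ v, Λ v = labelVertex ht τ v := by
  constructor
  · intro h v
    induction v with
    | nil =>
      have h1 : Λ [] = PreimageTree.parent f₁ t (Λ []) := Λ.map_parent []
      have h2 : (Λ []).1 = 0 := by
        by_contra h0
        obtain ⟨n, hn⟩ := Nat.exists_eq_succ_of_ne_zero h0
        have := (parent_of_fst_eq_succ hn).1
        rw [← h1, hn] at this
        omega
      generalize Λ [] = r at h2
      obtain ⟨m, q, hq⟩ := r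
      obtain rfl : m = 0 := h2
      exact vertex_ext rfl hq
    | cons x v ih =>
      obtain ⟨p, q, hp, hq, hl⟩ := h x v
      have h1 : LiftConnects f₁ v.length (ℓ x) p.1 (branch .mid (Λ v) (τ x)) := by
        have := liftConnects_branch ht (hℓ x) (Λ v)
        rw [hp] at this ⊢
        exact this
      rw [labelVertex, ← ih, hq]
      refine vertex_ext (by rw [hp]; rfl) ?_
      exact hl.unique (fun s => slitSphere_subset _ (hℓ x s)) h1
  · intro h x v
    have hlev := labelVertex_fst ht τ v
    have hx : Λ (x :: v) = graft ht (Λ v) (τ x) := by rw [h, h, labelVertex]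
    have hl := liftConnects_branch ht (hℓ x) (Λ v)
    rw [← h] at hlev
    rw [hx]
    generalize Λ v = w at hlev hl
    obtain ⟨m, q, hq⟩ := w
    obtain rfl : m = v.length := hlev
    exact ⟨⟨q, hq⟩, _, rfl, rfl, hl⟩

theorem existsUnique_isLabeling (ht : 0 < t.im)
    {τ : X ≃ {p : OnePoint ℂ // f₁ p = (t : OnePoint ℂ)}}
    {ℓ : ∀ x, Path (t : OnePoint ℂ) (τ x).1} (hℓ : ∀ x s, ℓ x s ∈ slitSphere .mid) :
    ∃! Λ : RootedTreeIso (List.dropLast : List X → List X)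
      (PreimageTree.parent f₁ (t : OnePoint ℂ)), IsLabeling ℓ Λ := by
  refine ⟨⟨Equiv.ofBijective _ (bijective_labelVertex ht τ), labelVertex_dropLast ht τ⟩,
    (isLabeling_iff ht hℓ).2 fun _ => rfl, fun Λ hΛ => ?_⟩
  exact RootedTreeIso.ext (Equiv.ext ((isLabeling_iff ht hℓ).1 hΛ))

end Labelling

/-! ### The wreath recursion -/

section Recursion

variable {t : ℂ} {X : Type*}

theorem exists_tileEquiv (ht : 0 < t.im) [Fintype X] (hX : Fintype.card X = 6)
    (τ : X ≃ {p : OnePoint ℂ // f₁ p = (t : OnePoint ℂ)}) :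
    ∃ e : Tile ≃ X, ∀ x, (τ (e x)).1 ∈ ((↑) : ℂ → OnePoint ℂ) '' tileSet 1 x := by
  choose T hT using fun x => exists_preimage_mem_tileSet ht (τ x)
  have hinj : Function.Injective T := fun x y h => τ.injective <| Subtype.ext <|
    eq_of_mem_tileSet (coe_mem_upperHalf.2 ht) (τ x).2 (τ y).2 (hT x) (h ▸ hT y)
  have hbij : Function.Bijective T :=
    (Fintype.bijective_iff_injective_and_card T).2 ⟨hinj, hX⟩
  refine ⟨(Equiv.ofBijective T hbij).symm, fun x => ?_⟩
  have := hT ((Equiv.ofBijective T hbij).symm x)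
  rwa [show T ((Equiv.ofBijective T hbij).symm x) = x from
    (Equiv.ofBijective T hbij).apply_symm_apply x] at this

/-- A branch of level `n + 1` is the composition of a branch of level `1` and one of level `n`. -/
theorem branch_graft (ht : 0 < t.im) {j k : Side} {v w : PreimageTree f₁ (t : OnePoint ℂ)}
    (hlev : w.1 = v.1) {p : {p : OnePoint ℂ // f₁ p = (t : OnePoint ℂ)}}
    (hmaps : Set.MapsTo (branch j (⟨1, p⟩ : PreimageTree f₁ (t : OnePoint ℂ))) (slitSphere j)
      (slitSphere k)) (h : branch .mid v p = branch k w p) :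
    Set.EqOn (branch j (graft ht v p))
      (fun q => branch k w (branch j (⟨1, p⟩ : PreimageTree f₁ (t : OnePoint ℂ)) q))
      (slitSphere j) := by
  have h1 := isBranch_branch ht j (⟨1, p⟩ : PreimageTree f₁ (t : OnePoint ℂ))
  have hw : IsBranch k v.1 (branch k w) := hlev ▸ isBranch_branch ht k w
  refine (isBranch_branch ht j (graft ht v p)).eqOn (isPreconnected_slitSphere j) le_rfl
    (hw.continuousOn.comp h1.continuousOn hmaps) (fun q hq => ?_)
    (upperHalf_subset j (coe_mem_upperHalf.2 ht)) ?_
  · change f₁^[v.1 + 1] _ = q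
    rw [Function.iterate_succ_apply', hw.iterate_apply _ (hmaps hq)]
    exact h1.iterate_apply q hq
  · rw [branch_base ht, branch_base ht]
    exact h

/-- One entry of the wreath recursion of an automorphism that identifies the branches on the slit
planes `j` and `k` along the lower half-plane. The branches of level `1` that start in the
components `x` and `y` agree on the lower half-plane, and the branches of level `n` have to be
compared in three places: at the preimages of the basepoint in `x` and `y`, and at the common
preimage of a point of the lower half-plane. -/
theorem apply_graft_eq (ht : 0 < t.im) {g : TreeAut (PreimageTree.parent f₁ (t : OnePoint ℂ))}
    (hglev : ∀ v, (g v).1 = v.1) {j k : Side}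
    (hg : ∀ v, Set.EqOn (branch j v) (branch k (g v)) lowerHalf) {x y : Tile}
    (hxy : cross j x = cross k y) {p q : {p : OnePoint ℂ // f₁ p = (t : OnePoint ℂ)}}
    (hp : p.1 ∈ ((↑) : ℂ → OnePoint ℂ) '' tileSet 1 x)
    (hq : q.1 ∈ ((↑) : ℂ → OnePoint ℂ) '' tileSet 1 y)
    {v v' w w' : PreimageTree f₁ (t : OnePoint ℂ)} (hv' : v'.1 = v.1) (hw : w.1 = v.1)
    (hw' : w'.1 = v.1)
    (h1 : Set.EqOn (branch .mid v) (branch (target j x) w) (tileHalf x))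
    (h2 : Set.EqOn (branch .mid v') (branch (target k y) w') (tileHalf y))
    (h3 : Set.EqOn (branch (target j x) w) (branch (target k y) w') (conjTileHalf (cross j x))) :
    g (graft ht v p) = graft ht v' q := by
  have htu : (t : OnePoint ℂ) ∈ upperHalf := coe_mem_upperHalf.2 ht
  obtain ⟨r, hr⟩ : ∃ r : OnePoint ℂ, r ∈ lowerHalf :=
    ⟨((-Complex.I : ℂ) : OnePoint ℂ), coe_mem_lowerHalf.2 (by simp)⟩
  let sj := branch j (⟨1, p⟩ : PreimageTree f₁ (t : OnePoint ℂ))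
  let sk := branch k (⟨1, q⟩ : PreimageTree f₁ (t : OnePoint ℂ))
  have hsj : IsBranch j 1 sj := isBranch_branch ht j ⟨1, p⟩
  have hsk : IsBranch k 1 sk := isBranch_branch ht k ⟨1, q⟩
  have hj : sj t ∈ ((↑) : ℂ → OnePoint ℂ) '' tileSet 1 x := by
    rw [show sj t = p.1 from branch_base ht j ⟨1, p⟩]; exact hp
  have hk : sk t ∈ ((↑) : ℂ → OnePoint ℂ) '' tileSet 1 y := by
    rw [show sk t = q.1 from branch_base ht k ⟨1, q⟩]; exact hq
  have hmj := hsj.mem_tileSet_cross htu hj r hr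
  have hmk := hsk.mem_tileSet_cross htu hk r hr
  rw [← hxy] at hmk
  have hm : sj r = sk r := eq_of_mem_tileSet_neg hr
    (hsj.iterate_apply r (lowerHalf_subset j hr)) (hsk.iterate_apply r (lowerHalf_subset k hr))
    hmj hmk
  refine branch_injective ht (j := k) ?_ (lowerHalf_subset k hr) ?_
  · rw [hglev]
    exact congrArg Nat.succ hv'.symm
  · rw [← hg _ hr, branch_graft ht hw (hsj.mapsTo_target htu hj) (h1 (image_tileSet_subset x hp))
      (lowerHalf_subset j hr), branch_graft ht (hw'.trans hv'.symm) (hsk.mapsTo_target htu hk)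
      (h2 (image_tileSet_subset y hq)) (lowerHalf_subset k hr)]
    change branch (target j x) w (sj r) = branch (target k y) w' (sk r)
    rw [← hm]
    exact h3 (image_tileSet_neg_subset _ hmj)

theorem sends_pullback (ht : 0 < t.im) {τ : X ≃ {p : OnePoint ℂ // f₁ p = (t : OnePoint ℂ)}}
    {Λ : RootedTreeIso (List.dropLast : List X → List X)
      (PreimageTree.parent f₁ (t : OnePoint ℂ))} (hΛ : ∀ v, Λ v = labelVertex ht τ v)
    {g h : TreeAut (PreimageTree.parent f₁ (t : OnePoint ℂ))} {x y : X}
    (hgh : ∀ v, g (graft ht v (τ x)) = graft ht (h v) (τ y)) :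
    WordAut.Sends (TreeAut.pullback Λ g) x (TreeAut.pullback Λ h) y := by
  have hcons (x : X) (v : List X) : Λ (x :: v) = graft ht (Λ v) (τ x) := by
    rw [hΛ, hΛ, labelVertex]
  intro u
  change Λ.toEquiv.symm (g (Λ (x :: u))) = y :: Λ.toEquiv.symm (h (Λ u))
  rw [Equiv.symm_apply_eq, hcons, hcons, Equiv.apply_symm_apply, hgh]

/-- In an entry of the recursion of `b`, the branches of `v` and of `h v` on the middle slit plane
are both compared with the branch of `k v` on the slit plane `target .right y`. Such a comparison is
trivial in the upper half-plane, and introduces `b` or `c⁻¹` in the lower half-plane. For `c` only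
the middle slit plane occurs, so that all its sections are trivial. -/
theorem isGeneratingPair_pullback (ht : 0 < t.im)
    {τ : X ≃ {p : OnePoint ℂ // f₁ p = (t : OnePoint ℂ)}}
    {Λ : RootedTreeIso (List.dropLast : List X → List X)
      (PreimageTree.parent f₁ (t : OnePoint ℂ))} (hΛ : ∀ v, Λ v = labelVertex ht τ v)
    {b c : TreeAut (PreimageTree.parent f₁ (t : OnePoint ℂ))} (hblev : ∀ v, (b v).1 = v.1)
    (hclev : ∀ v, (c v).1 = v.1)
    (hb : ∀ v, Set.EqOn (branch .mid v) (branch .right (b v)) lowerHalf)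
    (hc : ∀ v, Set.EqOn (branch .left v) (branch .mid (c v)) lowerHalf)
    {e : Tile ≃ X} (he : ∀ x, (τ (e x)).1 ∈ ((↑) : ℂ → OnePoint ℂ) '' tileSet 1 x) :
    IsGeneratingPair e (TreeAut.pullback Λ b) (TreeAut.pullback Λ c) := by
  have hb' (v) : Set.EqOn (branch .mid (b⁻¹ v)) (branch .right v) lowerHalf := by
    simpa only [TreeAut.apply_inv_self] using hb (b⁻¹ v)
  have hc' (v) : Set.EqOn (branch .mid v) (branch .left (c⁻¹ v)) lowerHalf := by
    have := (hc (c⁻¹ v)).symm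
    rwa [TreeAut.apply_inv_self] at this
  have hb2 (v) : (b⁻¹ v).1 = v.1 := by
    have := hblev (b⁻¹ v)
    rwa [TreeAut.apply_inv_self, eq_comm] at this
  have hc2 (v) : (c⁻¹ v).1 = v.1 := by
    have := hclev (c⁻¹ v)
    rwa [TreeAut.apply_inv_self, eq_comm] at this
  have up (j k v) := eqOn_branch_upperHalf (t := t) ht j k v
  have hinv (g : TreeAut (PreimageTree.parent f₁ (t : OnePoint ℂ))) :
      (TreeAut.pullback Λ g)⁻¹ = TreeAut.pullback Λ g⁻¹ := (map_inv _ g).symm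
  have hone : (1 : WordAut X) = TreeAut.pullback Λ 1 := (map_one _).symm
  have rec_b (x y : Tile) (hxy : cross .mid x = cross .right y)
      {h : TreeAut (PreimageTree.parent f₁ (t : OnePoint ℂ))} (hlev : ∀ v, (h v).1 = v.1)
      (k : TreeAut (PreimageTree.parent f₁ (t : OnePoint ℂ))) (hklev : ∀ v, (k v).1 = v.1)
      (h2 : ∀ v, Set.EqOn (branch .mid (h v)) (branch (target .right y) (k v)) (tileHalf y))
      (h3 : ∀ v, Set.EqOn (branch .mid v) (branch (target .right y) (k v))
        (conjTileHalf (cross .mid x))) :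
      WordAut.Sends (TreeAut.pullback Λ b) (e x) (TreeAut.pullback Λ h) (e y) :=
    sends_pullback ht hΛ fun v => apply_graft_eq ht hblev hb hxy (he x) (he y) (hlev v) rfl
      (hklev v) (Set.eqOn_refl _ _) (h2 v) (h3 v)
  have rec_c (x y : Tile) (hxy : cross .left x = cross .mid y) :
      WordAut.Sends (TreeAut.pullback Λ c) (e x) 1 (e y) := by
    rw [hone]
    exact sends_pullback ht hΛ fun v => apply_graft_eq ht hclev hc hxy (he x) (he y) rfl rfl rfl
      (Set.eqOn_refl _ _) (Set.eqOn_refl _ _) (Set.eqOn_refl _ _)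
  have one_lev (v : PreimageTree f₁ (t : OnePoint ℂ)) :
      ((1 : TreeAut (PreimageTree.parent f₁ (t : OnePoint ℂ))) v).1 = v.1 := rfl
  refine ⟨?_, ?_, ?_, ?_, ?_, ?_, rec_c _ _ rfl, rec_c _ _ rfl, rec_c _ _ rfl, rec_c _ _ rfl,
    rec_c _ _ rfl, rec_c _ _ rfl⟩
  · exact rec_b .A .A rfl hblev b hblev (fun v => up .mid .right (b v)) hb
  · rw [hinv]
    exact rec_b .B .F rfl hb2 1 one_lev hb' fun v => up .mid .right v
  · rw [hone]
    exact rec_b .C .B rfl one_lev 1 one_lev (fun v => up .mid .right v) fun v => up .mid .right v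
  · exact rec_b .D .D rfl hclev 1 one_lev (fun v => (hc v).symm) fun v => up .mid .left v
  · rw [hinv]
    exact rec_b .E .C rfl hc2 c⁻¹ hc2 (fun v => up .mid .left _) hc'
  · rw [hone]
    exact rec_b .F .E rfl one_lev c⁻¹ hc2 hc' hc'

end Recursion

/-! ### The two loops generate the iterated monodromy group -/

section Generation

variable {t : ℂ}

theorem eq_or_im_ne_zero_of_mem_slitPlane {i j : Side} {z : ℂ} (hi : z ∈ slitPlane i)
    (hj : z ∈ slitPlane j) : i = j ∨ z.im ≠ 0 := by
  by_cases hz : z.im = 0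
  swap
  · exact Or.inr hz
  left
  cases i <;> cases j <;> first
    | rfl
    | (have hi := hi.resolve_left (not_not.2 hz)
       have hj := hj.resolve_left (not_not.2 hz)
       linarith)

theorem exists_mem_slitSphere {q : OnePoint ℂ} (hq : q ∈ puncturedSphere) :
    ∃ j, q ∈ slitSphere j := by
  induction q using OnePoint.rec with
  | infty => exact absurd rfl hq.1
  | coe z =>
    obtain ⟨h1, h2⟩ := coe_mem_puncturedSphere.1 hq
    by_cases hz : z.im = 0
    swap
    · exact ⟨.mid, coe_mem_slitSphere.2 (mem_slitPlane_of_im_ne hz)⟩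
    have hr1 : z.re ≠ 1 := fun h => h1 (Complex.ext h hz)
    have hr2 : z.re ≠ -1 := fun h => h2 (Complex.ext h (by simpa using hz))
    rcases hr2.lt_or_gt with h | h
    · exact ⟨.left, coe_mem_slitSphere.2 (Or.inr h)⟩
    · rcases hr1.lt_or_gt with h' | h'
      · exact ⟨.mid, coe_mem_slitSphere.2 (Or.inr ⟨h, h'⟩)⟩
      · exact ⟨.right, coe_mem_slitSphere.2 (Or.inr h')⟩

variable {b c : TreeAut (PreimageTree.parent f₁ (t : OnePoint ℂ))}

/-- On the common part of two slit planes the branches on the first one are those on the second one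
up to an element of the group generated by `b` and `c`. -/
theorem exists_branch_change (ht : 0 < t.im) (hblev : ∀ v, (b v).1 = v.1)
    (hclev : ∀ v, (c v).1 = v.1)
    (hb : ∀ v, Set.EqOn (branch .mid v) (branch .right (b v)) lowerHalf)
    (hc : ∀ v, Set.EqOn (branch .left v) (branch .mid (c v)) lowerHalf) {i j : Side}
    {q : OnePoint ℂ} (hi : q ∈ slitSphere i) (hj : q ∈ slitSphere j) :
    ∃ k ∈ Subgroup.closure {b, c}, ∀ v, (k v).1 = v.1 ∧ branch i v q = branch j (k v) q := by
  obtain ⟨z, hz, rfl⟩ := hi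
  rcases eq_or_im_ne_zero_of_mem_slitPlane hz (coe_mem_slitSphere.1 hj) with rfl | him
  · exact ⟨1, one_mem _, fun v => ⟨rfl, rfl⟩⟩
  rcases him.lt_or_gt with him | him
  swap
  · exact ⟨1, one_mem _, fun v => ⟨rfl, eqOn_branch_upperHalf ht i j v (coe_mem_upperHalf.2 him)⟩⟩
  have hq := coe_mem_lowerHalf.2 him
  have hbK : b ∈ Subgroup.closure {b, c} := Subgroup.subset_closure (Or.inl rfl)
  have hcK : c ∈ Subgroup.closure {b, c} := Subgroup.subset_closure (Or.inr rfl)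
  have key (i : Side) : ∃ k ∈ Subgroup.closure {b, c},
      ∀ v, (k v).1 = v.1 ∧ branch i v (z : OnePoint ℂ) = branch .mid (k v) (z : OnePoint ℂ) := by
    cases i
    · exact ⟨1, one_mem _, fun v => ⟨rfl, rfl⟩⟩
    · refine ⟨b⁻¹, inv_mem hbK, fun v => ⟨?_, ?_⟩⟩
      · rw [← hblev (b⁻¹ v), TreeAut.apply_inv_self]
      · rw [hb _ hq, TreeAut.apply_inv_self]
    · exact ⟨c, hcK, fun v => ⟨hclev v, hc v hq⟩⟩
  obtain ⟨k, hk, hk'⟩ := key i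
  obtain ⟨l, hl, hl'⟩ := key j
  refine ⟨k * l⁻¹, mul_mem hk (inv_mem hl), fun v => ?_⟩
  have h := hl' (l⁻¹ (k v))
  rw [TreeAut.apply_inv_self] at h
  rw [TreeAut.mul_apply]
  exact ⟨h.1.symm.trans (hk' v).1, (hk' v).2.trans h.2.symm⟩

/-- The lifts of a loop follow, on each stretch of the loop that stays in a slit plane, the branches
permuted by a fixed element of the group generated by `b` and `c`. -/
theorem IsMonodromy.mem_closure (ht : 0 < t.im) (hblev : ∀ v, (b v).1 = v.1)
    (hclev : ∀ v, (c v).1 = v.1)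
    (hb : ∀ v, Set.EqOn (branch .mid v) (branch .right (b v)) lowerHalf)
    (hc : ∀ v, Set.EqOn (branch .left v) (branch .mid (c v)) lowerHalf)
    {γ : Path (t : OnePoint ℂ) t} (hγ : ∀ a, γ a ∈ puncturedSphere)
    {g : TreeAut (PreimageTree.parent f₁ (t : OnePoint ℂ))} (hg : IsMonodromy γ g) :
    g ∈ Subgroup.closure {b, c} := by
  rw [isMonodromy_iff] at hg
  choose hglev Γ hΓ using hg
  let Q : I → Prop := fun a => ∃ j, γ a ∈ slitSphere j ∧ ∃ k ∈ Subgroup.closure {b, c},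
    ∀ v, (k v).1 = v.1 ∧ Γ v a = branch j (k v) (γ a)
  have htu (j : Side) : (t : OnePoint ℂ) ∈ slitSphere j :=
    upperHalf_subset j (coe_mem_upperHalf.2 ht)
  have hQ0 : Q 0 := by
    refine ⟨.mid, by rw [γ.source]; exact htu _, 1, one_mem _, fun v => ⟨rfl, ?_⟩⟩
    rw [(Γ v).source, γ.source, TreeAut.one_apply, branch_base ht]
  have hstep {J : Set I} (hJ : IsPreconnected J) {j : Side} (hj : ∀ a ∈ J, γ a ∈ slitSphere j)
      {a a' : I} (ha : a ∈ J) (ha' : a' ∈ J) (hQ : Q a) : Q a' := by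
    obtain ⟨i, hi, k, hk, hkv⟩ := hQ
    obtain ⟨l, hl, hlv⟩ := exists_branch_change ht hblev hclev hb hc hi (hj a ha)
    refine ⟨j, hj a' ha', k * l, mul_mem hk hl, fun v => ?_⟩
    rw [TreeAut.mul_apply]
    have hlev : (l (k v)).1 = v.1 := (hlv (k v)).1.trans (hkv v).1
    refine ⟨hlev, ?_⟩
    exact (isBranch_branch ht j (l (k v))).eqOn_lift γ.continuous (Γ v).continuous
      (fun a => (congrArg (fun n => f₁^[n] (Γ v a)) hlev).trans (hΓ v a)) hJ hj ha
      ((hkv v).2.trans (hlv (k v)).2) a' ha'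
  have hQ : Q 0 → Q 1 := by
    -- an initial and a final point on a short stretch of the loop may be interchanged
    refine PreconnectedSpace.induction₂' (fun a a' => Q a → Q a') (fun a => ?_)
      ⟨fun _ _ _ h h' hQ => h' (h hQ)⟩ 0 1
    obtain ⟨j, hj⟩ := exists_mem_slitSphere (hγ a)
    obtain ⟨l, u, ha, hnhds, hsub⟩ := exists_Icc_mem_subset_of_mem_nhds
      (γ.continuous.continuousAt.preimage_mem_nhds ((isOpen_slitSphere j).mem_nhds hj))
    filter_upwards [hnhds] with a' ha'
    exact ⟨hstep isPreconnected_Icc hsub ha ha', hstep isPreconnected_Icc hsub ha' ha⟩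
  obtain ⟨j, -, k, hk, hkv⟩ := hQ hQ0
  have hgk : g = k := by
    refine RootedTreeIso.ext (Equiv.ext fun v => vertex_ext ((hglev v).trans (hkv v).1.symm) ?_)
    have := (hkv v).2
    rwa [(Γ v).target, γ.target, branch_base ht] at this
  rwa [hgk]

end Generation

theorem mem_slitSphere_mid_of_notMem_realSlits {q : OnePoint ℂ} (hq : q ∉ realSlits) :
    q ∈ slitSphere .mid := by
  induction q using OnePoint.rec with
  | infty => exact absurd (Or.inl rfl) hq
  | coe z =>
    refine coe_mem_slitSphere.2 ?_
    by_cases hz : z.im = 0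
    · have : |z.re| < 1 := by
        by_contra! h
        exact hq (Or.inr ⟨z, ⟨hz, h⟩, rfl⟩)
      exact Or.inr (abs_lt.1 this)
    · exact Or.inl hz

theorem mainTheorem9
    -- a basepoint in the upper half-plane
    (t : ℂ) (ht : 0 < t.im)
    -- a numbering of its preimages, and connecting paths that avoid `[-∞, -1] ∪ [1, ∞]`
    (τ : Fin 6 ≃ {p : OnePoint ℂ // f₁ p = (t : OnePoint ℂ)})
    (ℓ : ∀ j : Fin 6, Path (t : OnePoint ℂ) (τ j).1)
    (hℓ : ∀ j s, ℓ j s ∉ realSlits)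
    -- paths in the upper half-plane from `t` to small circles around `1` and `-1`
    (zb zc : ℂ) (hzb : ‖zb - 1‖ < 2) (hzc : ‖zc - (-1)‖ < 2)
    (δb : Path t zb) (hδb : ∀ s, 0 < (δb s).im)
    (δc : Path t zc) (hδc : ∀ s, 0 < (δc s).im) :
    ∃ ht' : (t : OnePoint ℂ) ∉ postcriticalSet f₁,
      (∃! Λ : RootedTreeIso (List.dropLast : List (Fin 6) → List (Fin 6))
        (PreimageTree.parent f₁ (t : OnePoint ℂ)), IsLabeling ℓ Λ) ∧
      (∃! b : TreeAut (PreimageTree.parent f₁ (t : OnePoint ℂ)),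
        IsMonodromy (loopAround 1 δb) b) ∧
      (∃! c : TreeAut (PreimageTree.parent f₁ (t : OnePoint ℂ)),
        IsMonodromy (loopAround (-1) δc) c) ∧
      ∀ (Λ : RootedTreeIso (List.dropLast : List (Fin 6) → List (Fin 6))
          (PreimageTree.parent f₁ (t : OnePoint ℂ)))
        (b c : TreeAut (PreimageTree.parent f₁ (t : OnePoint ℂ))),
        IsLabeling ℓ Λ → IsMonodromy (loopAround 1 δb) b →
        IsMonodromy (loopAround (-1) δc) c →
        b ∈ IMG f₁ t ht' ∧ c ∈ IMG f₁ t ht' ∧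
        IsRegularBranchOver ((IMG f₁ t ht').map (TreeAut.pullback Λ))
          (normalClosureIn ((IMG f₁ t ht').map (TreeAut.pullback Λ))
            (TreeAut.pullback Λ (rightCommutator (b ^ 2) c))) := by
  have hpost (q : OnePoint ℂ) : q ∉ postcriticalSet f₁ ↔ q ∈ puncturedSphere := by
    rw [postcriticalSet_f₁, Set.notMem_compl_iff]
  have hℓ' (x s) : ℓ x s ∈ slitSphere .mid := mem_slitSphere_mid_of_notMem_realSlits (hℓ x s)
  have hpos {z w : ℂ} (hw : w.im = 0) {δ : Path t z} (hδ : ∀ s, 0 < (δ s).im) :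
      0 < ‖z - w‖ := norm_pos_iff.2 fun h => by
    have hz := hδ 1
    rw [δ.target, sub_eq_zero.1 h, hw] at hz
    exact hz.false
  have hrb := hpos Complex.one_im hδb
  have him : (-1 : ℂ).im = 0 := by simp
  have hrc := hpos him hδc
  obtain ⟨ab, hb0, hb1, hb2⟩ := exists_loopAround_split (j := .mid) (k := .right)
    Complex.one_im hδb
    (Or.inr (by rw [Complex.ofReal_re, Complex.one_re]; constructor <;> linarith))
    (Or.inr (by rw [Complex.ofReal_re, Complex.one_re]; linarith))
  obtain ⟨ac, hc0, hc1, hc2⟩ := exists_loopAround_split (j := .left) (k := .mid) him hδc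
    (Or.inr (by rw [Complex.ofReal_re, Complex.neg_re, Complex.one_re]; linarith))
    (Or.inr (by rw [Complex.ofReal_re, Complex.neg_re, Complex.one_re]; constructor <;> linarith))
  have hbB (a : I) : loopAround 1 δb a ∈ puncturedSphere :=
    (le_total a ab).elim (fun h => slitSphere_subset _ (hb1 a h))
      fun h => slitSphere_subset _ (hb2 a h)
  have hcB (a : I) : loopAround (-1) δc a ∈ puncturedSphere :=
    (le_total a ac).elim (fun h => slitSphere_subset _ (hc1 a h))
      fun h => slitSphere_subset _ (hc2 a h)
  have ht' : (t : OnePoint ℂ) ∉ postcriticalSet f₁ :=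
    (hpost _).2 (slitSphere_subset .mid (upperHalf_subset .mid (coe_mem_upperHalf.2 ht)))
  refine ⟨ht', existsUnique_isLabeling ht hℓ', existsUnique_isMonodromy hbB,
    existsUnique_isMonodromy hcB, fun Λ b c hΛ hb hc => ?_⟩
  have hbG : b ∈ IMG f₁ t ht' := ⟨_, fun s => (hpost _).2 (hbB s), hb⟩
  have hcG : c ∈ IMG f₁ t ht' := ⟨_, fun s => (hpost _).2 (hcB s), hc⟩
  refine ⟨hbG, hcG, ?_⟩
  have hblev (v) : (b v).1 = v.1 := (isMonodromy_iff.1 hb v).1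
  have hclev (v) : (c v).1 = v.1 := (isMonodromy_iff.1 hc v).1
  have hbr := hb.eqOn_branch ht hb0 hb1 hb2
  have hcr := hc.eqOn_branch ht hc0 hc1 hc2
  have hgen : IMG f₁ t ht' = Subgroup.closure {b, c} := by
    refine le_antisymm ?_ ((Subgroup.closure_le _).2 ?_)
    · rintro g ⟨γ, hγ, hg⟩
      exact hg.mem_closure ht hblev hclev hbr hcr fun s => (hpost _).1 (hγ s)
    · rintro g (rfl | rfl)
      · exact hbG
      · exact hcG
  obtain ⟨e, he⟩ := exists_tileEquiv ht (Fintype.card_fin 6) τ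
  have hpair := isGeneratingPair_pullback ht ((isLabeling_iff ht hℓ').1 hΛ) hblev hclev hbr hcr he
  have hcomm : TreeAut.pullback Λ (rightCommutator (b ^ 2) c) =
      rightCommutator (TreeAut.pullback Λ b ^ 2) (TreeAut.pullback Λ c) := by
    simp only [rightCommutator, map_mul, map_inv, map_pow]
  rw [hgen, MonoidHom.map_closure, Set.image_pair, hcomm]
  exact hpair.isRegularBranchOver
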